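/- Let $n\ge 0$. A composition is a tuple $\eta=(\eta_1,\dots,\eta_n)$ of non-negative integers, and a partition is a weakly decreasing composition. Let $\eta^+$ and $\eta^R$ be the weakly decreasing and the weakly increasing rearrangement of $\eta$, and put $f_j=\#\{i:\eta_i=j\}$. For a node $s=(i,j)$ of $\eta$ ($1\le i\le n$, $1\le j\le\eta_i$) put $a(s)=\eta_i-j$, $a'(s)=j-1$, $l(s)=\#\{k>i: j\le\eta_k\le\eta_i\}+\#\{k<i: j\le\eta_k+1\le\eta_i\}$, $l'(s)=\#\{k<i:\eta_k\ge\eta_i\}+\#\{k>i:\eta_k>\eta_i\}$, and define $$d_\eta=\prod_{s\in\eta}(1-q^{a(s)+1}t^{l(s)+1}),\quad d'_\eta=\prod_{s\in\eta}(1-q^{a(s)+1}t^{l(s)}),\quad h_\eta=\prod_{s\in\eta}(1-q^{a(s)}t^{l(s)+1}),$$ $$e_\eta=\prod_{s\in\eta}(1-q^{a'(s)+1}t^{n-l'(s)}),\quad e'_\eta=\prod_{s\in\eta}(1-q^{a'(s)+1}t^{n-1-l'(s)}),\quad b_\eta=\prod_{s\in\eta}(1-q^{a'(s)}t^{n-l'(s)}),$$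 $l(\eta)=\sum_{s\in\eta}l(s)$ and $[k]_t!=\prod_{i=1}^k\frac{1-t^i}{1-t}$. For a partition $\kappa$ let $P_\kappa=P_\kappa(x;q,t)$ be the symmetric Macdonald polynomial in $x=(x_1,\dots,x_n)$, that is, the unique polynomial of the form $m_\kappa+\sum_{\mu<\kappa}u_{\kappa\mu}m_\mu$ (with $m_\mu$ the monomial symmetric functions and $<$ the dominance order on partitions of the same modulus) that is an eigenfunction, with eigenvalue $\sum_{i=1}^n q^{\kappa_i}t^{n-i}$, of the operator $\sum_{i=1}^n\Big(\prod_{j\ne i}\frac{tx_i-x_j}{x_i-x_j}\Big)\tau_i$, where $\tau_i$ replaces $x_i$ by $qx_i$. (a) For every composition $\eta$, $$P_{\eta^+}(1,t,\dots,t^{n-1};q,t)=\frac{t^{l(\eta^R)}\,[n]_{t^{-1}}!}{\prod_{j=0}^{\eta^+_1}[f_j]_{t^{-1}}!}\,\frac{e_{\eta^R}(q,t)}{d_{\eta^R}(q,t)}=t^{l(\eta^+)}\,\frac{b_{\eta^+}(q,t)}{h_{\eta^+}(q,t)}.$$ This holds when $q,t$ are indeterminates (elements of a field of characteristic $0$ that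 are algebraically independent over $\mathbb{Q}$), and when they are real parameters with $0<q,t<1$. (b) Let $q,t$ be real with $0<q,t<1$, and let $\lambda$ be defined by $t=q^\lambda$. For polynomials $f,g$ in $x$ whose coefficients depend on $q,t$ put $$\langle f,g\rangle_{q,t}=\mathrm{CT}\big(f(x;q,t)\,g(1/x;1/q,1/t)\,W(x)\big),\qquad W(x)=\prod_{1\le i<j\le n}\Big(\frac{x_i}{x_j};q\Big)_\lambda\Big(q\frac{x_j}{x_i};q\Big)_\lambda,$$ where $(b;q)_\lambda=(b;q)_\infty/(bq^\lambda;q)_\infty$, $(b;q)_\infty=\prod_{i\ge0}(1-bq^i)$ and $\mathrm{CT}$ is the constant term, that is, the mean value over the torus $|x_1|=\dots=|x_n|=1$. Put $\mathcal N_\kappa=\langle P_\kappa,P_\kappa\rangle_{q,t}$; in particular $\mathcal N_0=\langle1,1\rangle_{q,t}$. Then for every composition $\eta$, $$\frac{\mathcal N_{\eta^+}}{\mathcal N_0}=\frac{[n]_t!}{\prod_{j=0}^{\eta^+_1}[f_j]_t!}\,\frac{d'_{\eta^+}\,e_{\eta^R}}{d_{\eta^R}\,e'_{\eta^R}}=\frac{b_{\eta^+}\,d'_{\eta^+}}{h_{\eta^+}\,e'_{\eta^+}}.$$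 -/

import Mathlib

open scoped BigOperators

noncomputable section

namespace Macdonald

variable {n : ℕ}

/-! Compositions are tuples `η : Fin n → ℕ`; partitions of length at most `n` are the weakly
decreasing (`Antitone`) tuples.  Positions are indexed from `0`, so position `i` of the usual
`1`-based notation is `i - 1` here; columns `j` of a node `(i, j)` run over `1, …, η i`. -/

/-- `η^R`: the weakly increasing rearrangement of `η`. -/
def incr (η : Fin n → ℕ) : Fin n → ℕ := fun i => η (Tuple.sort η i)

/-- `η⁺`: the weakly decreasing rearrangement of `η`, that is, the partition obtained by
permuting the entries of `η`. -/
def plus (η : Fin n → ℕ) : Fin n → ℕ := fun i => incr η (Fin.rev i)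

/-- The strict dominance order on `n`-tuples of the same modulus. -/
def DomLT (μ κ : Fin n → ℕ) : Prop :=
  μ ≠ κ ∧ ∑ i, μ i = ∑ i, κ i ∧
    ∀ p : ℕ, ∑ i ∈ Finset.univ.filter (fun i : Fin n => (i : ℕ) < p), μ i ≤
      ∑ i ∈ Finset.univ.filter (fun i : Fin n => (i : ℕ) < p), κ i

/-- Arm length `a(s)` of the node `s = (i, j)`. -/
def arm (η : Fin n → ℕ) (i : Fin n) (j : ℕ) : ℕ := η i - j

/-- Arm colength `a'(s)` of the node `s = (i, j)`. -/
def coarm (j : ℕ) : ℕ := j - 1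

/-- Leg length `l(s)` of the node `s = (i, j)`. -/
def leg (η : Fin n → ℕ) (i : Fin n) (j : ℕ) : ℕ :=
  (Finset.univ.filter fun k => i < k ∧ j ≤ η k ∧ η k ≤ η i).card +
    (Finset.univ.filter fun k => k < i ∧ j ≤ η k + 1 ∧ η k + 1 ≤ η i).card

/-- Leg colength `l'(s)` of a node `s` in row `i`; it is always at most `n - 1`. -/
def coleg (η : Fin n → ℕ) (i : Fin n) : ℕ :=
  (Finset.univ.filter fun k => k < i ∧ η i ≤ η k).card +
    (Finset.univ.filter fun k => i < k ∧ η i < η k).card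

section Constants

variable {K : Type*} [Field K] (q t : K) (η : Fin n → ℕ)

def dConst : K :=
  ∏ i, ∏ j ∈ Finset.Icc 1 (η i), (1 - q ^ (arm η i j + 1) * t ^ (leg η i j + 1))

def dConst' : K :=
  ∏ i, ∏ j ∈ Finset.Icc 1 (η i), (1 - q ^ (arm η i j + 1) * t ^ leg η i j)

def eConst : K :=
  ∏ i, ∏ j ∈ Finset.Icc 1 (η i), (1 - q ^ (coarm j + 1) * t ^ (n - coleg η i))

def eConst' : K :=
  ∏ i, ∏ j ∈ Finset.Icc 1 (η i), (1 - q ^ (coarm j + 1) * t ^ (n - 1 - coleg η i))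

def bConst : K :=
  ∏ i, ∏ j ∈ Finset.Icc 1 (η i), (1 - q ^ coarm j * t ^ (n - coleg η i))

def hConst : K :=
  ∏ i, ∏ j ∈ Finset.Icc 1 (η i), (1 - q ^ arm η i j * t ^ (leg η i j + 1))

/-- `l(η) = ∑_{s ∈ η} l(s)`. -/
def legSum (η : Fin n → ℕ) : ℕ := ∑ i, ∑ j ∈ Finset.Icc 1 (η i), leg η i j

/-- `[k]_t! = [1]_t [2]_t ⋯ [k]_t` with `[i]_t = (1 - t ^ i) / (1 - t)`. -/
def bracketFactorial (t : K) (k : ℕ) : K :=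
  ∏ i ∈ Finset.Icc 1 k, (1 - t ^ i) / (1 - t)

/-- `f_j(η)`, the number of entries of `η` that are equal to `j`. -/
def mult (η : Fin n → ℕ) (j : ℕ) : ℕ := (Finset.univ.filter fun i => η i = j).card

/-- `[n]_t! / ∏_j [f_j(η)]_t!`, the product being over `j = 0, …, η⁺₁`, where `η⁺₁` is the
largest entry of `η`. -/
def bracketMultinomial (t : K) (η : Fin n → ℕ) : K :=
  bracketFactorial t n /
    ∏ j ∈ Finset.range (Finset.univ.sup η + 1), bracketFactorial t (mult η j)

end Constants

section Polynomials

variable {K : Type*} [Field K]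

/-- The monomial symmetric polynomial `m_κ` in `n` variables: the sum of the monomials `x ^ η`
over the distinct rearrangements `η` of `κ`. -/
def monomialSymm (κ : Fin n → ℕ) : MvPolynomial (Fin n) K :=
  ∑ η ∈ Finset.univ.image (fun σ : Equiv.Perm (Fin n) => κ ∘ σ),
    ∏ i, MvPolynomial.X i ^ η i

/-- The `q`-shift operator `τ_i`, which replaces `x_i` by `q x_i`. -/
def qShift (q : K) (i : Fin n) : MvPolynomial (Fin n) K →ₐ[K] MvPolynomial (Fin n) K :=
  MvPolynomial.aeval fun j =>
    if j = i then MvPolynomial.C q * MvPolynomial.X j else MvPolynomial.X j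

/-- The variable `x_i` in the field of rational functions. -/
def ratX (K : Type*) [Field K] (i : Fin n) : FractionRing (MvPolynomial (Fin n) K) :=
  algebraMap (MvPolynomial (Fin n) K) _ (MvPolynomial.X i)

/-- The Macdonald operator
`D_n^1(q,t) = ∑_i (∏_{j ≠ i} (t x_i - x_j) / (x_i - x_j)) τ_i`,
applied to a polynomial, with values in the rational functions. -/
def macdonaldOp (q t : K) (f : MvPolynomial (Fin n) K) :
    FractionRing (MvPolynomial (Fin n) K) :=
  ∑ i, (∏ j ∈ Finset.univ.erase i,
      (algebraMap K _ t * ratX K i - ratX K j) / (ratX K i - ratX K j)) *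
    algebraMap (MvPolynomial (Fin n) K) _ (qShift q i f)

/-- The eigenvalue `∑_i q ^ κ_i t ^ (n - i)` (`i = 1, …, n`) belonging to the partition `κ`. -/
def macdonaldEigenvalue (q t : K) (κ : Fin n → ℕ) : K :=
  ∑ i : Fin n, q ^ κ i * t ^ (n - 1 - (i : ℕ))

/-- The defining properties of the symmetric Macdonald polynomial `P_κ(x;q,t)`: it is
`m_κ` plus a linear combination of `m_μ` with partitions `μ < κ` of the same modulus, and it is an
eigenfunction of the Macdonald operator. -/
structure IsMacdonaldP (q t : K) (κ : Fin n → ℕ) (P : MvPolynomial (Fin n) K) : Prop where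
  triangular : ∃ u : (Fin n → ℕ) →₀ K,
    (∀ μ ∈ u.support, Antitone μ ∧ DomLT μ κ) ∧
      P = monomialSymm κ + u.sum fun μ c => MvPolynomial.C c * monomialSymm μ
  eigen : macdonaldOp q t P =
    algebraMap (MvPolynomial (Fin n) K) _ (MvPolynomial.C (macdonaldEigenvalue q t κ) * P)

open Classical in
/-- The symmetric Macdonald polynomial `P_κ(x;q,t)`, the unique polynomial with the defining
properties (and `0` for parameters for which these do not determine exactly one polynomial). -/
def macdonaldP (q t : K) (κ : Fin n → ℕ) : MvPolynomial (Fin n) K :=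
  if h : ∃! P, IsMacdonaldP q t κ P then h.choose else 0

end Polynomials

section ScalarProduct

/-- `(b;q)_∞ = ∏_{i ≥ 0} (1 - b q ^ i)`. -/
def qPochInf (b : ℂ) (q : ℝ) : ℂ := ∏' i : ℕ, (1 - b * (q : ℂ) ^ i)

/-- `(b;q)_λ = (b;q)_∞ / (b q ^ λ;q)_∞`, written in terms of `t = q ^ λ`. -/
def qPoch (b : ℂ) (q t : ℝ) : ℂ := qPochInf b q / qPochInf (b * t) q

/-- The weight function
`W(x;q,t) = ∏_{i < j} (x_i / x_j ; q)_λ (q x_j / x_i ; q)_λ`, where `t = q ^ λ`. -/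
def weight (q t : ℝ) (x : Fin n → ℂ) : ℂ :=
  ∏ i, ∏ j ∈ Finset.Ioi i, qPoch (x i / x j) q t * qPoch (q * (x j / x i)) q t

/-- The constant term of `F`, as a Fourier integral: the mean value of `F` over the torus
`|x_1| = ⋯ = |x_n| = 1`. -/
def constantTerm (F : (Fin n → ℂ) → ℂ) : ℂ :=
  ∫ θ : Fin n → UnitAddCircle, F (fun i => (AddCircle.toCircle (θ i) : ℂ))
    ∂(MeasureTheory.Measure.pi fun _ => AddCircle.haarAddCircle)

/-- The scalar product
`⟨f, g⟩_{q,t} = CT (f(x;q,t) g(1/x;1/q,1/t) W(x;q,t))`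
of polynomials whose coefficients depend on the parameters `q` and `t`. -/
def scalarProduct (f g : ℝ → ℝ → MvPolynomial (Fin n) ℝ) (q t : ℝ) : ℂ :=
  constantTerm fun x =>
    MvPolynomial.aeval x (f q t) * MvPolynomial.aeval (fun i => (x i)⁻¹) (g q⁻¹ t⁻¹) *
      weight q t x

/-- `N_κ(q,t) = ⟨P_κ, P_κ⟩_{q,t}`. -/
def normP (κ : Fin n → ℕ) (q t : ℝ) : ℂ :=
  scalarProduct (fun q t => macdonaldP q t κ) (fun q t => macdonaldP q t κ) q t

end ScalarProduct

end Macdonald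

end

open scoped BigOperators

noncomputable section

namespace Macdonald

section

variable {n : ℕ}

/-! ### Row order and leg colengths -/

/-- The strict total order on the rows of `η` in which longer rows come first and rows of equal
length are ordered by position. -/
def Prec (η : Fin n → ℕ) (k i : Fin n) : Prop := η i < η k ∨ (η i = η k ∧ k < i)

instance (η : Fin n → ℕ) (k i : Fin n) : Decidable (Prec η k i) := by
  unfold Prec; infer_instance

theorem coleg_eq_sum (η : Fin n → ℕ) (i : Fin n) :
    coleg η i = ∑ k, if Prec η k i then 1 else 0 := by
  unfold coleg
  rw [Finset.card_filter, Finset.card_filter, ← Finset.sum_add_distrib]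
  refine Finset.sum_congr rfl fun k _ => ?_
  unfold Prec
  rcases lt_trichotomy k i with h | rfl | h
  · have h' : ¬ i < k := by omega
    simp only [h, h', true_and, false_and, if_false, add_zero, and_true]
    congr 1
    exact propext ⟨by omega, by omega⟩
  · simp
  · have h' : ¬ k < i := by omega
    simp [h, h']

theorem coleg_eq_card (η : Fin n → ℕ) (i : Fin n) :
    coleg η i = (Finset.univ.filter fun k => Prec η k i).card := by
  rw [coleg_eq_sum, Finset.card_filter]

theorem coleg_lt_of_prec {η : Fin n → ℕ} {k i : Fin n} (h : Prec η k i) :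
    coleg η k < coleg η i := by
  rw [coleg_eq_card, coleg_eq_card]
  refine Finset.card_lt_card (Finset.ssubset_iff_of_subset ?_ |>.2 ⟨k, ?_, ?_⟩)
  · intro l hl
    simp only [Finset.mem_filter, Finset.mem_univ, true_and] at hl ⊢
    unfold Prec at hl h ⊢
    omega
  · simpa using h
  · simp only [Finset.mem_filter, Finset.mem_univ, true_and]
    simp [Prec]

theorem prec_trichotomy (η : Fin n → ℕ) {k i : Fin n} (h : k ≠ i) :
    Prec η k i ∨ Prec η i k := by
  unfold Prec
  omega

theorem prec_iff_coleg_lt {η : Fin n → ℕ} {k i : Fin n} :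
    Prec η k i ↔ coleg η k < coleg η i := by
  refine ⟨coleg_lt_of_prec, fun h => ?_⟩
  rcases eq_or_ne k i with rfl | hne
  · omega
  · rcases prec_trichotomy η hne with h' | h'
    · exact h'
    · have := coleg_lt_of_prec h'
      omega

theorem coleg_injective (η : Fin n → ℕ) : Function.Injective (coleg η) := by
  intro k i h
  by_contra hne
  rcases prec_trichotomy η hne with h' | h' <;> have := coleg_lt_of_prec h' <;> omega

theorem coleg_lt (η : Fin n → ℕ) (i : Fin n) : coleg η i < n := by
  rw [coleg_eq_card]
  calc _ < (Finset.univ : Finset (Fin n)).card := by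
        refine Finset.card_lt_card (Finset.ssubset_univ_iff.2 fun h => ?_)
        have : i ∈ Finset.univ.filter fun k => Prec η k i := by rw [h]; simp
        simp only [Finset.mem_filter, Finset.mem_univ, true_and] at this
        simp [Prec] at this
    _ = n := by simp

theorem coleg_of_equiv {η η' : Fin n → ℕ} (e : Fin n ≃ Fin n)
    (h : ∀ k i, Prec η' k i ↔ Prec η (e k) (e i)) (i : Fin n) :
    coleg η' i = coleg η (e i) := by
  rw [coleg_eq_sum, coleg_eq_sum]
  simp only [h]
  exact Equiv.sum_comp e fun k => if Prec η k (e i) then 1 else 0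

theorem coleg_antitone {κ : Fin n → ℕ} (hκ : Antitone κ) (i : Fin n) : coleg κ i = i := by
  rw [coleg_eq_card]
  have : (Finset.univ.filter fun k => Prec κ k i) = Finset.Iio i := by
    ext k
    simp only [Finset.mem_filter, Finset.mem_univ, true_and, Finset.mem_Iio]
    unfold Prec
    constructor
    · rintro (h | h)
      · by_contra hk
        exact absurd (hκ (not_lt.1 hk)) (by omega)
      · exact h.2
    · intro h
      have := hκ h.le
      omega
  rw [this, Fin.card_Iio]

/-! ### The raising operation on compositions -/

section Raise

variable {m : ℕ} {K : Type*} [Field K] (q t : K)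

/-- `Φη = (η_2, …, η_n, η_1 + 1)`. -/
def raise (η : Fin (m + 1) → ℕ) : Fin (m + 1) → ℕ :=
  Fin.snoc (fun i : Fin m => η i.succ) (η 0 + 1)

@[simp] theorem raise_castSucc (η : Fin (m + 1) → ℕ) (i : Fin m) :
    raise η i.castSucc = η i.succ := by
  simp [raise]

@[simp] theorem raise_last (η : Fin (m + 1) → ℕ) : raise η (Fin.last m) = η 0 + 1 := by
  simp [raise]

theorem coleg_raise_castSucc (η : Fin (m + 1) → ℕ) (i : Fin m) :
    coleg (raise η) i.castSucc = coleg η i.succ := by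
  rw [coleg_eq_sum, coleg_eq_sum, Fin.sum_univ_castSucc, Fin.sum_univ_succ, add_comm]
  congr 1
  · congr 1
    simp only [Prec, raise_castSucc, raise_last, Fin.succ_pos, and_true, eq_iff_iff]
    have : ¬ Fin.last m < i.castSucc := by simp [Fin.le_last]
    simp only [this, and_false, or_false]
    omega
  · refine Finset.sum_congr rfl fun k _ => ?_
    simp [Prec]

theorem coleg_raise_last (η : Fin (m + 1) → ℕ) :
    coleg (raise η) (Fin.last m) = coleg η 0 := by
  rw [coleg_eq_sum, coleg_eq_sum, Fin.sum_univ_castSucc, Fin.sum_univ_succ, add_comm]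
  congr 1
  · simp [Prec]
  · refine Finset.sum_congr rfl fun k _ => ?_
    congr 1
    simp only [Prec, raise_castSucc, raise_last, Fin.castSucc_lt_last, and_true,
      Fin.not_lt_zero, and_false, or_false, eq_iff_iff]
    omega

theorem leg_eq_sum (η : Fin n → ℕ) (i : Fin n) (j : ℕ) :
    leg η i j = ∑ k, ((if i < k ∧ j ≤ η k ∧ η k ≤ η i then 1 else 0) +
      (if k < i ∧ j ≤ η k + 1 ∧ η k + 1 ≤ η i then 1 else 0)) := by
  unfold leg
  rw [Finset.card_filter, Finset.card_filter, ← Finset.sum_add_distrib]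

theorem leg_raise_castSucc (η : Fin (m + 1) → ℕ) (i : Fin m) (j : ℕ) :
    leg (raise η) i.castSucc j = leg η i.succ j := by
  rw [leg_eq_sum, leg_eq_sum, Fin.sum_univ_castSucc, Fin.sum_univ_succ, add_comm]
  have h1 : ¬ Fin.last m < i.castSucc := by simp [Fin.le_last]
  have h2 : ¬ i.succ < 0 := by simp
  congr 1
  · simp [h1]
  · simp

theorem leg_raise_last (η : Fin (m + 1) → ℕ) (j : ℕ) :
    leg (raise η) (Fin.last m) (j + 1) = leg η 0 j := by
  rw [leg_eq_sum, leg_eq_sum, Fin.sum_univ_castSucc, Fin.sum_univ_succ, add_comm]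
  have h1 : ∀ i : Fin m, ¬ Fin.last m < i.castSucc := by simp [Fin.le_last]
  congr 1
  · simp
  · simp [h1]

theorem leg_raise_last_one (η : Fin (m + 1) → ℕ) :
    leg (raise η) (Fin.last m) 1 + coleg η 0 = m := by
  rw [leg_eq_sum, coleg_eq_sum, Fin.sum_univ_castSucc, Fin.sum_univ_succ]
  have h1 : ∀ i : Fin m, ¬ Fin.last m < i.castSucc := by simp [Fin.le_last]
  have h2 : ∀ i : Fin m, (if η i.succ ≤ η 0 then 1 else 0) + (if η 0 < η i.succ then 1 else 0)
      = 1 := by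
    intro i
    rcases le_or_gt (η i.succ) (η 0) with h | h
    · simp [h, not_lt.2 h]
    · simp [h, not_le.2 h]
  simp only [Prec, raise_castSucc, raise_last, h1, Fin.castSucc_lt_last, lt_self_iff_false]
  simp only [false_and, if_false, zero_add, true_and, add_le_add_iff_right, Fin.not_lt_zero,
    and_false, or_false, le_add_iff_nonneg_left, zero_le, add_zero]
  rw [← Finset.sum_add_distrib]
  simp only [h2]
  simp

theorem prod_Icc_one_succ {M : Type*} [CommMonoid M] (f : ℕ → M) (k : ℕ) :
    ∏ j ∈ Finset.Icc 1 (k + 1), f j = f 1 * ∏ j ∈ Finset.Icc 1 k, f (j + 1) := by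
  induction k with
  | zero => simp
  | succ k ih =>
    rw [Finset.prod_Icc_succ_top (by omega), ih, Finset.prod_Icc_succ_top (by omega), mul_assoc]

/-- A product over the nodes of `Φη`, the weight of a node depending on the row through `g`. -/
theorem prod_nodes_raise {M : Type*} [CommMonoid M] (η : Fin (m + 1) → ℕ)
    (F G : Fin (m + 1) → ℕ → M)
    (h1 : ∀ i : Fin m, ∀ j, F i.castSucc j = G i.succ j)
    (h2 : ∀ j, 1 ≤ j → F (Fin.last m) (j + 1) = G 0 j) :
    ∏ i, ∏ j ∈ Finset.Icc 1 (raise η i), F i j =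
      (∏ i, ∏ j ∈ Finset.Icc 1 (η i), G i j) * F (Fin.last m) 1 := by
  rw [Fin.prod_univ_castSucc, Fin.prod_univ_succ]
  simp only [raise_castSucc, raise_last, prod_Icc_one_succ, h1]
  rw [Finset.prod_congr rfl fun j hj => h2 j (Finset.mem_Icc.1 hj).1]
  rw [mul_comm (F _ _), ← mul_assoc]
  congr 1
  exact mul_comm _ _

theorem dConst_raise (η : Fin (m + 1) → ℕ) :
    dConst q t (raise η) =
      dConst q t η * (1 - q ^ (η 0 + 1) * t ^ (m + 1 - coleg η 0)) := by
  unfold dConst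
  rw [prod_nodes_raise η _ fun i j => 1 - q ^ (arm η i j + 1) * t ^ (leg η i j + 1)]
  · have := leg_raise_last_one η
    rw [show leg (raise η) (Fin.last m) 1 + 1 = m + 1 - coleg η 0 by omega]
    simp [arm]
  · intro i j
    simp [arm, leg_raise_castSucc]
  · intro j hj
    simp [arm, leg_raise_last η j]

theorem dConst'_raise (η : Fin (m + 1) → ℕ) :
    dConst' q t (raise η) =
      dConst' q t η * (1 - q ^ (η 0 + 1) * t ^ (m - coleg η 0)) := by
  unfold dConst'
  rw [prod_nodes_raise η _ fun i j => 1 - q ^ (arm η i j + 1) * t ^ (leg η i j)]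
  · have := leg_raise_last_one η
    rw [show leg (raise η) (Fin.last m) 1 = m - coleg η 0 by omega]
    simp [arm]
  · intro i j
    simp [arm, leg_raise_castSucc]
  · intro j hj
    simp [arm, leg_raise_last η j]

theorem prod_coarm_raise {M : Type*} [CommMonoid M] (η : Fin (m + 1) → ℕ) (F : ℕ → ℕ → M) :
    ∏ i, ∏ j ∈ Finset.Icc 1 (raise η i), F (coarm j + 1) (coleg (raise η) i) =
      (∏ i, ∏ j ∈ Finset.Icc 1 (η i), F (coarm j + 1) (coleg η i)) *
        F (η 0 + 1) (coleg η 0) := by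
  rw [Fin.prod_univ_castSucc, Fin.prod_univ_succ]
  simp only [raise_castSucc, raise_last, coleg_raise_castSucc, coleg_raise_last]
  rw [Finset.prod_Icc_succ_top (by omega), ← mul_assoc]
  congr 1
  exact mul_comm _ _

theorem eConst_raise (η : Fin (m + 1) → ℕ) :
    eConst q t (raise η) =
      eConst q t η * (1 - q ^ (η 0 + 1) * t ^ (m + 1 - coleg η 0)) :=
  prod_coarm_raise η fun a c => 1 - q ^ a * t ^ (m + 1 - c)

theorem eConst'_raise (η : Fin (m + 1) → ℕ) :
    eConst' q t (raise η) =
      eConst' q t η * (1 - q ^ (η 0 + 1) * t ^ (m - coleg η 0)) :=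
  prod_coarm_raise η fun a c => 1 - q ^ a * t ^ (m - c)

theorem legSum_raise (η : Fin (m + 1) → ℕ) :
    legSum (raise η) = legSum η + (m - coleg η 0) := by
  have h := prod_nodes_raise (M := Multiplicative ℕ) η
    (fun i j => Multiplicative.ofAdd (leg (raise η) i j))
    (fun i j => Multiplicative.ofAdd (leg η i j))
    (fun i j => by simp [leg_raise_castSucc]) (fun j hj => by simp [leg_raise_last η j])
  have := leg_raise_last_one η
  rw [show leg (raise η) (Fin.last m) 1 = m - coleg η 0 by omega] at h
  exact h

end Raise

/-! ### Exchanging neighbouring rows -/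

section Exchange

variable {m : ℕ} {K : Type*} [Field K] (q t : K)

/-- The transposition of the positions `i` and `i + 1`. -/
abbrev adj (i : Fin m) : Equiv.Perm (Fin (m + 1)) := Equiv.swap i.castSucc i.succ

theorem adj_lt_iff (i : Fin m) {k l : Fin (m + 1)} (h : ¬(k = i.castSucc ∧ l = i.succ))
    (h' : ¬(k = i.succ ∧ l = i.castSucc)) : adj i k < adj i l ↔ k < l := by
  unfold adj
  simp only [Equiv.swap_apply_def, Fin.ext_iff, Fin.lt_def, Fin.val_castSucc, Fin.val_succ] at *
  split_ifs <;> simp only [Fin.val_castSucc, Fin.val_succ] <;> omega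

theorem coleg_adj {η : Fin (m + 1) → ℕ} (i : Fin m) (h : η i.castSucc ≠ η i.succ)
    (k : Fin (m + 1)) : coleg (η ∘ adj i) k = coleg η (adj i k) := by
  refine coleg_of_equiv (adj i) (fun k l => ?_) k
  unfold Prec
  simp only [Function.comp_apply]
  by_cases h1 : k = i.castSucc ∧ l = i.succ
  · obtain ⟨rfl, rfl⟩ := h1
    simp [h]
  by_cases h2 : k = i.succ ∧ l = i.castSucc
  · obtain ⟨rfl, rfl⟩ := h2
    simp [h.symm]
  rw [adj_lt_iff i h1 h2]

/-- The height difference of two neighbouring rows in the row order. -/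
theorem coleg_succ_eq {η : Fin (m + 1) → ℕ} {i : Fin m} (h : η i.succ < η i.castSucc) :
    coleg η i.succ = coleg η i.castSucc + leg η i.castSucc (η i.succ + 1) + 1 := by
  rw [coleg_eq_sum, coleg_eq_sum, leg_eq_sum, ← Finset.sum_add_distrib]
  have : ∑ k, (if k = i.castSucc then 1 else 0) = 1 := by simp
  refine Eq.trans ?_ (congrArg _ this)
  rw [← Finset.sum_add_distrib]
  refine Finset.sum_congr rfl fun k _ => ?_
  unfold Prec
  rcases lt_trichotomy k i.castSucc with hk | rfl | hk
  · have h1 : k < i.succ := hk.trans (Fin.castSucc_lt_succ)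
    have h2 : ¬ i.castSucc < k := by omega
    simp only [hk, h1, h2, hk.ne, and_true, true_and, false_and, if_false]
    split_ifs <;> omega
  · simp [h]
  · have h2 : ¬ k < i.castSucc := by omega
    simp only [hk, h2, hk.ne', true_and, false_and, if_false, and_false]
    rcases eq_or_ne k i.succ with rfl | hne
    · simp [h.le]
    · have h3 : ¬ k < i.succ := by
        simp only [Fin.lt_def, Fin.val_castSucc, Fin.val_succ, Fin.ext_iff, ne_eq] at *
        omega
      simp only [h3, and_false, or_false]
      split_ifs <;> omega

theorem leg_adj {η : Fin (m + 1) → ℕ} {i : Fin m} (h : η i.succ < η i.castSucc)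
    (k : Fin (m + 1)) (j : ℕ) :
    leg (η ∘ adj i) (adj i k) j =
      leg η k j + if k = i.castSucc ∧ j = η i.succ + 1 then 1 else 0 := by
  have hs : ∀ x, (η ∘ adj i) (adj i x) = η x := fun x => by simp [adj]
  rw [leg_eq_sum, leg_eq_sum, ← Equiv.sum_comp (adj i)]
  simp only [hs]
  have : (if k = i.castSucc ∧ j = η i.succ + 1 then 1 else 0) = ∑ l,
      if l = i.succ then (if k = i.castSucc ∧ j = η i.succ + 1 then 1 else 0) else 0 := by simp
  rw [this, ← Finset.sum_add_distrib]
  refine Finset.sum_congr rfl fun l _ => ?_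
  by_cases h1 : k = i.castSucc ∧ l = i.succ
  · obtain ⟨rfl, rfl⟩ := h1
    simp only [adj, Equiv.swap_apply_left, Equiv.swap_apply_right]
    have h3 : i.castSucc < i.succ := Fin.castSucc_lt_succ
    have h4 : ¬ i.succ < i.castSucc := by omega
    simp only [h3, h4, true_and, false_and, if_true, if_false]
    split_ifs <;> omega
  by_cases h2 : k = i.succ ∧ l = i.castSucc
  · obtain ⟨rfl, rfl⟩ := h2
    simp only [adj, Equiv.swap_apply_left, Equiv.swap_apply_right]
    have h3 : i.castSucc < i.succ := Fin.castSucc_lt_succ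
    have h4 : ¬ i.succ < i.castSucc := by omega
    simp only [h3, h4, true_and, false_and, if_false, h3.ne, h3.ne']
    split_ifs <;> omega
  simp only [adj_lt_iff i h1 h2, adj_lt_iff i (fun h => h2 h.symm) (fun h => h1 h.symm)]
  have : (if l = i.succ then (if k = i.castSucc ∧ j = η i.succ + 1 then 1 else 0) else 0) = 0 := by
    split_ifs with h3 h4
    · exact absurd ⟨h4.1, h3⟩ h1
    · rfl
    · rfl
  rw [this, add_zero]

/-- Only one node changes its leg when a longer row is moved down past a shorter one. -/
theorem prod_nodes_adj {M : Type*} [CommMonoid M] {η : Fin (m + 1) → ℕ} {i : Fin m}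
    (h : η i.succ < η i.castSucc) (F : ℕ → ℕ → M) :
    (∏ k, ∏ j ∈ Finset.Icc 1 ((η ∘ adj i) k), F (arm (η ∘ adj i) k j) (leg (η ∘ adj i) k j)) *
        F (η i.castSucc - η i.succ - 1) (leg η i.castSucc (η i.succ + 1)) =
      (∏ k, ∏ j ∈ Finset.Icc 1 (η k), F (arm η k j) (leg η k j)) *
        F (η i.castSucc - η i.succ - 1) (leg η i.castSucc (η i.succ + 1) + 1) := by
  have hs : ∀ x, (η ∘ adj i) (adj i x) = η x := fun x => by simp [adj]
  rw [← Equiv.prod_comp (adj i)]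
  simp only [hs, arm, leg_adj h]
  rw [← Finset.mul_prod_erase _ _ (Finset.mem_univ i.castSucc),
    ← Finset.mul_prod_erase _ _ (Finset.mem_univ i.castSucc)]
  have e1 : ∏ x ∈ Finset.univ.erase i.castSucc, ∏ j ∈ Finset.Icc 1 (η x),
      F (η x - j) (leg η x j + if x = i.castSucc ∧ j = η i.succ + 1 then 1 else 0) =
      ∏ x ∈ Finset.univ.erase i.castSucc, ∏ j ∈ Finset.Icc 1 (η x), F (η x - j) (leg η x j) := by
    refine Finset.prod_congr rfl fun x hx => Finset.prod_congr rfl fun j _ => ?_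
    simp [Finset.ne_of_mem_erase hx]
  have hmem : η i.succ + 1 ∈ Finset.Icc 1 (η i.castSucc) := by
    simp; omega
  rw [e1, ← Finset.mul_prod_erase _ _ hmem, ← Finset.mul_prod_erase _ _ hmem]
  have e2 : ∏ x ∈ (Finset.Icc 1 (η i.castSucc)).erase (η i.succ + 1), F (η i.castSucc - x)
      (leg η i.castSucc x + if i.castSucc = i.castSucc ∧ x = η i.succ + 1 then 1 else 0) =
      ∏ x ∈ (Finset.Icc 1 (η i.castSucc)).erase (η i.succ + 1), F (η i.castSucc - x)
      (leg η i.castSucc x) := by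
    refine Finset.prod_congr rfl fun x hx => ?_
    simp [Finset.ne_of_mem_erase hx]
  rw [e2]
  simp only [and_self, if_true, Nat.sub_sub]
  ac_rfl

theorem dConst_adj {η : Fin (m + 1) → ℕ} {i : Fin m} (h : η i.succ < η i.castSucc) :
    dConst q t (η ∘ adj i) * (1 - q ^ (η i.castSucc - η i.succ) *
        t ^ (coleg η i.succ - coleg η i.castSucc)) =
      dConst q t η * (1 - q ^ (η i.castSucc - η i.succ) *
        t ^ (coleg η i.succ - coleg η i.castSucc + 1)) := by
  have := prod_nodes_adj h fun a l => 1 - q ^ (a + 1) * t ^ (l + 1)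
  have h2 := coleg_succ_eq h
  rwa [show η i.castSucc - η i.succ - 1 + 1 = η i.castSucc - η i.succ by omega,
    show leg η i.castSucc (η i.succ + 1) + 1 = coleg η i.succ - coleg η i.castSucc by omega] at this

theorem dConst'_adj {η : Fin (m + 1) → ℕ} {i : Fin m} (h : η i.succ < η i.castSucc) :
    dConst' q t (η ∘ adj i) * (1 - q ^ (η i.castSucc - η i.succ) *
        t ^ (coleg η i.succ - coleg η i.castSucc - 1)) =
      dConst' q t η * (1 - q ^ (η i.castSucc - η i.succ) *
        t ^ (coleg η i.succ - coleg η i.castSucc)) := by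
  have := prod_nodes_adj h fun a l => 1 - q ^ (a + 1) * t ^ l
  have h2 := coleg_succ_eq h
  rwa [show η i.castSucc - η i.succ - 1 + 1 = η i.castSucc - η i.succ by omega,
    show leg η i.castSucc (η i.succ + 1) + 1 = coleg η i.succ - coleg η i.castSucc by omega,
    show leg η i.castSucc (η i.succ + 1) = coleg η i.succ - coleg η i.castSucc - 1 by omega] at this

theorem legSum_adj {η : Fin (m + 1) → ℕ} {i : Fin m} (h : η i.succ < η i.castSucc) :
    legSum (η ∘ adj i) = legSum η + 1 := by
  have h1 := prod_nodes_adj (M := Multiplicative ℕ) h fun _ l => Multiplicative.ofAdd l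
  have h2 : legSum (η ∘ adj i) + leg η i.castSucc (η i.succ + 1) =
    legSum η + (leg η i.castSucc (η i.succ + 1) + 1) := h1
  omega

theorem prod_coleg_adj {M : Type*} [CommMonoid M] {η : Fin (m + 1) → ℕ} {i : Fin m}
    (h : η i.succ ≠ η i.castSucc) (F : ℕ → ℕ → M) :
    ∏ k, ∏ j ∈ Finset.Icc 1 ((η ∘ adj i) k), F j (coleg (η ∘ adj i) k) =
      ∏ k, ∏ j ∈ Finset.Icc 1 (η k), F j (coleg η k) := by
  simp only [coleg_adj i h.symm]
  exact Equiv.prod_comp (adj i) fun k => ∏ j ∈ Finset.Icc 1 (η k), F j (coleg η k)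

theorem eConst_adj {η : Fin (m + 1) → ℕ} {i : Fin m} (h : η i.succ ≠ η i.castSucc) :
    eConst q t (η ∘ adj i) = eConst q t η :=
  prod_coleg_adj h fun j c => 1 - q ^ (coarm j + 1) * t ^ (m + 1 - c)

theorem eConst'_adj {η : Fin (m + 1) → ℕ} {i : Fin m} (h : η i.succ ≠ η i.castSucc) :
    eConst' q t (η ∘ adj i) = eConst' q t η :=
  prod_coleg_adj h fun j c => 1 - q ^ (coarm j + 1) * t ^ (m + 1 - 1 - c)

end Exchange

end

section

variable {n : ℕ}

/-! ### The symmetrization identity -/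

section Symmetrization

variable {K : Type*} [Field K]

/-- `∏_{i<j} (z_j - t z_i) / (z_j - z_i)`. -/
def symFactor (t : K) (z : Fin n → K) : K :=
  ∏ i, ∏ j ∈ Finset.Ioi i, (z j - t * z i) / (z j - z i)

theorem symFactor_succ (t : K) (z : Fin (n + 1) → K) :
    symFactor t z = (∏ j : Fin n, (z j.succ - t * z 0) / (z j.succ - z 0)) *
      symFactor t fun i : Fin n => z i.succ := by
  unfold symFactor
  rw [Fin.prod_univ_succ]
  congr 1
  · rw [Fin.prod_Ioi_zero]
  · exact Finset.prod_congr rfl fun i _ =>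
      Fin.prod_Ioi_succ (fun j => (z j - t * z i.succ) / (z j - z i.succ)) i

theorem sum_prod_erase (t : K) (ht : t ≠ 1) (z : Fin n → K) (hz : Function.Injective z)
    (hz0 : ∀ i, z i ≠ 0) :
    ∑ p, ∏ k ∈ Finset.univ.erase p, (z k - t * z p) / (z k - z p) = (1 - t ^ n) / (1 - t) := by
  classical
  have h1t : (1 : K) - t ≠ 0 := sub_ne_zero.2 ht.symm
  let P : Polynomial K := ∏ k, (Polynomial.C (z k) - Polynomial.C t * Polynomial.X)
  let v : Option (Fin n) → K := fun o => o.elim 0 z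
  have hv : Set.InjOn v (Finset.univ : Finset (Option (Fin n))) := by
    intro a _ b _ hab
    rcases a with _ | a <;> rcases b with _ | b <;> simp only [v, Option.elim] at hab
    · rfl
    · exact absurd hab.symm (hz0 b)
    · exact absurd hab (hz0 a)
    · rw [hz hab]
  have hdeg : ∀ k ∈ (Finset.univ : Finset (Fin n)),
      (Polynomial.C (z k) - Polynomial.C t * Polynomial.X).natDegree ≤ 1 := fun k _ => by
    compute_degree
  have hPdeg : P.degree < (Finset.univ : Finset (Option (Fin n))).card := by
    refine lt_of_le_of_lt Polynomial.degree_le_natDegree ?_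
    have : P.natDegree ≤ n := (Polynomial.natDegree_prod_le _ _).trans
      ((Finset.sum_le_sum hdeg).trans (by simp))
    simp only [Finset.card_univ, Fintype.card_option, Fintype.card_fin]
    exact_mod_cast Nat.lt_succ_of_le this
  have key := Lagrange.coeff_eq_sum hv hPdeg
  have hcoeff : P.coeff n = (-t) ^ n := by
    have := Polynomial.coeff_prod_of_natDegree_le Finset.univ
      (fun k : Fin n => Polynomial.C (z k) - Polynomial.C t * Polynomial.X) 1 hdeg
    simp only [Finset.card_univ, Fintype.card_fin, mul_one] at this
    rw [show P.coeff n = _ from this]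
    simp [Polynomial.coeff_C]
  simp only [Finset.card_univ, Fintype.card_option, Fintype.card_fin, Nat.add_sub_cancel] at key
  rw [hcoeff, Fintype.sum_option] at key
  have hnone : P.eval (v none) / ∏ j ∈ Finset.univ.erase (none : Option (Fin n)), (v none - v j)
      = (-1) ^ n := by
    have : (Finset.univ.erase (none : Option (Fin n))) =
        Finset.univ.map Function.Embedding.some := by
      ext x; cases x <;> simp
    rw [this, Finset.prod_map]
    simp only [P, v, Polynomial.eval_prod, Option.elim, Function.Embedding.some_apply,
      Polynomial.eval_sub, Polynomial.eval_mul, Polynomial.eval_C, Polynomial.eval_X, mul_zero,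
      sub_zero, zero_sub]
    rw [← Finset.prod_div_distrib]
    simp only [div_neg, div_self (hz0 _)]
    simp
  have hsome : ∀ p : Fin n, P.eval (v (some p)) /
      ∏ j ∈ Finset.univ.erase (some p), (v (some p) - v j) = (1 - t) * ((-1) ^ (n - 1) *
        ∏ k ∈ Finset.univ.erase p, (z k - t * z p) / (z k - z p)) := by
    intro p
    have hn : (-1 : K) ^ (n - 1) = ∏ k ∈ Finset.univ.erase p, (-1) := by
      simp [Finset.card_erase_of_mem]
    have he : (Finset.univ.erase (some p)) =
        insert none ((Finset.univ.erase p).map Function.Embedding.some) := by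
      ext x; cases x <;> simp
    rw [he, Finset.prod_insert (by simp), Finset.prod_map, hn, ← Finset.prod_mul_distrib]
    simp only [P, v, Polynomial.eval_prod, Option.elim, Function.Embedding.some_apply,
      Polynomial.eval_sub, Polynomial.eval_mul, Polynomial.eval_C, Polynomial.eval_X, sub_zero]
    rw [← Finset.mul_prod_erase _ _ (Finset.mem_univ p), mul_div_mul_comm,
      ← Finset.prod_div_distrib]
    congr 1
    · field_simp [hz0 p]
    · refine Finset.prod_congr rfl fun k hk => ?_
      rw [← neg_sub (z k) (z p), div_neg, neg_one_mul]
  rw [hnone, Finset.sum_congr rfl fun p _ => hsome p, ← Finset.mul_sum, ← Finset.mul_sum] at key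
  rcases n with _ | n
  · simp
  · simp only [Nat.add_sub_cancel] at key
    rw [eq_div_iff h1t]
    have h2 : ((-1 : K) ^ n) * (-1) ^ n = 1 := by rw [← mul_pow]; simp
    rw [neg_pow, pow_succ] at key
    linear_combination (-(-1) ^ n) * key + (1 - t ^ (n+1) - (1-t) *
      ∑ p, ∏ k ∈ Finset.univ.erase p, (z k - t * z p) / (z k - z p)) * h2

/-- Summing `∏_{i<j} (z_j - t z_i) / (z_j - z_i)` over all rearrangements of `z`. -/
theorem sum_symFactor (t : K) (ht : t ≠ 1) : ∀ {n : ℕ} (z : Fin n → K),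
    Function.Injective z → (∀ i, z i ≠ 0) →
    ∑ w : Equiv.Perm (Fin n), symFactor t (z ∘ w) = bracketFactorial t n := by
  intro n
  induction n with
  | zero => intro z _ _; simp [symFactor, bracketFactorial]
  | succ n ih =>
    intro z hz hz0
    rw [← Equiv.sum_comp Equiv.Perm.decomposeFin.symm, Fintype.sum_prod_type]
    have h1 : ∀ p : Fin (n + 1), ∑ e : Equiv.Perm (Fin n),
        symFactor t (z ∘ Equiv.Perm.decomposeFin.symm (p, e)) =
        (∏ k ∈ Finset.univ.erase p, (z k - t * z p) / (z k - z p)) * bracketFactorial t n := by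
      intro p
      let y : Fin n → K := fun i => z (Equiv.swap 0 p i.succ)
      have hy : Function.Injective y := fun a b hab => by
        simpa using hz hab
      rw [← ih y hy fun i => hz0 _, Finset.mul_sum]
      refine Finset.sum_congr rfl fun e _ => ?_
      rw [symFactor_succ]
      simp only [Function.comp_apply, Equiv.Perm.decomposeFin_symm_apply_zero,
        Equiv.Perm.decomposeFin_symm_apply_succ]
      congr 1
      rw [Equiv.prod_comp e fun j => (z (Equiv.swap 0 p j.succ) - t * z p) /
        (z (Equiv.swap 0 p j.succ) - z p)]
      have h0 : (Finset.univ.erase p) =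
          (Finset.univ.erase (0 : Fin (n + 1))).map (Equiv.swap 0 p).toEmbedding := by
        ext x
        simp
      have h3 : Finset.univ.erase (0 : Fin (n + 1)) = Finset.univ.map (Fin.succEmb n) := by
        ext x
        refine Fin.cases ?_ (fun i => ?_) x <;> simp
      rw [h0, Finset.prod_map, h3, Finset.prod_map]
      rfl
    rw [Finset.sum_congr rfl fun p _ => h1 p, ← Finset.sum_mul, sum_prod_erase t ht z hz hz0]
    unfold bracketFactorial
    rw [Finset.prod_Icc_succ_top (by omega), mul_comm]

end Symmetrization

/-! ### Rearrangements -/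

section Rearrangement

theorem incr_monotone (η : Fin n → ℕ) : Monotone (incr η) := Tuple.monotone_sort η

theorem plus_antitone (η : Fin n → ℕ) : Antitone (plus η) := fun _ _ h =>
  incr_monotone η (Fin.rev_le_rev.2 h)

theorem incr_comp (η : Fin n → ℕ) (σ : Equiv.Perm (Fin n)) : incr (η ∘ σ) = incr η :=
  Tuple.comp_perm_comp_sort_eq_comp_sort

theorem plus_comp (η : Fin n → ℕ) (σ : Equiv.Perm (Fin n)) : plus (η ∘ σ) = plus η := by
  unfold plus
  rw [incr_comp]

theorem exists_incr_eq (η : Fin n → ℕ) : ∃ σ : Equiv.Perm (Fin n), incr η = η ∘ σ :=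
  ⟨Tuple.sort η, rfl⟩

theorem exists_plus_eq (η : Fin n → ℕ) : ∃ σ : Equiv.Perm (Fin n), plus η = η ∘ σ :=
  ⟨Fin.revPerm.trans (Tuple.sort η), rfl⟩

theorem plus_of_antitone {κ : Fin n → ℕ} (hκ : Antitone κ) : plus κ = κ := by
  obtain ⟨σ, hσ⟩ := exists_plus_eq κ
  have h1 : Antitone (κ ∘ σ) := hσ ▸ plus_antitone κ
  have h2 : Antitone (κ ∘ (Equiv.refl _ : Equiv.Perm (Fin n))) := by simpa using hκ
  rw [hσ, Tuple.unique_antitone h1 h2]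
  rfl

theorem plus_plus (η : Fin n → ℕ) : plus (plus η) = plus η := plus_of_antitone (plus_antitone η)

theorem plus_incr (η : Fin n → ℕ) : plus (incr η) = plus η := by
  obtain ⟨σ, hσ⟩ := exists_incr_eq η
  rw [hσ, plus_comp]

/-- The rows of `η` in the row order. -/
def colegEquiv (η : Fin n → ℕ) : Fin n ≃ Fin n :=
  Equiv.ofBijective (fun i => ⟨coleg η i, coleg_lt η i⟩)
    ((Finite.injective_iff_bijective).1 fun a b h => coleg_injective η (by simpa using h))

@[simp] theorem colegEquiv_val (η : Fin n → ℕ) (i : Fin n) :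
    ((colegEquiv η i : Fin n) : ℕ) = coleg η i := rfl

theorem plus_colegEquiv (η : Fin n → ℕ) (i : Fin n) : plus η (colegEquiv η i) = η i := by
  have h1 : Antitone (η ∘ (colegEquiv η).symm) := by
    intro a b hab
    obtain ⟨i, rfl⟩ := (colegEquiv η).surjective a
    obtain ⟨j, rfl⟩ := (colegEquiv η).surjective b
    simp only [Function.comp_apply, Equiv.symm_apply_apply]
    rcases hab.lt_or_eq with h | h
    · have : Prec η i j := prec_iff_coleg_lt.2 h
      unfold Prec at this
      omega
    · rw [(colegEquiv η).injective h]
  have h2 := plus_of_antitone h1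
  rw [plus_comp] at h2
  rw [h2]
  simp

/-- Products over the rows depend only on the row lengths and the leg colengths. -/
@[to_additive]
theorem prod_rows_plus {M : Type*} [CommMonoid M] (η : Fin n → ℕ) (F : ℕ → ℕ → M) :
    ∏ i, F (η i) (coleg η i) = ∏ i, F (plus η i) i := by
  rw [← Equiv.prod_comp (colegEquiv η) fun i => F (plus η i) i]
  simp only [plus_colegEquiv, colegEquiv_val]

theorem prod_rows_plus' {M : Type*} [CommMonoid M] (η : Fin n → ℕ) (F : ℕ → ℕ → M) :
    ∏ i, F (plus η i) (coleg (plus η) i) = ∏ i, F (η i) (coleg η i) := by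
  rw [prod_rows_plus η, prod_rows_plus (plus η), plus_plus]

variable {K : Type*} [Field K] (q t : K)

theorem eConst_plus (η : Fin n → ℕ) : eConst q t (plus η) = eConst q t η :=
  prod_rows_plus' η fun a c => ∏ j ∈ Finset.Icc 1 a, (1 - q ^ (coarm j + 1) * t ^ (n - c))

theorem eConst'_plus (η : Fin n → ℕ) : eConst' q t (plus η) = eConst' q t η :=
  prod_rows_plus' η fun a c => ∏ j ∈ Finset.Icc 1 a, (1 - q ^ (coarm j + 1) * t ^ (n - 1 - c))

theorem eConst_incr (η : Fin n → ℕ) : eConst q t (incr η) = eConst q t (plus η) := by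
  rw [← eConst_plus, plus_incr]

theorem eConst'_incr (η : Fin n → ℕ) : eConst' q t (incr η) = eConst' q t (plus η) := by
  rw [← eConst'_plus, plus_incr]

/-- The number of rows shorter than `j`. -/
def below (η : Fin n → ℕ) (j : ℕ) : ℕ := (Finset.univ.filter fun k => η k < j).card

theorem below_comp (η : Fin n → ℕ) (σ : Equiv.Perm (Fin n)) (j : ℕ) :
    below (η ∘ σ) j = below η j := by
  unfold below
  rw [Finset.card_filter, Finset.card_filter]
  exact Equiv.sum_comp σ fun k => if η k < j then 1 else 0

theorem below_plus (η : Fin n → ℕ) (j : ℕ) : below (plus η) j = below η j := by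
  obtain ⟨σ, hσ⟩ := exists_plus_eq η
  rw [hσ, below_comp]

theorem below_incr (η : Fin n → ℕ) (j : ℕ) : below (incr η) j = below η j := by
  obtain ⟨σ, hσ⟩ := exists_incr_eq η
  rw [hσ, below_comp]

theorem sum_one_fin (n : ℕ) : n = ∑ _k : Fin n, 1 := by simp

theorem leg_of_antitone {κ : Fin n → ℕ} (hκ : Antitone κ) (i : Fin n) {j : ℕ} (hj : j ≤ κ i) :
    leg κ i j + coleg κ i + below κ j + 1 = n := by
  have h1 : (1 : ℕ) = ∑ k, if k = i then 1 else 0 := by simp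
  rw [leg_eq_sum, coleg_eq_sum, below, Finset.card_filter, h1, ← Finset.sum_add_distrib,
    ← Finset.sum_add_distrib, ← Finset.sum_add_distrib]
  refine Eq.trans ?_ (sum_one_fin n).symm
  refine Finset.sum_congr rfl fun k _ => ?_
  unfold Prec
  rcases lt_trichotomy k i with hk | rfl | hk
  · have := hκ hk.le
    have h2 : ¬ i < k := by omega
    simp only [hk, h2, hk.ne, true_and, false_and, if_false, and_true]
    split_ifs <;> omega
  · simp [hj]
  · have := hκ hk.le
    have h2 : ¬ k < i := by omega
    simp only [hk, h2, hk.ne', true_and, false_and, if_false, and_false, or_false]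
    split_ifs <;> omega

theorem leg_of_monotone {κ : Fin n → ℕ} (hκ : Monotone κ) (i : Fin n) {j : ℕ} (hj : j + 1 ≤ κ i) :
    leg κ i (j + 1) + coleg κ i + below κ j + 1 = n := by
  have h1 : (1 : ℕ) = ∑ k, if k = i then 1 else 0 := by simp
  nth_rw 2 [h1]
  rw [leg_eq_sum, coleg_eq_sum, below, Finset.card_filter, ← Finset.sum_add_distrib,
    ← Finset.sum_add_distrib, ← Finset.sum_add_distrib]
  refine Eq.trans ?_ (sum_one_fin n).symm
  refine Finset.sum_congr rfl fun k _ => ?_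
  unfold Prec
  rcases lt_trichotomy k i with hk | rfl | hk
  · have := hκ hk.le
    have h2 : ¬ i < k := by omega
    simp only [hk, h2, hk.ne, true_and, false_and, if_false, and_true]
    split_ifs <;> omega
  · simp
    omega
  · have := hκ hk.le
    have h2 : ¬ k < i := by omega
    simp only [hk, h2, hk.ne', true_and, false_and, if_false, and_false, or_false]
    split_ifs <;> omega

end Rearrangement

end

section

variable {n : ℕ}

section Formulas

variable {K : Type*} [Field K] {q t : K}

/-- Parameters for which no product `q^a t^b` other than `q^0 t^0` is `1`. -/
structure Admissible (q t : K) : Prop where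
  q_ne : q ≠ 0
  t_ne : t ≠ 0
  pow_eq_one : ∀ a b : ℕ, q ^ a * t ^ b = 1 → a = 0 ∧ b = 0

theorem Admissible.one_sub_ne (h : Admissible q t) {a b : ℕ} (hab : a ≠ 0 ∨ b ≠ 0) :
    1 - q ^ a * t ^ b ≠ 0 := fun h0 => by
  have := h.pow_eq_one a b (sub_eq_zero.1 h0).symm
  omega

theorem Admissible.pow_t_ne (h : Admissible q t) {b : ℕ} (hb : b ≠ 0) : t ^ b ≠ 1 := fun h0 =>
  hb (h.pow_eq_one 0 b (by simpa using h0)).2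

theorem Admissible.t_ne_one (h : Admissible q t) : t ≠ 1 := by
  simpa using h.pow_t_ne one_ne_zero

theorem Admissible.inv (h : Admissible q t) : Admissible q⁻¹ t⁻¹ where
  q_ne := inv_ne_zero h.q_ne
  t_ne := inv_ne_zero h.t_ne
  pow_eq_one a b hab := h.pow_eq_one a b (by
    rw [inv_pow, inv_pow, ← mul_inv, inv_eq_one] at hab
    exact hab)

@[to_additive]
theorem prod_shift {M : Type*} [CommMonoid M] (f : ℕ → M) (a : ℕ) :
    (∏ j ∈ Finset.Icc 1 a, f (j - 1)) * f a = (∏ j ∈ Finset.Icc 1 a, f j) * f 0 := by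
  induction a with
  | zero => simp
  | succ a ih =>
    rw [Finset.prod_Icc_succ_top (by omega), Finset.prod_Icc_succ_top (by omega),
      Nat.add_sub_cancel, ih]
    exact mul_right_comm _ _ _

@[simp] theorem below_zero (η : Fin n → ℕ) : below η 0 = 0 := by simp [below]

/-- The factor of a node in the row of rank `c` and length `m`, up to the column. -/
def nodeFactor (q t : K) (η : Fin n → ℕ) (m c j : ℕ) : K :=
  1 - q ^ (m - j) * t ^ (n - c - below η j)

theorem dConst_incr_eq (η : Fin n → ℕ) :
    dConst q t (incr η) =
      ∏ c : Fin n, ∏ j ∈ Finset.Icc 1 (plus η c), nodeFactor q t η (plus η c) c (j - 1) := by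
  rw [← plus_incr η, ← prod_rows_plus (incr η) fun a c =>
    ∏ j ∈ Finset.Icc 1 a, nodeFactor q t η a c (j - 1)]
  refine Finset.prod_congr rfl fun i _ => Finset.prod_congr rfl fun j hj => ?_
  rw [Finset.mem_Icc] at hj
  obtain ⟨j, rfl⟩ := Nat.exists_eq_add_of_le' hj.1
  have h := leg_of_monotone (incr_monotone η) i hj.2
  rw [below_incr] at h
  unfold nodeFactor arm
  rw [Nat.add_sub_cancel]
  congr 3 <;> omega

theorem hConst_plus_eq (η : Fin n → ℕ) :
    hConst q t (plus η) =
      ∏ c : Fin n, ∏ j ∈ Finset.Icc 1 (plus η c), nodeFactor q t η (plus η c) c j := by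
  refine Finset.prod_congr rfl fun i _ => Finset.prod_congr rfl fun j hj => ?_
  rw [Finset.mem_Icc] at hj
  have h := leg_of_antitone (plus_antitone η) i hj.2
  rw [below_plus, coleg_antitone (plus_antitone η)] at h
  unfold nodeFactor arm
  congr 3
  omega

theorem below_plus_add_lt (η : Fin n → ℕ) (c : Fin n) : below η (plus η c) + c < n := by
  have h := leg_of_antitone (plus_antitone η) c le_rfl
  rw [below_plus, coleg_antitone (plus_antitone η)] at h
  omega

theorem dConst_incr_mul (η : Fin n → ℕ) :
    dConst q t (incr η) * ∏ c : Fin n, (1 - t ^ (n - c - below η (plus η c))) =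
      hConst q t (plus η) * ∏ c : Fin n, (1 - q ^ plus η c * t ^ (n - (c : ℕ))) := by
  rw [dConst_incr_eq, hConst_plus_eq, ← Finset.prod_mul_distrib, ← Finset.prod_mul_distrib]
  refine Finset.prod_congr rfl fun c _ => ?_
  have := prod_shift (nodeFactor q t η (plus η c) c) (plus η c)
  simpa [nodeFactor] using this

theorem legSum_incr (η : Fin n → ℕ) :
    legSum (incr η) = legSum (plus η) + ∑ c : Fin n, below η (plus η c) := by
  let g : ℕ → ℕ → ℕ := fun c j => n - 1 - c - below η j
  have h1 : legSum (incr η) =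
      ∑ c : Fin n, ∑ j ∈ Finset.Icc 1 (plus η c), g c (j - 1) := by
    rw [← plus_incr η, ← sum_rows_plus (incr η) fun a c => ∑ j ∈ Finset.Icc 1 a, g c (j - 1)]
    refine Finset.sum_congr rfl fun i _ => Finset.sum_congr rfl fun j hj => ?_
    rw [Finset.mem_Icc] at hj
    obtain ⟨j, rfl⟩ := Nat.exists_eq_add_of_le' hj.1
    have h := leg_of_monotone (incr_monotone η) i hj.2
    rw [below_incr] at h
    simp only [g, Nat.add_sub_cancel]
    omega
  have h2 : legSum (plus η) = ∑ c : Fin n, ∑ j ∈ Finset.Icc 1 (plus η c), g c j := by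
    refine Finset.sum_congr rfl fun i _ => Finset.sum_congr rfl fun j hj => ?_
    rw [Finset.mem_Icc] at hj
    have h := leg_of_antitone (plus_antitone η) i hj.2
    rw [below_plus, coleg_antitone (plus_antitone η)] at h
    simp only [g]
    omega
  rw [h1, h2, ← Finset.sum_add_distrib]
  refine Finset.sum_congr rfl fun c _ => ?_
  have h3 := sum_shift (g c) (plus η c)
  have h4 := below_plus_add_lt η c
  have h5 : g c 0 = g c (plus η c) + below η (plus η c) := by
    simp only [g, below_zero]
    omega
  omega

theorem prod_Icc_coarm (T : K) (a : ℕ) :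
    (∏ j ∈ Finset.Icc 1 a, (1 - q ^ coarm j * T)) * (1 - q ^ a * T) =
      (∏ j ∈ Finset.Icc 1 a, (1 - q ^ (coarm j + 1) * T)) * (1 - T) := by
  have := prod_shift (fun j => 1 - q ^ j * T) a
  simp only [pow_zero, one_mul] at this
  rw [show (∏ j ∈ Finset.Icc 1 a, (1 - q ^ (coarm j + 1) * T)) =
    ∏ j ∈ Finset.Icc 1 a, (1 - q ^ j * T) from ?_]
  · exact this
  · refine Finset.prod_congr rfl fun j hj => ?_
    rw [Finset.mem_Icc] at hj
    rw [coarm, Nat.sub_add_cancel hj.1]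

theorem bConst_mul_of_antitone {κ : Fin n → ℕ} (hκ : Antitone κ) :
    bConst q t κ * ∏ c : Fin n, (1 - q ^ κ c * t ^ (n - (c : ℕ))) =
      eConst q t κ * ∏ c : Fin n, (1 - t ^ (n - (c : ℕ))) := by
  unfold bConst eConst
  rw [← Finset.prod_mul_distrib, ← Finset.prod_mul_distrib]
  refine Finset.prod_congr rfl fun c _ => ?_
  rw [coleg_antitone hκ]
  exact prod_Icc_coarm _ _

theorem prod_rank {M : Type*} [CommMonoid M] (g : ℕ → M) (S : Finset (Fin n)) :
    ∏ i ∈ S, g (1 + (S.filter (i < ·)).card) = ∏ k ∈ Finset.Icc 1 S.card, g k := by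
  induction S using Finset.induction_on_min with
  | empty => simp
  | insert a S ha ih =>
    have haS : a ∉ S := fun h => lt_irrefl a (ha a h)
    rw [Finset.prod_insert haS, Finset.card_insert_of_notMem haS,
      Finset.prod_Icc_succ_top (by omega), mul_comm]
    congr 1
    · rw [← ih]
      refine Finset.prod_congr rfl fun i hi => ?_
      rw [Finset.filter_insert, if_neg (not_lt.2 (ha i hi).le)]
    · rw [Finset.filter_insert, if_neg (lt_irrefl a), Finset.filter_true_of_mem ha, add_comm]

theorem ties_add (η : Fin n → ℕ) (i : Fin n) :
    coleg η i + below η (η i) +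
      (1 + ((Finset.univ.filter fun k => η k = η i).filter (i < ·)).card) = n := by
  have h1 : (1 : ℕ) = ∑ k, if k = i then 1 else 0 := by simp
  nth_rw 1 [h1]
  rw [coleg_eq_sum, below, Finset.filter_filter, Finset.card_filter, Finset.card_filter,
    ← Finset.sum_add_distrib, ← Finset.sum_add_distrib, ← Finset.sum_add_distrib]
  refine Eq.trans ?_ (sum_one_fin n).symm
  refine Finset.sum_congr rfl fun k _ => ?_
  unfold Prec
  rcases lt_trichotomy k i with hk | rfl | hk
  · have h2 : ¬ i < k := by omega
    simp only [hk, h2, hk.ne, if_false, and_true, and_false]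
    split_ifs <;> omega
  · simp
  · have h2 : ¬ k < i := by omega
    simp only [hk, h2, hk.ne', if_false, and_false, or_false, and_true]
    split_ifs <;> omega

theorem prod_bracketFactorial_mult (s : K) (η : Fin n → ℕ) :
    ∏ j ∈ Finset.range (Finset.univ.sup η + 1), bracketFactorial s (mult η j) =
      ∏ c : Fin n, (1 - s ^ (n - c - below η (plus η c))) / (1 - s) := by
  rw [← prod_rows_plus η fun a c => (1 - s ^ (n - c - below η a)) / (1 - s)]
  rw [← Finset.prod_fiberwise_of_maps_to (s := Finset.univ)
    (t := Finset.range (Finset.univ.sup η + 1)) (g := η) fun i _ =>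
      Finset.mem_range.2 (Nat.lt_succ_of_le (Finset.le_sup (Finset.mem_univ i)))]
  refine Finset.prod_congr rfl fun j _ => ?_
  unfold bracketFactorial mult
  rw [← prod_rank]
  refine Finset.prod_congr rfl fun i hi => ?_
  simp only [Finset.mem_filter, Finset.mem_univ, true_and] at hi
  have := ties_add η i
  subst hi
  congr 3
  omega

theorem bracketFactorial_eq_prod (s : K) (n : ℕ) :
    bracketFactorial s n = ∏ c : Fin n, (1 - s ^ (n - (c : ℕ))) / (1 - s) := by
  have h := prod_rank (fun k => (1 - s ^ k) / (1 - s)) (Finset.univ : Finset (Fin n))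
  rw [Finset.card_univ, Fintype.card_fin] at h
  rw [bracketFactorial, ← h]
  refine Finset.prod_congr rfl fun i _ => ?_
  have h1 : Finset.univ.filter (i < ·) = Finset.Ioi i := by ext; simp
  rw [h1, Fin.card_Ioi]
  congr 3
  omega

theorem bracketMultinomial_mul {s : K} (hs : ∀ k : ℕ, k ≠ 0 → s ^ k ≠ 1) (η : Fin n → ℕ) :
    bracketMultinomial s η * ∏ c : Fin n, (1 - s ^ (n - c - below η (plus η c))) =
      ∏ c : Fin n, (1 - s ^ (n - (c : ℕ))) := by
  have h1 : 1 - s ≠ 0 := sub_ne_zero.2 (by simpa using (hs 1 one_ne_zero).symm)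
  have h2 : ∏ c : Fin n, (1 - s ^ (n - c - below η (plus η c))) ≠ 0 := by
    refine Finset.prod_ne_zero_iff.2 fun c _ => sub_ne_zero.2 (hs _ ?_).symm
    have := below_plus_add_lt η c
    omega
  unfold bracketMultinomial
  rw [prod_bracketFactorial_mult, bracketFactorial_eq_prod, Finset.prod_div_distrib,
    Finset.prod_div_distrib, Finset.prod_const]
  field_simp

theorem one_sub_inv_pow (ht : t ≠ 0) (k : ℕ) : 1 - t⁻¹ ^ k = -(t⁻¹ ^ k * (1 - t ^ k)) := by
  have : t⁻¹ ^ k * t ^ k = 1 := by rw [← mul_pow, inv_mul_cancel₀ ht, one_pow]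
  linear_combination -this

theorem bracketMultinomial_inv_mul (h : Admissible q t) (η : Fin n → ℕ) :
    t ^ (∑ c : Fin n, below η (plus η c)) * bracketMultinomial t⁻¹ η = bracketMultinomial t η := by
  have h1 := bracketMultinomial_mul (s := t) (fun k hk => h.pow_t_ne hk) η
  have h2 := bracketMultinomial_mul (s := t⁻¹) (fun k hk => h.inv.pow_t_ne hk) η
  have h3 : ∏ c : Fin n, (1 - t ^ (n - c - below η (plus η c))) ≠ 0 := by
    refine Finset.prod_ne_zero_iff.2 fun c _ => sub_ne_zero.2 (h.pow_t_ne ?_).symm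
    have := below_plus_add_lt η c
    omega
  have h4 : ∏ c : Fin n, (1 - t⁻¹ ^ (n - c - below η (plus η c))) * t ^ (n - (c : ℕ)) =
      ∏ c : Fin n, (-(1 - t ^ (n - c - below η (plus η c))) * t ^ below η (plus η c)) := by
    refine Finset.prod_congr rfl fun c _ => ?_
    have h5 := below_plus_add_lt η c
    have h6 : n - (c : ℕ) = (n - c - below η (plus η c)) + below η (plus η c) := by omega
    conv_lhs => rw [one_sub_inv_pow h.t_ne, h6, pow_add]
    have : t⁻¹ ^ (n - c - below η (plus η c)) * t ^ (n - c - below η (plus η c)) = 1 := by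
      rw [← mul_pow, inv_mul_cancel₀ h.t_ne, one_pow]
    simp only [Nat.add_sub_cancel]
    linear_combination (-(1 - t ^ (n - c - below η (plus η c))) * t ^ below η (plus η c)) * this
  have h5 : ∏ c : Fin n, (1 - t⁻¹ ^ (n - (c : ℕ))) * t ^ (n - (c : ℕ)) =
      ∏ c : Fin n, (-(1 - t ^ (n - (c : ℕ)))) := by
    refine Finset.prod_congr rfl fun c _ => ?_
    have : t⁻¹ ^ (n - (c : ℕ)) * t ^ (n - (c : ℕ)) = 1 := by
      rw [← mul_pow, inv_mul_cancel₀ h.t_ne, one_pow]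
    linear_combination -this
  simp only [Finset.prod_mul_distrib, ← neg_one_mul (1 - t ^ _), Finset.prod_pow_eq_pow_sum]
    at h4 h5
  refine mul_right_cancel₀ h3 ?_
  rw [h1]
  have h6 : (∏ c : Fin n, (-1 : K)) ≠ 0 := by simp
  refine mul_left_cancel₀ h6 ?_
  rw [← h5, ← h2]
  linear_combination -(bracketMultinomial t⁻¹ η) * h4

/-- The two forms of the constant in the evaluation and norm formulas. -/
theorem bracketMultinomial_mul_div (h : Admissible q t) (η : Fin n → ℕ)
    (hh : hConst q t (plus η) ≠ 0) (hd : dConst q t (incr η) ≠ 0) :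
    bracketMultinomial t η * (eConst q t (incr η) / dConst q t (incr η)) =
      bConst q t (plus η) / hConst q t (plus η) := by
  have h1 := bracketMultinomial_mul (s := t) (fun k hk => h.pow_t_ne hk) η
  have h2 := dConst_incr_mul (q := q) (t := t) η
  have h3 := bConst_mul_of_antitone (q := q) (t := t) (plus_antitone η)
  have h4 : ∏ c : Fin n, (1 - t ^ (n - c - below η (plus η c))) ≠ 0 := by
    refine Finset.prod_ne_zero_iff.2 fun c _ => sub_ne_zero.2 (h.pow_t_ne ?_).symm
    have := below_plus_add_lt η c
    omega
  have h5 : ∏ c : Fin n, (1 - q ^ plus η c * t ^ (n - (c : ℕ))) ≠ 0 :=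
    Finset.prod_ne_zero_iff.2 fun c _ => h.one_sub_ne (Or.inr (by omega))
  rw [eConst_incr, mul_div_assoc', div_eq_div_iff hd hh]
  refine mul_right_cancel₀ h4 (mul_right_cancel₀ h5 ?_)
  linear_combination (eConst q t (plus η) * hConst q t (plus η) *
    ∏ c : Fin n, (1 - q ^ plus η c * t ^ (n - (c : ℕ)))) * h1 - bConst q t (plus η) *
    (∏ c : Fin n, (1 - q ^ plus η c * t ^ (n - (c : ℕ)))) * h2 -
    hConst q t (plus η) * (∏ c : Fin n, (1 - q ^ plus η c * t ^ (n - (c : ℕ)))) * h3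

end Formulas

end

section

variable {n : ℕ}

section Spectrum

variable {K : Type*} [Field K] {q t : K}

/-- The joint spectrum of the Cherednik operators on the nonsymmetric Macdonald polynomial
`E_η`. -/
def spec (q t : K) (η : Fin n → ℕ) (i : Fin n) : K := q ^ η i * t ^ (n - 1 - coleg η i)

theorem spec_ne_zero (h : Admissible q t) (η : Fin n → ℕ) (i : Fin n) : spec q t η i ≠ 0 :=
  mul_ne_zero (pow_ne_zero _ h.q_ne) (pow_ne_zero _ h.t_ne)

theorem spec_inv (η : Fin n → ℕ) (i : Fin n) : spec q⁻¹ t⁻¹ η i = (spec q t η i)⁻¹ := by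
  simp [spec, mul_comm]

theorem spec_of_prec {η : Fin n → ℕ} {i j : Fin n} (hij : Prec η i j) :
    spec q t η i = q ^ (η i - η j) * t ^ (coleg η j - coleg η i) * spec q t η j := by
  have h1 := coleg_lt_of_prec hij
  have h2 := coleg_lt η j
  have h3 : η j ≤ η i := by unfold Prec at hij; omega
  unfold spec
  rw [mul_mul_mul_comm, ← pow_add, ← pow_add, Nat.sub_add_cancel h3]
  congr 2
  omega

theorem spec_injective (h : Admissible q t) (η : Fin n → ℕ) :
    Function.Injective (spec q t η) := by
  have key : ∀ i j, Prec η i j → spec q t η i ≠ spec q t η j := fun i j hij heq => by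
    have h1 := coleg_lt_of_prec hij
    rw [spec_of_prec hij] at heq
    have := h.pow_eq_one _ _ ((mul_eq_right₀ (spec_ne_zero h η j)).1 heq)
    omega
  intro i j hij
  by_contra hne
  rcases prec_trichotomy η hne with h' | h'
  · exact key _ _ h' hij
  · exact key _ _ h' hij.symm

theorem eq_and_eq_or_of_pow_mul_pow_eq (h : Admissible q t) {a b c d : ℕ}
    (e : q ^ a * t ^ b = q ^ c * t ^ d) : (a = c ∧ b = d) ∨ (a < c ∧ d < b) ∨ (c < a ∧ b < d) := by
  have hq := h.q_ne
  have ht := h.t_ne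
  rcases le_or_gt a c with h1 | h1 <;> rcases le_or_gt b d with h2 | h2
  · obtain ⟨x, rfl⟩ := Nat.exists_eq_add_of_le h1
    obtain ⟨y, rfl⟩ := Nat.exists_eq_add_of_le h2
    have : q ^ x * t ^ y = 1 := by
      refine mul_left_cancel₀ (mul_ne_zero (pow_ne_zero a hq) (pow_ne_zero b ht)) ?_
      rw [pow_add, pow_add] at e
      linear_combination -e
    have := h.pow_eq_one _ _ this
    omega
  · rcases h1.lt_or_eq with h3 | rfl
    · omega
    · obtain ⟨y, rfl⟩ := Nat.exists_eq_add_of_lt h2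
      have e' := mul_left_cancel₀ (pow_ne_zero a hq) e
      have : q ^ 0 * t ^ (y + 1) = 1 := by
        refine mul_left_cancel₀ (pow_ne_zero d ht) ?_
        rw [add_assoc, pow_add] at e'
        linear_combination e'
      have := h.pow_eq_one _ _ this
      omega
  · rcases h2.lt_or_eq with h3 | rfl
    · omega
    · obtain ⟨y, rfl⟩ := Nat.exists_eq_add_of_lt h1
      have e' := mul_right_cancel₀ (pow_ne_zero b ht) e
      have : q ^ (y + 1) * t ^ 0 = 1 := by
        refine mul_left_cancel₀ (pow_ne_zero c hq) ?_
        rw [add_assoc, pow_add] at e'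
        linear_combination e'
      have := h.pow_eq_one _ _ this
      omega
  · obtain ⟨x, rfl⟩ := Nat.exists_eq_add_of_lt h1
    obtain ⟨y, rfl⟩ := Nat.exists_eq_add_of_lt h2
    have : q ^ (x + 1) * t ^ (y + 1) = 1 := by
      refine mul_left_cancel₀ (mul_ne_zero (pow_ne_zero c hq) (pow_ne_zero d ht)) ?_
      rw [add_assoc, pow_add q, add_assoc, pow_add t] at e
      linear_combination e
    have := h.pow_eq_one _ _ this
    omega

/-- A tuple together with an enumeration of its positions by decreasing entries. -/
structure IsRanking (α γ : Fin n → ℕ) : Prop where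
  inj : Function.Injective γ
  lt : ∀ i, γ i < n
  le : ∀ k i, γ k < γ i → α i ≤ α k

theorem isRanking_coleg (η : Fin n → ℕ) : IsRanking η (coleg η) where
  inj := coleg_injective η
  lt := coleg_lt η
  le _ _ h := by
    have := prec_iff_coleg_lt.2 h
    unfold Prec at this
    omega

theorem IsRanking.comp {α γ : Fin n → ℕ} (h : IsRanking α γ) (σ : Equiv.Perm (Fin n)) :
    IsRanking (α ∘ σ) (γ ∘ σ) where
  inj := h.inj.comp σ.injective
  lt i := h.lt (σ i)
  le _ _ hki := h.le _ _ hki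

theorem IsRanking.exists_eq {α γ : Fin n → ℕ} (h : IsRanking α γ) {c : ℕ} (hc : c < n) :
    ∃ i, γ i = c := by
  have hs : Function.Surjective fun i => (⟨γ i, h.lt i⟩ : Fin n) :=
    Finite.surjective_of_injective fun i j hij => h.inj (by simpa using hij)
  obtain ⟨i, hi⟩ := hs ⟨c, hc⟩
  exact ⟨i, by simpa using hi⟩

theorem IsRanking.separates (h : Admissible q t) {α γ β δ : Fin n → ℕ} (h1 : IsRanking α γ)
    (h2 : IsRanking β δ)
    (e : ∀ i, q ^ α i * t ^ (n - 1 - γ i) = q ^ β i * t ^ (n - 1 - δ i)) : α = β ∧ γ = δ := by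
  have key : ∀ i, (α i = β i ∧ γ i = δ i) ∨ (α i < β i ∧ γ i < δ i) ∨
      (β i < α i ∧ δ i < γ i) := fun i => by
    have h3 := h1.lt i
    have h4 := h2.lt i
    rcases eq_and_eq_or_of_pow_mul_pow_eq h (e i) with h5 | h5 | h5 <;> omega
  have hind : ∀ c : ℕ, ∀ i, (γ i = c ∨ δ i = c) → α i = β i ∧ γ i = δ i := by
    intro c
    induction c using Nat.strong_induction_on with
    | _ c ih =>
      have main : ∀ α β γ δ : Fin n → ℕ, IsRanking α γ → IsRanking β δ →
          (∀ i, (α i = β i ∧ γ i = δ i) ∨ (α i < β i ∧ γ i < δ i) ∨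
            (β i < α i ∧ δ i < γ i)) →
          (∀ c' < c, ∀ i, (γ i = c' ∨ δ i = c') → γ i = δ i) →
          ∀ i, γ i = c → α i = β i ∧ γ i = δ i := by
        intro α β γ δ h1 h2 hkey hih i hi
        by_contra hcon
        have h3 : α i < β i ∧ γ i < δ i := by
          rcases hkey i with h4 | h4 | h4
          · exact absurd h4 hcon
          · exact h4
          · have := hih (δ i) (by omega) i (Or.inr rfl)
            omega
        obtain ⟨k, hk⟩ := h2.exists_eq (c := c) (hi ▸ h1.lt i)
        have hki := h2.le k i (by omega)
        have hne : k ≠ i := fun hh => by subst hh; omega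
        have hck : c < γ k := by
          rcases lt_trichotomy (γ k) c with h4 | h4 | h4
          · have := hih _ h4 k (Or.inl rfl)
            omega
          · exact absurd (h1.inj (h4.trans hi.symm)) hne
          · exact h4
        have hik := h1.le i k (by omega)
        have h4 := hkey k
        omega
      intro i hi
      rcases hi with hi | hi
      · exact main α β γ δ h1 h2 key (fun c' hc' i hi => (ih c' hc' i hi).2) i hi
      · have := main β α δ γ h2 h1 (fun i => by have := key i; omega)
          (fun c' hc' i hi => (ih c' hc' i hi.symm).2.symm) i hi
        exact ⟨this.1.symm, this.2.symm⟩
  exact ⟨funext fun i => (hind _ i (Or.inl rfl)).1, funext fun i => (hind _ i (Or.inl rfl)).2⟩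

/-- The joint spectrum determines the composition. -/
theorem spec_separates (h : Admissible q t) {η ν : Fin n → ℕ}
    (e : ∀ i, spec q t η i = spec q t ν i) : η = ν :=
  ((isRanking_coleg η).separates h (isRanking_coleg ν) e).1

theorem spec_separates_comp (h : Admissible q t) {η ν : Fin n → ℕ} {σ : Equiv.Perm (Fin n)}
    (e : ∀ i, spec q t η i = spec q t ν (σ i)) : η = ν ∘ σ ∧ coleg η = coleg ν ∘ σ :=
  (isRanking_coleg η).separates h ((isRanking_coleg ν).comp σ) e

theorem spec_adj {m : ℕ} {η : Fin (m + 1) → ℕ} {i : Fin m} (h : η i.castSucc ≠ η i.succ)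
    (k : Fin (m + 1)) : spec q t (η ∘ adj i) k = spec q t η (adj i k) := by
  unfold spec
  rw [coleg_adj i h]
  rfl

theorem spec_raise_castSucc {m : ℕ} (η : Fin (m + 1) → ℕ) (i : Fin m) :
    spec q t (raise η) i.castSucc = spec q t η i.succ := by
  unfold spec
  rw [coleg_raise_castSucc, raise_castSucc]

theorem spec_raise_last {m : ℕ} (η : Fin (m + 1) → ℕ) :
    spec q t (raise η) (Fin.last m) = q * spec q t η 0 := by
  unfold spec
  rw [coleg_raise_last, raise_last, pow_succ']
  ring

/-! ### The leading constant of the symmetric polynomial -/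

theorem prod_row_telescope (h : Admissible q t) (a : ℕ) : ∀ {N : ℕ} (μ : Fin N → ℕ),
    Antitone μ → (∀ k, μ k ≤ a) →
    (∏ j ∈ Finset.Icc 1 a, (1 - q ^ (a - j + 1) *
        t ^ ((Finset.univ.filter fun k => j ≤ μ k).card + 1))) *
      ((1 - t) * ∏ k : Fin N, (1 - q ^ (a - μ k) * t ^ ((k : ℕ) + 2))) =
    (∏ j ∈ Finset.Icc 1 a, (1 - q ^ (a - j) *
        t ^ ((Finset.univ.filter fun k => j ≤ μ k).card + 1))) *
      ((1 - q ^ a * t ^ (N + 1)) * ∏ k : Fin N, (1 - q ^ (a - μ k) * t ^ ((k : ℕ) + 1))) := by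
  intro N
  have tele : ∀ (T : K) (b : ℕ), b ≤ a →
      (∏ j ∈ Finset.Icc 1 b, (1 - q ^ (a - j + 1) * T)) * (1 - q ^ (a - b) * T) =
      (∏ j ∈ Finset.Icc 1 b, (1 - q ^ (a - j) * T)) * (1 - q ^ a * T) := fun T b hb => by
    have := prod_shift (fun j => 1 - q ^ (a - j) * T) b
    rw [Nat.sub_zero] at this
    rw [← this]
    congr 1
    refine Finset.prod_congr rfl fun j hj => ?_
    rw [Finset.mem_Icc] at hj
    rw [show a - (j - 1) = a - j + 1 by omega]
  induction N with
  | zero =>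
    intro μ _ _
    simpa using tele t a le_rfl
  | succ N ih =>
    intro μ hμ hμa
    let b := μ (Fin.last N)
    have hb : b ≤ a := hμa _
    have hle : ∀ k : Fin N, b ≤ μ k.castSucc := fun k => hμ (Fin.le_last _)
    have hIH := ih (fun k => μ k.castSucc) (fun _ _ hxy => hμ (by simpa using hxy)) fun k => hμa _
    have hcard : ∀ j, (Finset.univ.filter fun k => j ≤ μ k).card =
        (Finset.univ.filter fun k : Fin N => j ≤ μ k.castSucc).card + if j ≤ b then 1 else 0 := by
      intro j
      rw [Finset.card_filter, Finset.card_filter, Fin.sum_univ_castSucc]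
    have hfull : ∀ j ≤ b, (Finset.univ.filter fun k : Fin N => j ≤ μ k.castSucc).card = N := by
      intro j hj
      rw [Finset.filter_true_of_mem fun k _ => hj.trans (hle k)]
      simp
    have split : ∀ f : ℕ → K, ∏ j ∈ Finset.Icc 1 a, f j =
        (∏ j ∈ Finset.Icc 1 b, f j) * ∏ j ∈ Finset.Ioc b a, f j := by
      intro f
      have : ∀ k, Finset.Icc 1 k = Finset.Ioc 0 k := fun k => by ext; simp; omega
      rw [this, this, Finset.prod_Ioc_consecutive f (Nat.zero_le _) hb]
    have low : ∀ (g : ℕ → ℕ → K), ∏ j ∈ Finset.Icc 1 b,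
        g j ((Finset.univ.filter fun k => j ≤ μ k).card + 1) =
        ∏ j ∈ Finset.Icc 1 b, g j (N + 2) := fun g => by
      refine Finset.prod_congr rfl fun j hj => ?_
      rw [Finset.mem_Icc] at hj
      rw [hcard, hfull j hj.2, if_pos hj.2]
    have low' : ∀ (g : ℕ → ℕ → K), ∏ j ∈ Finset.Icc 1 b,
        g j ((Finset.univ.filter fun k : Fin N => j ≤ μ k.castSucc).card + 1) =
        ∏ j ∈ Finset.Icc 1 b, g j (N + 1) := fun g => by
      refine Finset.prod_congr rfl fun j hj => ?_
      rw [Finset.mem_Icc] at hj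
      rw [hfull j hj.2]
    have high : ∀ (g : ℕ → ℕ → K), ∏ j ∈ Finset.Ioc b a,
        g j ((Finset.univ.filter fun k => j ≤ μ k).card + 1) =
        ∏ j ∈ Finset.Ioc b a,
        g j ((Finset.univ.filter fun k : Fin N => j ≤ μ k.castSucc).card + 1) := fun g => by
      refine Finset.prod_congr rfl fun j hj => ?_
      rw [Finset.mem_Ioc] at hj
      rw [hcard, if_neg (by omega), add_zero]
    rw [split, split, low fun j l => 1 - q ^ (a - j + 1) * t ^ l,
      low fun j l => 1 - q ^ (a - j) * t ^ l, high fun j l => 1 - q ^ (a - j + 1) * t ^ l,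
      high fun j l => 1 - q ^ (a - j) * t ^ l, Fin.prod_univ_castSucc, Fin.prod_univ_castSucc]
    rw [split, split, low' fun j l => 1 - q ^ (a - j + 1) * t ^ l,
      low' fun j l => 1 - q ^ (a - j) * t ^ l] at hIH
    simp only [Fin.val_castSucc, Fin.val_last]
    have t1 := tele (t ^ (N + 1)) b hb
    have t2 := tele (t ^ (N + 2)) b hb
    have n1 : ∏ j ∈ Finset.Icc 1 b, (1 - q ^ (a - j) * t ^ (N + 1)) ≠ 0 :=
      Finset.prod_ne_zero_iff.2 fun j _ => h.one_sub_ne (Or.inr (by omega))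
    have n2 : 1 - q ^ a * t ^ (N + 1) ≠ 0 := h.one_sub_ne (Or.inr (by omega))
    generalize ∏ j ∈ Finset.Icc 1 b, (1 - q ^ (a - j) * t ^ (N + 1)) = B at *
    generalize ∏ j ∈ Finset.Icc 1 b, (1 - q ^ (a - j + 1) * t ^ (N + 1)) = A at *
    generalize ∏ j ∈ Finset.Icc 1 b, (1 - q ^ (a - j) * t ^ (N + 2)) = B' at *
    generalize ∏ j ∈ Finset.Icc 1 b, (1 - q ^ (a - j + 1) * t ^ (N + 2)) = A' at *
    generalize ∏ k : Fin N, (1 - q ^ (a - μ k.castSucc) * t ^ ((k : ℕ) + 2)) = P at *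
    generalize ∏ k : Fin N, (1 - q ^ (a - μ k.castSucc) * t ^ ((k : ℕ) + 1)) = Q at *
    generalize ∏ j ∈ Finset.Ioc b a, (1 - q ^ (a - j + 1) *
      t ^ ((Finset.univ.filter fun k : Fin N => j ≤ μ k.castSucc).card + 1)) = X at *
    generalize ∏ j ∈ Finset.Ioc b a, (1 - q ^ (a - j) *
      t ^ ((Finset.univ.filter fun k : Fin N => j ≤ μ k.castSucc).card + 1)) = Y at *
    change A' * X * ((1 - t) * (P * (1 - q ^ (a - b) * t ^ (N + 2)))) =
      B' * Y * ((1 - q ^ a * t ^ (N + 2)) * (Q * (1 - q ^ (a - b) * t ^ (N + 1))))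
    have h3 : X * ((1 - t) * P) = Y * (Q * (1 - q ^ (a - b) * t ^ (N + 1))) := by
      refine mul_left_cancel₀ n1 (mul_left_cancel₀ n2 ?_)
      linear_combination (1 - q ^ (a - b) * t ^ (N + 1)) * hIH - X * (1 - t) * P * t1
    linear_combination X * (1 - t) * P * t2 + B' * (1 - q ^ a * t ^ (N + 2)) * h3

theorem leg_succ_of_antitone {κ : Fin (n + 1) → ℕ} (hκ : Antitone κ) (i : Fin n) (j : ℕ) :
    leg κ i.succ j = leg (fun k : Fin n => κ k.succ) i j := by
  rw [leg_eq_sum, leg_eq_sum, Fin.sum_univ_succ]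
  have := hκ (Fin.zero_le i.succ)
  have h1 : ¬ (κ 0 + 1 ≤ κ i.succ) := by omega
  simp [h1]

theorem leg_zero_of_antitone {κ : Fin (n + 1) → ℕ} (hκ : Antitone κ) (j : ℕ) :
    leg κ 0 j = (Finset.univ.filter fun k : Fin n => j ≤ κ k.succ).card := by
  rw [leg_eq_sum, Fin.sum_univ_succ, Finset.card_filter]
  simp [hκ (Fin.zero_le _)]

theorem dConst_mul_prod (h : Admissible q t) : ∀ {n : ℕ} {κ : Fin n → ℕ}, Antitone κ →
    dConst q t κ * ∏ i, ((1 - t) *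
      ∏ j ∈ Finset.Ioi i, (1 - q ^ (κ i - κ j) * t ^ ((j : ℕ) - i + 1))) =
    hConst q t κ * ∏ i : Fin n, ((1 - q ^ κ i * t ^ (n - (i : ℕ))) *
      ∏ j ∈ Finset.Ioi i, (1 - q ^ (κ i - κ j) * t ^ ((j : ℕ) - i))) := by
  intro n
  induction n with
  | zero => intro κ _; simp [dConst, hConst]
  | succ n ih =>
    intro κ hκ
    have hκ' : Antitone fun k : Fin n => κ k.succ := fun a b hab => hκ (by simpa using hab)
    have h1 := ih hκ'
    have h2 := prod_row_telescope h (κ 0) (fun k : Fin n => κ k.succ) hκ' fun k =>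
      hκ (Fin.zero_le _)
    have hd : dConst q t κ = (∏ j ∈ Finset.Icc 1 (κ 0), (1 - q ^ (κ 0 - j + 1) *
        t ^ ((Finset.univ.filter fun k : Fin n => j ≤ κ k.succ).card + 1))) *
        dConst q t fun k : Fin n => κ k.succ := by
      unfold dConst arm
      rw [Fin.prod_univ_succ]
      simp only [leg_succ_of_antitone hκ, leg_zero_of_antitone hκ]
    have hh : hConst q t κ = (∏ j ∈ Finset.Icc 1 (κ 0), (1 - q ^ (κ 0 - j) *
        t ^ ((Finset.univ.filter fun k : Fin n => j ≤ κ k.succ).card + 1))) *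
        hConst q t fun k : Fin n => κ k.succ := by
      unfold hConst arm
      rw [Fin.prod_univ_succ]
      simp only [leg_succ_of_antitone hκ, leg_zero_of_antitone hκ]
    rw [hd, hh, Fin.prod_univ_succ, Fin.prod_univ_succ, Fin.prod_Ioi_zero, Fin.prod_Ioi_zero]
    simp only [Fin.prod_Ioi_succ, Fin.val_zero, Fin.val_succ, Nat.sub_zero,
      Nat.add_sub_add_right, add_assoc, Nat.reduceAdd]
    rw [mul_mul_mul_comm, h1, h2]
    ring

theorem symFactor_spec (h : Admissible q t) {κ : Fin n → ℕ} (hκ : Antitone κ) :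
    symFactor t (spec q t κ) = ∏ i, ∏ j ∈ Finset.Ioi i,
      (1 - q ^ (κ i - κ j) * t ^ ((j : ℕ) - i + 1)) /
        (1 - q ^ (κ i - κ j) * t ^ ((j : ℕ) - i)) := by
  refine Finset.prod_congr rfl fun i _ => Finset.prod_congr rfl fun j hj => ?_
  have hij : i < j := Finset.mem_Ioi.1 hj
  have hp : Prec κ i j := by
    rw [prec_iff_coleg_lt, coleg_antitone hκ, coleg_antitone hκ]
    exact hij
  rw [spec_of_prec hp, coleg_antitone hκ, coleg_antitone hκ, pow_succ]
  have h0 := spec_ne_zero h κ j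
  rw [show spec q t κ j - t * (q ^ (κ i - κ j) * t ^ ((j : ℕ) - i) * spec q t κ j) =
    spec q t κ j * (1 - q ^ (κ i - κ j) * (t ^ ((j : ℕ) - i) * t)) by ring,
    show spec q t κ j - q ^ (κ i - κ j) * t ^ ((j : ℕ) - i) * spec q t κ j =
    spec q t κ j * (1 - q ^ (κ i - κ j) * t ^ ((j : ℕ) - i)) by ring, mul_div_mul_left _ _ h0]

theorem hConst_ne_zero (h : Admissible q t) (η : Fin n → ℕ) : hConst q t η ≠ 0 :=
  Finset.prod_ne_zero_iff.2 fun _ _ => Finset.prod_ne_zero_iff.2 fun _ _ =>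
    h.one_sub_ne (Or.inr (by omega))

theorem dConst_ne_zero (h : Admissible q t) (η : Fin n → ℕ) : dConst q t η ≠ 0 :=
  Finset.prod_ne_zero_iff.2 fun _ _ => Finset.prod_ne_zero_iff.2 fun _ _ =>
    h.one_sub_ne (Or.inr (by omega))

theorem eConst_ne_zero (h : Admissible q t) (η : Fin n → ℕ) : eConst q t η ≠ 0 :=
  Finset.prod_ne_zero_iff.2 fun _ _ => Finset.prod_ne_zero_iff.2 fun _ _ =>
    h.one_sub_ne (Or.inl (by omega))

theorem eConst'_ne_zero (h : Admissible q t) (η : Fin n → ℕ) : eConst' q t η ≠ 0 :=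
  Finset.prod_ne_zero_iff.2 fun _ _ => Finset.prod_ne_zero_iff.2 fun _ _ =>
    h.one_sub_ne (Or.inl (by omega))

theorem symFactor_spec_ne_zero (h : Admissible q t) {κ : Fin n → ℕ} (hκ : Antitone κ) :
    symFactor t (spec q t κ) ≠ 0 := by
  rw [symFactor_spec h hκ]
  refine Finset.prod_ne_zero_iff.2 fun i _ => Finset.prod_ne_zero_iff.2 fun j hj => ?_
  have hij : i < j := Finset.mem_Ioi.1 hj
  exact div_ne_zero (h.one_sub_ne (Or.inr (by omega))) (h.one_sub_ne (Or.inr (by omega)))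

theorem bracketFactorial_div_symFactor (h : Admissible q t) {κ : Fin n → ℕ} (hκ : Antitone κ) :
    bracketFactorial t n * (eConst q t κ / dConst q t κ) / symFactor t (spec q t κ) =
      bConst q t κ / hConst q t κ := by
  have h1 := dConst_mul_prod h hκ
  have h2 := bConst_mul_of_antitone (q := q) (t := t) hκ
  have hs := symFactor_spec_ne_zero h hκ
  have hd := dConst_ne_zero h κ
  have hh := hConst_ne_zero h κ
  have n1 : (1 : K) - t ≠ 0 := sub_ne_zero.2 h.t_ne_one.symm
  have n3 : ∏ i, ∏ j ∈ Finset.Ioi i, (1 - q ^ (κ i - κ j) * t ^ ((j : ℕ) - i)) ≠ 0 :=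
    Finset.prod_ne_zero_iff.2 fun i _ => Finset.prod_ne_zero_iff.2 fun j hj =>
      h.one_sub_ne (Or.inr (by have : i < j := Finset.mem_Ioi.1 hj; omega))
  have hs2 := symFactor_spec h hκ
  simp only [Finset.prod_div_distrib] at hs2
  rw [eq_div_iff n3] at hs2
  simp only [Finset.prod_mul_distrib, Finset.prod_const, Finset.card_univ,
    Fintype.card_fin] at h1
  rw [bracketFactorial_eq_prod, Finset.prod_div_distrib, Finset.prod_const, Finset.card_univ,
    Fintype.card_fin, ← hs2] at *
  rw [div_eq_div_iff hs hh]
  field_simp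
  refine mul_right_cancel₀ n3 ?_
  linear_combination (-(bConst q t κ)) * h1 - hConst q t κ * (∏ i, ∏ j ∈ Finset.Ioi i,
    (1 - q ^ (κ i - κ j) * t ^ ((j : ℕ) - i))) * h2

end Spectrum

end

section

open MvPolynomial

section Operators

variable {m : ℕ} {K : Type*} [Field K]

theorem rename_adj_adj (i : Fin m) (f : MvPolynomial (Fin (m + 1)) K) :
    rename (adj i) (rename (adj i) f) = f := by
  rw [rename_rename]
  have : (adj i : Fin (m + 1) → Fin (m + 1)) ∘ adj i = id := by
    funext x
    simp [adj]
  rw [this, rename_id_apply]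

theorem X_sub_X_ne_zero {n : ℕ} {a b : Fin n} (h : a ≠ b) :
    (X a - X b : MvPolynomial (Fin n) K) ≠ 0 :=
  sub_ne_zero.2 fun h' => h (X_injective h')

theorem castSucc_ne_succ (i : Fin m) : i.castSucc ≠ i.succ := (Fin.castSucc_lt_succ).ne

theorem exists_divDiff (i : Fin m) (f : MvPolynomial (Fin (m + 1)) K) :
    ∃ g, (X i.castSucc - X i.succ) * g = rename (adj i) f - f := by
  induction f using MvPolynomial.induction_on with
  | C a => exact ⟨0, by simp⟩
  | add p p' hp hp' =>
    obtain ⟨g, hg⟩ := hp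
    obtain ⟨g', hg'⟩ := hp'
    exact ⟨g + g', by rw [mul_add, hg, hg', map_add]; ring⟩
  | mul_X p k hp =>
    obtain ⟨g, hg⟩ := hp
    have : ∃ c : MvPolynomial (Fin (m + 1)) K,
        (X i.castSucc - X i.succ) * c = X (adj i k) - X k := by
      rcases eq_or_ne k i.castSucc with rfl | h1
      · exact ⟨-1, by simp [adj]⟩
      rcases eq_or_ne k i.succ with rfl | h2
      · exact ⟨1, by simp [adj]⟩
      · exact ⟨0, by simp [adj, Equiv.swap_apply_of_ne_of_ne h1 h2]⟩
    obtain ⟨c, hc⟩ := this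
    refine ⟨g * X (adj i k) + p * c, ?_⟩
    rw [map_mul, rename_X]
    linear_combination X (adj i k) * hg + p * hc

/-- The Demazure–Lusztig operator
`T_i = t + (t x_i - x_{i+1}) / (x_i - x_{i+1}) (s_i - 1)` on polynomials. -/
def heckeFun (t : K) (i : Fin m) (f : MvPolynomial (Fin (m + 1)) K) :
    MvPolynomial (Fin (m + 1)) K :=
  C t * f + (C t * X i.castSucc - X i.succ) * (exists_divDiff i f).choose

theorem heckeFun_spec (t : K) (i : Fin m) (f : MvPolynomial (Fin (m + 1)) K) :
    (X i.castSucc - X i.succ) * heckeFun t i f =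
      (1 - C t) * X i.succ * f + (C t * X i.castSucc - X i.succ) * rename (adj i) f := by
  unfold heckeFun
  linear_combination (C t * X i.castSucc - X i.succ) * (exists_divDiff i f).choose_spec

theorem heckeFun_unique {t : K} {i : Fin m} {f g : MvPolynomial (Fin (m + 1)) K}
    (h : (X i.castSucc - X i.succ) * g =
      (1 - C t) * X i.succ * f + (C t * X i.castSucc - X i.succ) * rename (adj i) f) :
    heckeFun t i f = g :=
  mul_left_cancel₀ (X_sub_X_ne_zero (castSucc_ne_succ i)) ((heckeFun_spec t i f).trans h.symm)

/-- The Demazure–Lusztig operator as a linear map. -/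
def hecke (t : K) (i : Fin m) : Module.End K (MvPolynomial (Fin (m + 1)) K) where
  toFun := heckeFun t i
  map_add' f g := heckeFun_unique (by
    rw [mul_add, heckeFun_spec, heckeFun_spec, map_add]; ring)
  map_smul' c f := heckeFun_unique (by
    simp only [RingHom.id_apply, smul_eq_C_mul, map_mul, rename_C]
    linear_combination C c * heckeFun_spec t i f)

theorem hecke_spec (t : K) (i : Fin m) (f : MvPolynomial (Fin (m + 1)) K) :
    (X i.castSucc - X i.succ) * hecke t i f =
      (1 - C t) * X i.succ * f + (C t * X i.castSucc - X i.succ) * rename (adj i) f :=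
  heckeFun_spec t i f

theorem hecke_unique {t : K} {i : Fin m} {f g : MvPolynomial (Fin (m + 1)) K}
    (h : (X i.castSucc - X i.succ) * g =
      (1 - C t) * X i.succ * f + (C t * X i.castSucc - X i.succ) * rename (adj i) f) :
    hecke t i f = g :=
  heckeFun_unique h

theorem rename_hecke (t : K) (i : Fin m) (f : MvPolynomial (Fin (m + 1)) K) :
    (X i.succ - X i.castSucc) * rename (adj i) (hecke t i f) =
      (1 - C t) * X i.castSucc * rename (adj i) f + (C t * X i.succ - X i.castSucc) * f := by
  have h := congrArg (rename (adj i)) (hecke_spec t i f)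
  simpa only [map_mul, map_sub, map_add, map_one, rename_X, rename_C, rename_adj_adj,
    Equiv.swap_apply_left, Equiv.swap_apply_right, adj] using h

theorem hecke_sq (t : K) (i : Fin m) : hecke t i * hecke t i = (t - 1) • hecke t i + t • 1 := by
  refine LinearMap.ext fun f => ?_
  rw [Module.End.mul_apply, LinearMap.add_apply, LinearMap.smul_apply, LinearMap.smul_apply,
    Module.End.one_apply]
  refine hecke_unique ?_
  simp only [smul_eq_C_mul, map_sub, map_one]
  refine mul_left_cancel₀ (X_sub_X_ne_zero (castSucc_ne_succ i)) ?_
  linear_combination ((C t - 1) * (X i.castSucc - X i.succ) - (1 - C t) * X i.succ) *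
    hecke_spec t i f + (C t * X i.castSucc - X i.succ) * rename_hecke t i f

theorem hecke_mul_X (t : K) (i : Fin m) (f : MvPolynomial (Fin (m + 1)) K) :
    hecke t i (X i.castSucc * f) = X i.succ * (hecke t i f - (t - 1) • f) := by
  refine hecke_unique ?_
  simp only [map_mul, rename_X, adj, Equiv.swap_apply_left, smul_eq_C_mul, map_sub, map_one]
  linear_combination X i.succ * hecke_spec t i f

theorem hecke_mul_X_of_ne (t : K) (i : Fin m) {k : Fin (m + 1)} (h1 : k ≠ i.castSucc)
    (h2 : k ≠ i.succ) (f : MvPolynomial (Fin (m + 1)) K) :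
    hecke t i (X k * f) = X k * hecke t i f := by
  refine hecke_unique ?_
  rw [map_mul, rename_X, adj, Equiv.swap_apply_of_ne_of_ne h1 h2]
  linear_combination X k * hecke_spec t i f

theorem hecke_of_symm (t : K) (i : Fin m) {f : MvPolynomial (Fin (m + 1)) K}
    (h : rename (adj i) f = f) : hecke t i f = t • f := by
  refine hecke_unique ?_
  rw [h, smul_eq_C_mul]
  ring

theorem symm_of_hecke {t : K} {i : Fin m} {f : MvPolynomial (Fin (m + 1)) K}
    (h : hecke t i f = t • f) : rename (adj i) f = f := by
  have h1 := hecke_spec t i f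
  rw [h, smul_eq_C_mul] at h1
  have h2 : (C t * X i.castSucc - X i.succ : MvPolynomial (Fin (m + 1)) K) ≠ 0 := by
    intro h0
    have := congrArg (eval fun k => if k = i.succ then (1 : K) else 0) h0
    simp [castSucc_ne_succ] at this
  refine mul_left_cancel₀ h2 ?_
  linear_combination -h1

/-! The braid relations are checked in the field of rational functions. -/

/-- The field of rational functions in `n` variables. -/
abbrev RatFun (n : ℕ) (K : Type*) [Field K] := FractionRing (MvPolynomial (Fin n) K)

/-- Permutation of the variables of rational functions. -/
def permRat {n : ℕ} (σ : Equiv.Perm (Fin n)) : RatFun n K →+* RatFun n K :=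
  IsFractionRing.map (A := MvPolynomial (Fin n) K) (B := MvPolynomial (Fin n) K)
    (j := (rename (R := K) σ).toRingHom)
    (rename_injective σ σ.injective)

theorem permRat_algebraMap {n : ℕ} (σ : Equiv.Perm (Fin n)) (f : MvPolynomial (Fin n) K) :
    permRat σ (algebraMap _ (RatFun n K) f) = algebraMap _ _ (rename σ f) := by
  unfold permRat IsFractionRing.map
  exact IsLocalization.map_eq _ f

@[simp] theorem permRat_ratX {n : ℕ} (σ : Equiv.Perm (Fin n)) (i : Fin n) :
    permRat σ (ratX K i) = ratX K (σ i) := by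
  rw [ratX, permRat_algebraMap, rename_X, ratX]

theorem algebraMap_C {n : ℕ} (c : K) :
    algebraMap (MvPolynomial (Fin n) K) (RatFun n K) (C c) = algebraMap K _ c := by
  rw [← algebraMap_eq, ← IsScalarTower.algebraMap_apply]

@[simp] theorem permRat_C {n : ℕ} (σ : Equiv.Perm (Fin n)) (c : K) :
    permRat σ (algebraMap K (RatFun n K) c) = algebraMap K _ c := by
  rw [← algebraMap_C, permRat_algebraMap, rename_C]

theorem permRat_mul {n : ℕ} (σ τ : Equiv.Perm (Fin n)) (x : RatFun n K) :
    permRat σ (permRat τ x) = permRat (σ * τ) x := by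
  have : (permRat σ).comp (permRat τ) = permRat (K := K) (σ * τ) := by
    refine IsLocalization.ringHom_ext (nonZeroDivisors (MvPolynomial (Fin n) K)) ?_
    refine RingHom.ext fun f => ?_
    simp only [RingHom.comp_apply, permRat_algebraMap, rename_rename]
    rfl
  exact RingHom.congr_fun this x

theorem ratX_sub_ne_zero {n : ℕ} {a b : Fin n} (h : a ≠ b) : ratX K a - ratX K b ≠ 0 := by
  rw [ratX, ratX, ← map_sub]
  exact (map_ne_zero_iff _ (IsFractionRing.injective _ _)).2 (X_sub_X_ne_zero h)

theorem algebraMap_hecke (t : K) (i : Fin m) (f : MvPolynomial (Fin (m + 1)) K) :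
    algebraMap _ (RatFun (m + 1) K) (hecke t i f) =
      ((1 - algebraMap K _ t) * ratX K i.succ * algebraMap _ _ f +
        (algebraMap K _ t * ratX K i.castSucc - ratX K i.succ) * permRat (adj i) (algebraMap _ _ f))
        / (ratX K i.castSucc - ratX K i.succ) := by
  rw [eq_div_iff (ratX_sub_ne_zero (castSucc_ne_succ i)), permRat_algebraMap, mul_comm]
  have := congrArg (algebraMap _ (RatFun (m + 1) K)) (hecke_spec t i f)
  simpa only [map_mul, map_sub, map_add, map_one, algebraMap_C, ratX] using this

theorem hecke_braid (t : K) {i j : Fin m} (hij : (j : ℕ) = i + 1) :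
    hecke t i * hecke t j * hecke t i = hecke t j * hecke t i * hecke t j := by
  refine LinearMap.ext fun f => IsFractionRing.injective _ (RatFun (m + 1) K) ?_
  have hy : j.castSucc = i.succ := Fin.ext (by simp [hij])
  have hxz : i.castSucc ≠ j.succ := fun h => by
    have := congrArg Fin.val h
    simp [hij] at this
    omega
  have hxy := castSucc_ne_succ i
  have hyz : i.succ ≠ j.succ := hy ▸ castSucc_ne_succ j
  have h1 := ratX_sub_ne_zero (K := K) hxy
  have h2 := ratX_sub_ne_zero (K := K) hyz
  have h3 := ratX_sub_ne_zero (K := K) hxz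
  have h4 := ratX_sub_ne_zero (K := K) hxy.symm
  have h5 := ratX_sub_ne_zero (K := K) hyz.symm
  have h6 := ratX_sub_ne_zero (K := K) hxz.symm
  have e1 : adj i i.castSucc = i.succ := Equiv.swap_apply_left _ _
  have e2 : adj i i.succ = i.castSucc := Equiv.swap_apply_right _ _
  have e3 : adj i j.succ = j.succ := Equiv.swap_apply_of_ne_of_ne hxz.symm hyz.symm
  have e4 : adj j i.castSucc = i.castSucc := by
    unfold adj
    rw [hy, Equiv.swap_apply_of_ne_of_ne hxy hxz]
  have e5 : adj j i.succ = j.succ := by unfold adj; rw [hy, Equiv.swap_apply_left]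
  have e6 : adj j j.succ = i.succ := by unfold adj; rw [hy, Equiv.swap_apply_right]
  have p1 : adj i * adj i = 1 := Equiv.swap_mul_self _ _
  have p2 : adj j * adj j = 1 := Equiv.swap_mul_self _ _
  have p3 : adj i * adj j * adj i = adj j * adj i * adj j := by
    refine Equiv.ext fun x => ?_
    simp only [Equiv.Perm.mul_apply]
    rcases eq_or_ne x i.castSucc with rfl | a1
    · rw [e1, e5, e3, e4, e1, e5]
    rcases eq_or_ne x i.succ with rfl | a2
    · rw [e2, e4, e1, e5, e3, e6]
    rcases eq_or_ne x j.succ with rfl | a3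
    · rw [e3, e6, e2, e4]
    have b1 : adj i x = x := Equiv.swap_apply_of_ne_of_ne a1 a2
    have b2 : adj j x = x := Equiv.swap_apply_of_ne_of_ne (hy ▸ a2) a3
    rw [b1, b2, b1, b2]
  have p4 : ∀ g : RatFun (m + 1) K, permRat 1 g = g := fun g => by
    rw [show (1 : Equiv.Perm (Fin (m + 1))) = adj i * adj i from p1.symm, ← permRat_mul]
    obtain ⟨a, b, _, rfl⟩ := IsFractionRing.div_surjective (A := MvPolynomial (Fin (m + 1)) K) g
    simp only [map_div₀, permRat_algebraMap, rename_adj_adj]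
  have q1 : ∀ g : RatFun (m + 1) K, permRat (adj i) (permRat (adj i) g) = g := fun g => by
    rw [permRat_mul, p1, p4]
  have q2 : ∀ g : RatFun (m + 1) K, permRat (adj j) (permRat (adj j) g) = g := fun g => by
    rw [permRat_mul, p2, p4]
  have q3 : ∀ g : RatFun (m + 1) K, permRat (adj i) (permRat (adj j) (permRat (adj i) g)) =
      permRat (adj j) (permRat (adj i) (permRat (adj j) g)) := fun g => by
    rw [permRat_mul, permRat_mul, permRat_mul, permRat_mul, p3]
  simp only [Module.End.mul_apply, algebraMap_hecke, map_div₀, map_add, map_mul, map_sub, map_one,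
    permRat_ratX, permRat_C, hy, e1, e2, e3, e4, e5, e6, q1, q2, q3]
  generalize algebraMap _ (RatFun (m + 1) K) f = F
  generalize permRat (adj j) (permRat (adj i) (permRat (adj j) F)) = F1
  generalize permRat (adj i) (permRat (adj j) F) = F2
  generalize permRat (adj j) (permRat (adj i) F) = F3
  generalize permRat (adj i) F = F4
  generalize permRat (adj j) F = F5
  generalize ratX K i.castSucc = x at *
  generalize ratX K i.succ = y at *
  generalize ratX K j.succ = z at *
  generalize algebraMap K (RatFun (m + 1) K) t = s
  have n1 : y - x = -(x - y) := by ring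
  have n2 : z - y = -(y - z) := by ring
  have n3 : z - x = -(x - z) := by ring
  rw [n1, n2]
  field_simp
  ring

theorem hecke_comm (t : K) {i j : Fin m} (hij : (i : ℕ) + 2 ≤ j) :
    hecke t i * hecke t j = hecke t j * hecke t i := by
  refine LinearMap.ext fun f => IsFractionRing.injective _ (RatFun (m + 1) K) ?_
  have a1 : i.castSucc ≠ j.castSucc := by simp [Fin.ext_iff]; omega
  have a2 : i.castSucc ≠ j.succ := by simp [Fin.ext_iff]; omega
  have a3 : i.succ ≠ j.castSucc := by simp [Fin.ext_iff]; omega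
  have a4 : i.succ ≠ j.succ := by simp [Fin.ext_iff]; omega
  have e1 : adj i j.castSucc = j.castSucc := Equiv.swap_apply_of_ne_of_ne a1.symm a3.symm
  have e2 : adj i j.succ = j.succ := Equiv.swap_apply_of_ne_of_ne a2.symm a4.symm
  have e3 : adj j i.castSucc = i.castSucc := Equiv.swap_apply_of_ne_of_ne a1 a2
  have e4 : adj j i.succ = i.succ := Equiv.swap_apply_of_ne_of_ne a3 a4
  have p : adj i * adj j = adj j * adj i :=
    (Equiv.Perm.disjoint_swap_swap (by simp [a1, a2, a3, a4, castSucc_ne_succ])).commute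
  have q : ∀ g : RatFun (m + 1) K, permRat (adj i) (permRat (adj j) g) =
      permRat (adj j) (permRat (adj i) g) := fun g => by
    rw [permRat_mul, permRat_mul, p]
  have h1 := ratX_sub_ne_zero (K := K) (castSucc_ne_succ i)
  have h2 := ratX_sub_ne_zero (K := K) (castSucc_ne_succ j)
  simp only [Module.End.mul_apply, algebraMap_hecke, map_div₀, map_add, map_mul, map_sub, map_one,
    permRat_ratX, permRat_C, e1, e2, e3, e4, q]
  field_simp
  ring

end Operators

end

section

open MvPolynomial

section Rotation

variable {m : ℕ} {K : Type*} [Field K]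

/-- The substitution `x_1 ↦ q x_n`, `x_{i+1} ↦ x_i`. -/
def rot (q : K) : MvPolynomial (Fin (m + 1)) K →ₐ[K] MvPolynomial (Fin (m + 1)) K :=
  aeval (Fin.cases (C q * X (Fin.last m)) fun k => X k.castSucc)

@[simp] theorem rot_X_zero (q : K) : rot q (X (0 : Fin (m + 1))) = C q * X (Fin.last m) := by
  simp [rot]

@[simp] theorem rot_X_succ (q : K) (k : Fin m) : rot q (X k.succ) = X k.castSucc := by
  simp [rot]

@[simp] theorem rot_C (q c : K) : rot q (C c : MvPolynomial (Fin (m + 1)) K) = C c := by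
  rw [← algebraMap_eq, AlgHom.commutes]

theorem rename_rot (q : K) {i j : Fin m} (hij : (j : ℕ) = i + 1)
    (f : MvPolynomial (Fin (m + 1)) K) :
    rename (adj i) (rot q f) = rot q (rename (adj j) f) := by
  suffices h : (rename (adj i)).comp (rot q) = (rot q).comp (rename (R := K) (adj j)) from
    AlgHom.congr_fun h f
  ext1 k
  simp only [AlgHom.comp_apply, rename_X]
  refine Fin.cases ?_ (fun l => ?_) k
  · have h1 : adj j 0 = 0 := Equiv.swap_apply_of_ne_of_ne
      (by simp [Fin.ext_iff]; omega) (by simp [Fin.ext_iff])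
    have h2 : adj i (Fin.last m) = Fin.last m := Equiv.swap_apply_of_ne_of_ne
      (by simp [Fin.ext_iff]; omega) (by simp [Fin.ext_iff]; omega)
    rw [h1, rot_X_zero, map_mul, rename_C, rename_X, h2]
  · have h1 : adj j l.succ = (⟨adj i l.castSucc, by
        unfold adj
        rw [Equiv.swap_apply_def]
        split_ifs <;> simp only [Fin.val_succ, Fin.val_castSucc] <;> omega⟩ : Fin m).succ := by
      unfold adj
      ext
      simp only [Equiv.swap_apply_def, Fin.val_succ, Fin.ext_iff, Fin.val_castSucc]
      split_ifs <;> simp only [Fin.val_succ, Fin.val_castSucc] <;> omega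
    rw [h1, rot_X_succ, rot_X_succ, rename_X]
    congr 1

theorem hecke_rot (q t : K) {i j : Fin m} (hij : (j : ℕ) = i + 1)
    (f : MvPolynomial (Fin (m + 1)) K) : hecke t i (rot q f) = rot q (hecke t j f) := by
  refine hecke_unique ?_
  have h1 : j.castSucc = i.succ := Fin.ext (by simp [hij])
  have h2 : rot q (X j.castSucc) = (X i.castSucc : MvPolynomial (Fin (m + 1)) K) := by
    rw [h1, rot_X_succ]
  have h := congrArg (rot q) (hecke_spec t j f)
  simp only [map_mul, map_sub, map_add, map_one, h2, rot_X_succ, rot_C] at h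
  rw [rename_rot q hij, ← h1]
  exact h

theorem rename_rot_rot (q : K) (f : MvPolynomial (Fin (m + 2)) K) :
    rename (adj (Fin.last m)) (rot q (rot q f)) = rot q (rot q (rename (adj 0) f)) := by
  suffices h : (rename (adj (Fin.last m))).comp ((rot q).comp (rot q)) =
      ((rot q).comp (rot q)).comp (rename (R := K) (adj 0)) from AlgHom.congr_fun h f
  have e0 : (0 : Fin (m + 1)).castSucc = 0 := rfl
  have e1 : (Fin.last m).succ = Fin.last (m + 1) := rfl
  have e2 : rot q (X (Fin.last (m + 1)) : MvPolynomial (Fin (m + 2)) K) =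
      X (Fin.last m).castSucc := by rw [← e1, rot_X_succ]
  have a1 : adj (0 : Fin (m + 1)) 0 = (0 : Fin (m + 1)).succ := Equiv.swap_apply_left _ _
  have a2 : adj (0 : Fin (m + 1)) (0 : Fin (m + 1)).succ = 0 := Equiv.swap_apply_right _ _
  have a3 : adj (Fin.last m) (Fin.last m).castSucc = Fin.last (m + 1) := Equiv.swap_apply_left _ _
  have a4 : adj (Fin.last m) (Fin.last (m + 1)) = (Fin.last m).castSucc :=
    Equiv.swap_apply_right _ _
  ext1 k
  simp only [AlgHom.comp_apply, rename_X]
  refine Fin.cases ?_ (fun l => ?_) k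
  · simp only [a1, rot_X_zero, rot_X_succ, e0, map_mul, rot_C, e2, rename_C, rename_X, a3]
  · refine Fin.cases ?_ (fun l => ?_) l
    · simp only [a2, rot_X_zero, rot_X_succ, e0, map_mul, rot_C, e2, rename_C, rename_X, a4]
    · have h1 : adj (0 : Fin (m + 1)) l.succ.succ = l.succ.succ :=
        Equiv.swap_apply_of_ne_of_ne (by simp [Fin.ext_iff]) (by simp [Fin.ext_iff])
      have h2 : adj (Fin.last m) l.castSucc.castSucc = l.castSucc.castSucc :=
        Equiv.swap_apply_of_ne_of_ne (by simp [Fin.ext_iff]; omega) (by simp [Fin.ext_iff]; omega)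
      rw [h1, rot_X_succ, ← Fin.succ_castSucc, rot_X_succ, rename_X, h2]

theorem hecke_rot_rot {q : K} (hq : q ≠ 0) (t : K) (f : MvPolynomial (Fin (m + 2)) K) :
    hecke t (Fin.last m) (rot q (rot q f)) = rot q (rot q (hecke t 0 f)) := by
  refine hecke_unique ?_
  have e0 : (0 : Fin (m + 1)).castSucc = 0 := rfl
  have e1 : (Fin.last m).succ = Fin.last (m + 1) := rfl
  have e2 : rot q (X (Fin.last (m + 1)) : MvPolynomial (Fin (m + 2)) K) =
      X (Fin.last m).castSucc := by rw [← e1, rot_X_succ]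
  have h := congrArg (fun g => rot q (rot q g)) (hecke_spec t 0 f)
  simp only [map_mul, map_sub, map_add, map_one, rot_X_succ, rot_C, e0, rot_X_zero, e2] at h
  rw [rename_rot_rot, e1]
  refine mul_left_cancel₀ (C_ne_zero.2 hq) ?_
  linear_combination h

end Rotation

/-! ### The Cherednik operators -/

section Cherednik

variable {m : ℕ} {K : Type*} [Field K] (q t : K)

/-- `T_k` with a natural number as index. -/
def heckeN (m : ℕ) (t : K) (k : ℕ) : Module.End K (MvPolynomial (Fin (m + 1)) K) :=
  if h : k < m then hecke t ⟨k, h⟩ else 1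

/-- The inverse of `T_k`. -/
def heckeInv (m : ℕ) (t : K) (k : ℕ) : Module.End K (MvPolynomial (Fin (m + 1)) K) :=
  t⁻¹ • (heckeN m t k - (t - 1) • 1)

theorem heckeN_of_lt {k : ℕ} (h : k < m) : heckeN m t k = hecke t ⟨k, h⟩ := dif_pos h

theorem heckeN_fin (i : Fin m) : heckeN m t i = hecke t i := dif_pos i.2

theorem heckeN_sq {k : ℕ} (h : k < m) :
    heckeN m t k * heckeN m t k = (t - 1) • heckeN m t k + t • 1 := by
  rw [heckeN_of_lt t h, hecke_sq]

theorem heckeN_braid {k : ℕ} (h : k + 1 < m) :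
    heckeN m t k * heckeN m t (k + 1) * heckeN m t k =
      heckeN m t (k + 1) * heckeN m t k * heckeN m t (k + 1) := by
  rw [heckeN_of_lt t h, heckeN_of_lt t (by omega : k < m)]
  exact hecke_braid t rfl

theorem heckeN_comm {j k : ℕ} (h : j + 2 ≤ k) :
    heckeN m t j * heckeN m t k = heckeN m t k * heckeN m t j := by
  unfold heckeN
  split_ifs with h1 h2
  · exact hecke_comm t h
  all_goals simp

variable {t}

theorem heckeN_mul_inv (ht : t ≠ 0) {k : ℕ} (h : k < m) :
    heckeN m t k * heckeInv m t k = 1 := by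
  rw [heckeInv, mul_smul_comm, mul_sub, heckeN_sq t h, mul_smul_comm, mul_one, add_sub_cancel_left,
    smul_smul, inv_mul_cancel₀ ht, one_smul]

theorem heckeInv_mul (ht : t ≠ 0) {k : ℕ} (h : k < m) :
    heckeInv m t k * heckeN m t k = 1 := by
  rw [heckeInv, smul_mul_assoc, sub_mul, heckeN_sq t h, smul_mul_assoc, one_mul,
    add_sub_cancel_left, smul_smul, inv_mul_cancel₀ ht, one_smul]

theorem commute_heckeInv {k : ℕ} {A : Module.End K (MvPolynomial (Fin (m + 1)) K)}
    (h : A * heckeN m t k = heckeN m t k * A) : A * heckeInv m t k = heckeInv m t k * A := by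
  rw [heckeInv, mul_smul_comm, smul_mul_assoc, mul_sub, sub_mul, h, mul_smul_comm, smul_mul_assoc,
    mul_one, one_mul]

variable (t)

/-- `T_{m-j} ⋯ T_{m-1}`, the product of the last `j` operators. -/
def tailAux (m : ℕ) (t : K) : ℕ → Module.End K (MvPolynomial (Fin (m + 1)) K)
  | 0 => 1
  | j + 1 => heckeN m t (m - 1 - j) * tailAux m t j

/-- `T_k ⋯ T_{m-1}`. -/
def tail (m : ℕ) (t : K) (k : ℕ) : Module.End K (MvPolynomial (Fin (m + 1)) K) :=
  tailAux m t (m - k)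

@[simp] theorem tail_self : tail m t m = 1 := by
  simp [tail, tailAux]

theorem tail_of_lt {k : ℕ} (h : k < m) : tail m t k = heckeN m t k * tail m t (k + 1) := by
  unfold tail
  obtain ⟨j, hj⟩ : ∃ j, m - k = j + 1 := ⟨m - k - 1, by omega⟩
  rw [hj, tailAux, show m - 1 - j = k by omega, show m - (k + 1) = j by omega]

/-- `T_0⁻¹ ⋯ T_{k-1}⁻¹`. -/
def headInv (m : ℕ) (t : K) : ℕ → Module.End K (MvPolynomial (Fin (m + 1)) K)
  | 0 => 1
  | k + 1 => headInv m t k * heckeInv m t k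

/-- The operator `f(x_1, …, x_n) ↦ f(q x_n, x_1, …, x_{n-1})`. -/
def omg (m : ℕ) (q : K) : Module.End K (MvPolynomial (Fin (m + 1)) K) := (rot q).toLinearMap

/-- Multiplication by the variable `x_k`. -/
def mulX (k : Fin (m + 1)) : Module.End K (MvPolynomial (Fin (m + 1)) K) :=
  LinearMap.mulLeft K (X k)

@[simp] theorem omg_apply (f : MvPolynomial (Fin (m + 1)) K) : omg m q f = rot q f := rfl

@[simp] theorem mulX_apply (k : Fin (m + 1)) (f : MvPolynomial (Fin (m + 1)) K) :
    mulX k f = X k * f := rfl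

/-- The Cherednik operator `Y_k = t^k T_k ⋯ T_{m-1} ω T_0⁻¹ ⋯ T_{k-1}⁻¹`. -/
def cherednik (m : ℕ) (q t : K) (k : ℕ) : Module.End K (MvPolynomial (Fin (m + 1)) K) :=
  t ^ k • (tail m t k * omg m q * headInv m t k)

/-- The raising operator `Φ = x_n ω`. -/
def raiseOp (m : ℕ) (q : K) : Module.End K (MvPolynomial (Fin (m + 1)) K) :=
  mulX (Fin.last m) * omg m q

theorem heckeN_omg {k : ℕ} (h : k + 1 < m) :
    heckeN m t k * omg m q = omg m q * heckeN m t (k + 1) := by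
  rw [heckeN_of_lt t h, heckeN_of_lt t (by omega : k < m)]
  refine LinearMap.ext fun f => ?_
  rw [Module.End.mul_apply, omg_apply, Module.End.mul_apply, omg_apply]
  exact hecke_rot q t (i := ⟨k, by omega⟩) (j := ⟨k + 1, h⟩) rfl f

theorem heckeN_mulX_of_ne {k : ℕ} {l : Fin (m + 1)} (h1 : (l : ℕ) ≠ k) (h2 : (l : ℕ) ≠ k + 1) :
    heckeN m t k * mulX l = mulX l * heckeN m t k := by
  unfold heckeN
  split_ifs with h
  · refine LinearMap.ext fun f => ?_
    rw [Module.End.mul_apply, mulX_apply, Module.End.mul_apply, mulX_apply, hecke_mul_X_of_ne]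
    · exact fun h' => h1 (by rw [h']; rfl)
    · exact fun h' => h2 (by rw [h']; rfl)
  · simp

variable {q t}

theorem heckeN_mulX (ht : t ≠ 0) {k : ℕ} (h : k < m) :
    heckeN m t k * mulX (⟨k, by omega⟩ : Fin (m + 1)) =
      t • (mulX ⟨k + 1, by omega⟩ * heckeInv m t k) := by
  refine LinearMap.ext fun f => ?_
  rw [heckeInv, mul_smul_comm, smul_smul, mul_inv_cancel₀ ht, one_smul, heckeN_of_lt t h]
  rw [Module.End.mul_apply, mulX_apply, Module.End.mul_apply, mulX_apply, LinearMap.sub_apply,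
    LinearMap.smul_apply, Module.End.one_apply]
  exact hecke_mul_X t ⟨k, h⟩ f

theorem heckeInv_mulX (ht : t ≠ 0) {k : ℕ} (h : k < m) :
    heckeInv m t k * mulX (⟨k + 1, by omega⟩ : Fin (m + 1)) =
      t⁻¹ • (mulX ⟨k, by omega⟩ * heckeN m t k) := by
  have h1 := congrArg (fun A => heckeInv m t k * A * heckeN m t k) (heckeN_mulX ht h)
  simp only [mul_smul_comm, smul_mul_assoc] at h1
  rw [← mul_assoc, heckeInv_mul ht h, one_mul, mul_assoc, mul_assoc, heckeInv_mul ht h,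
    mul_one] at h1
  rw [h1, smul_smul, inv_mul_cancel₀ ht, one_smul]

theorem heckeN_tail_of_add_two_le {j k : ℕ} (hk : k ≤ m) (hjk : j + 2 ≤ k) :
    heckeN m t j * tail m t k = tail m t k * heckeN m t j := by
  obtain ⟨d, hd⟩ : ∃ d, m = k + d := ⟨m - k, by omega⟩
  induction d generalizing k with
  | zero =>
    have : k = m := by omega
    subst this
    simp
  | succ d ih =>
    rw [tail_of_lt t (by omega), ← mul_assoc, heckeN_comm t hjk, mul_assoc,
      ih (k := k + 1) (by omega) (by omega) (by omega), mul_assoc]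

theorem heckeN_tail_of_lt {j k : ℕ} (hkj : k < j) (hjm : j < m) :
    heckeN m t j * tail m t k = tail m t k * heckeN m t (j - 1) := by
  obtain ⟨d, hd⟩ : ∃ d, j = k + 1 + d := ⟨j - k - 1, by omega⟩
  clear hkj
  induction d generalizing k with
  | zero =>
    have hj : j = k + 1 := hd
    subst hj
    simp only [Nat.add_sub_cancel]
    rw [tail_of_lt t (by omega : k < m), tail_of_lt t hjm, ← mul_assoc, ← mul_assoc,
      ← heckeN_braid t hjm, mul_assoc _ (heckeN m t k) (tail m t _),
      heckeN_tail_of_add_two_le (by omega) le_rfl]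
    simp only [mul_assoc]
  | succ d ih =>
    rw [tail_of_lt t (by omega : k < m), ← mul_assoc, ← heckeN_comm t (by omega), mul_assoc,
      ih (k := k + 1) (by omega), mul_assoc]

theorem heckeN_headInv_of_lt {j k : ℕ} (hkj : k < j) :
    heckeN m t j * headInv m t k = headInv m t k * heckeN m t j := by
  induction k with
  | zero => simp [headInv]
  | succ k ih =>
    rw [headInv, ← mul_assoc, ih (by omega), mul_assoc,
      commute_heckeInv (heckeN_comm t (by omega)).symm, mul_assoc]

theorem heckeN_headInv_of_add_two_le (ht : t ≠ 0) {j k : ℕ} (hjk : j + 2 ≤ k) (hk : k ≤ m) :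
    heckeN m t (j + 1) * headInv m t k = headInv m t k * heckeN m t j := by
  induction k, hjk using Nat.le_induction with
  | base =>
    have h1 := heckeN_braid t (by omega : j + 1 < m)
    have a1 := heckeInv_mul ht (by omega : j < m)
    have a2 := heckeN_mul_inv ht (by omega : j < m)
    have b1 := heckeInv_mul ht (by omega : j + 1 < m)
    have b2 := heckeN_mul_inv ht (by omega : j + 1 < m)
    have key : heckeN m t (j + 1) * (heckeInv m t j * heckeInv m t (j + 1)) =
        heckeInv m t j * heckeInv m t (j + 1) * heckeN m t j := by
      generalize heckeN m t j = A at *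
      generalize heckeN m t (j + 1) = B at *
      generalize heckeInv m t j = A' at *
      generalize heckeInv m t (j + 1) = B' at *
      calc B * (A' * B') = A' * B' * (B * A * B) * A' * B' := by
            rw [show A' * B' * (B * A * B) * A' * B' = A' * (B' * B) * A * B * A' * B' by
              simp only [mul_assoc], b1, mul_one, a1, one_mul, mul_assoc]
        _ = A' * B' * (A * B * A) * A' * B' := by rw [h1]
        _ = A' * B' * A := by
            rw [show A' * B' * (A * B * A) * A' * B' = A' * B' * A * B * (A * A') * B' by
              simp only [mul_assoc], a2, mul_one, mul_assoc _ B B', b2, mul_one]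
    rw [headInv, headInv, mul_assoc, ← mul_assoc, heckeN_headInv_of_lt (by omega), mul_assoc, key]
    simp only [mul_assoc]
  | succ k hk' ih =>
    rw [headInv, ← mul_assoc, ih (by omega), mul_assoc, commute_heckeInv (heckeN_comm t hk'),
      mul_assoc]

/-- `T_j` commutes with `Y_k` unless `k` is `j` or `j + 1`. -/
theorem heckeN_cherednik (ht : t ≠ 0) {j k : ℕ} (hj : j < m) (hk : k ≤ m) (h1 : k ≠ j)
    (h2 : k ≠ j + 1) :
    heckeN m t j * cherednik m q t k = cherednik m q t k * heckeN m t j := by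
  unfold cherednik
  rw [mul_smul_comm, smul_mul_assoc]
  congr 1
  rcases lt_or_gt_of_ne h1 with h | h
  · rw [← mul_assoc, ← mul_assoc, heckeN_tail_of_lt h hj, mul_assoc _ (heckeN m t (j - 1)),
      heckeN_omg q t (by omega), Nat.sub_add_cancel (by omega), ← mul_assoc, mul_assoc _ _
      (headInv m t k), heckeN_headInv_of_lt h, mul_assoc, mul_assoc, mul_assoc]
  · have h3 : j + 2 ≤ k := by omega
    rw [← mul_assoc, ← mul_assoc, heckeN_tail_of_add_two_le hk h3, mul_assoc _ (heckeN m t j),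
      heckeN_omg q t (by omega), ← mul_assoc, mul_assoc _ _ (headInv m t k),
      heckeN_headInv_of_add_two_le ht h3 hk, mul_assoc, mul_assoc, mul_assoc]

theorem heckeN_cherednik_heckeN (ht : t ≠ 0) {k : ℕ} (hk : k < m) :
    heckeN m t k * cherednik m q t (k + 1) * heckeN m t k = t • cherednik m q t k := by
  unfold cherednik
  rw [mul_smul_comm, smul_mul_assoc, smul_smul, ← pow_succ', headInv, ← mul_assoc, ← mul_assoc,
    ← mul_assoc, ← tail_of_lt t hk, mul_assoc _ (heckeInv m t k), heckeInv_mul ht hk, mul_one]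

theorem cherednik_succ (ht : t ≠ 0) {k : ℕ} (hk : k < m) :
    cherednik m q t (k + 1) = t • (heckeInv m t k * cherednik m q t k * heckeInv m t k) := by
  have h := congrArg (fun A => heckeInv m t k * A * heckeInv m t k)
    (heckeN_cherednik_heckeN (q := q) ht hk)
  simp only [mul_smul_comm, smul_mul_assoc] at h
  rw [← h]
  rw [show heckeInv m t k * (heckeN m t k * cherednik m q t (k + 1) * heckeN m t k) *
    heckeInv m t k = (heckeInv m t k * heckeN m t k) * cherednik m q t (k + 1) *
      (heckeN m t k * heckeInv m t k) by simp only [mul_assoc], heckeInv_mul ht hk,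
    heckeN_mul_inv ht hk, one_mul, mul_one]

theorem heckeN_raiseOp {k : ℕ} (h : k + 1 < m) :
    heckeN m t k * raiseOp m q = raiseOp m q * heckeN m t (k + 1) := by
  rw [raiseOp, ← mul_assoc, heckeN_mulX_of_ne t (by simp; omega) (by simp; omega), mul_assoc,
    heckeN_omg q t h, mul_assoc]

theorem heckeInv_raiseOp {k : ℕ} (h : k + 1 < m) :
    heckeInv m t k * raiseOp m q = raiseOp m q * heckeInv m t (k + 1) := by
  rw [heckeInv, heckeInv, smul_mul_assoc, mul_smul_comm, sub_mul, mul_sub, heckeN_raiseOp h,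
    smul_mul_assoc, mul_smul_comm, one_mul, mul_one]

theorem omg_mulX_zero : omg m q * mulX 0 = q • (mulX (Fin.last m) * omg m q) := by
  refine LinearMap.ext fun f => ?_
  simp [smul_eq_C_mul, mul_assoc]

theorem omg_mulX_succ (k : Fin m) : omg m q * mulX k.succ = mulX k.castSucc * omg m q := by
  refine LinearMap.ext fun f => ?_
  simp

theorem tail_mulX_omg {M : ℕ} (hq : q ≠ 0) (ht : t ≠ 0) {k : ℕ} (hk : k ≤ M) :
    tail (M + 1) t k * mulX (⟨M, by omega⟩ : Fin (M + 1 + 1)) * omg (M + 1) q * omg (M + 1) q =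
      t • (raiseOp (M + 1) q * tail (M + 1) t (k + 1) * omg (M + 1) q *
        heckeInv (M + 1) t 0) := by
  obtain ⟨d, hd⟩ : ∃ d, M = k + d := ⟨M - k, by omega⟩
  clear hk
  induction d generalizing k with
  | zero =>
    have hM : k = M := hd.symm
    subst hM
    rw [tail_of_lt t (by omega : k < k + 1), tail_self, mul_one, mul_one]
    have h1 := heckeN_mulX ht (by omega : k < k + 1)
    have h2 : heckeN (k + 1) t k * omg (k + 1) q * omg (k + 1) q =
        omg (k + 1) q * omg (k + 1) q * heckeN (k + 1) t 0 := by
      rw [heckeN_of_lt t (by omega : k < k + 1), heckeN_of_lt t (by omega : 0 < k + 1)]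
      exact LinearMap.ext fun f => hecke_rot_rot hq t f
    have h3 : heckeInv (k + 1) t k * (omg (k + 1) q * omg (k + 1) q) =
        omg (k + 1) q * omg (k + 1) q * heckeInv (k + 1) t 0 := by
      rw [heckeInv, heckeInv, smul_mul_assoc, mul_smul_comm, sub_mul, mul_sub, ← mul_assoc, h2,
        smul_mul_assoc, mul_smul_comm, one_mul, mul_one]
    rw [h1, smul_mul_assoc, smul_mul_assoc, mul_assoc, mul_assoc, h3, raiseOp]
    simp only [mul_assoc]
    rfl
  | succ d ih =>
    have ih' := ih (k := k + 1) (by omega)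
    simp only [mul_assoc] at ih' ⊢
    rw [tail_of_lt t (by omega : k < M + 1), mul_assoc, ih', mul_smul_comm, ← mul_assoc,
      heckeN_raiseOp (by omega), tail_of_lt t (by omega : k + 1 < M + 1)]
    simp only [mul_assoc]

theorem cherednik_raiseOp (hq : q ≠ 0) (ht : t ≠ 0) {k : ℕ} (hk : k < m) :
    cherednik m q t k * raiseOp m q = raiseOp m q * cherednik m q t (k + 1) := by
  induction k with
  | zero =>
    obtain ⟨M, rfl⟩ : ∃ M, m = M + 1 := ⟨m - 1, by omega⟩
    have h1 := tail_mulX_omg hq ht (Nat.zero_le M)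
    have h2 : omg (M + 1) q * mulX (Fin.last (M + 1)) = _ :=
      omg_mulX_succ (q := q) (Fin.last M)
    unfold cherednik
    rw [headInv, headInv, headInv, mul_one, one_mul, pow_zero, one_smul, pow_one, mul_smul_comm]
    nth_rw 1 [raiseOp]
    rw [mul_assoc, ← mul_assoc (omg (M + 1) q), h2]
    simp only [mul_assoc] at h1 ⊢
    exact h1
  | succ k ih =>
    rw [cherednik_succ ht (by omega : k < m), cherednik_succ ht hk, smul_mul_assoc, mul_assoc,
      heckeInv_raiseOp hk, ← mul_assoc, mul_assoc (heckeInv m t k), ih (by omega), ← mul_assoc,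
      heckeInv_raiseOp hk, mul_smul_comm]
    simp only [mul_assoc]

theorem headInv_mulX_tail (ht : t ≠ 0) {k : ℕ} (hk : k ≤ m) :
    headInv m t k * mulX (⟨k, by omega⟩ : Fin (m + 1)) * tail m t k =
      (t ^ k)⁻¹ • (mulX 0 * tail m t 0) := by
  induction k with
  | zero => simp [headInv]
  | succ k ih =>
    rw [headInv, mul_assoc (headInv m t k), heckeInv_mulX ht (by omega : k < m), mul_smul_comm,
      smul_mul_assoc, ← mul_assoc, mul_assoc _ (heckeN m t k), ← tail_of_lt t (by omega : k < m),
      ih (by omega), smul_smul, pow_succ', mul_inv]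

theorem cherednik_last_raiseOp (ht : t ≠ 0) :
    cherednik m q t m * raiseOp m q = q • (raiseOp m q * cherednik m q t 0) := by
  have h1 := headInv_mulX_tail ht (le_refl m)
  rw [tail_self, mul_one] at h1
  have h2 : headInv m t m * mulX (Fin.last m) = _ := h1
  unfold cherednik
  nth_rw 1 [raiseOp]
  rw [tail_self, one_mul, smul_mul_assoc, mul_assoc, ← mul_assoc (headInv m t m), h2,
    smul_mul_assoc, mul_smul_comm, smul_smul, mul_inv_cancel₀ (pow_ne_zero _ ht), one_smul,
    ← mul_assoc, ← mul_assoc, omg_mulX_zero, headInv, mul_one, pow_zero, one_smul, raiseOp,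
    smul_mul_assoc, smul_mul_assoc, mul_assoc _ (tail m t 0)]

end Cherednik

end

section

open MvPolynomial

/-! ### Monomials, coefficients and the triangular order -/

section Monomials

variable {n : ℕ} {K : Type*} [Field K]

/-- The monomial `x ^ μ`. -/
def mon (K : Type*) [Field K] (μ : Fin n → ℕ) : MvPolynomial (Fin n) K := ∏ i, X i ^ μ i

/-- The coefficient of `x ^ μ`. -/
def cf (μ : Fin n → ℕ) : MvPolynomial (Fin n) K →ₗ[K] K :=
  lcoeff K (Finsupp.equivFunOnFinite.symm μ)

theorem cf_apply (μ : Fin n → ℕ) (f : MvPolynomial (Fin n) K) :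
    cf μ f = coeff (Finsupp.equivFunOnFinite.symm μ) f := rfl

theorem mon_eq_monomial (μ : Fin n → ℕ) :
    mon K μ = monomial (Finsupp.equivFunOnFinite.symm μ) 1 := by
  rw [monomial_eq, C_1, one_mul, Finsupp.prod_fintype _ _ fun i => pow_zero _]
  rfl

theorem cf_mon (ν μ : Fin n → ℕ) : cf ν (mon K μ) = if μ = ν then 1 else 0 := by
  classical
  rw [cf_apply, mon_eq_monomial, coeff_monomial]
  simp

theorem cf_mon_self (μ : Fin n → ℕ) : cf μ (mon K μ) = 1 := by rw [cf_mon, if_pos rfl]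

theorem cf_mon_of_ne {ν μ : Fin n → ℕ} (h : μ ≠ ν) : cf ν (mon K μ) = 0 := by
  rw [cf_mon, if_neg h]

/-- The exponents of the monomials that occur in `f`. -/
def supp (f : MvPolynomial (Fin n) K) : Finset (Fin n → ℕ) :=
  f.support.map Finsupp.equivFunOnFinite.toEmbedding

theorem mem_supp {f : MvPolynomial (Fin n) K} {μ : Fin n → ℕ} : μ ∈ supp f ↔ cf μ f ≠ 0 := by
  simp only [supp, Finset.mem_map_equiv, mem_support_iff, cf_apply]

theorem eq_sum_mon (f : MvPolynomial (Fin n) K) : f = ∑ μ ∈ supp f, cf μ f • mon K μ := by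
  conv_lhs => rw [f.as_sum]
  rw [supp, Finset.sum_map]
  refine Finset.sum_congr rfl fun d _ => ?_
  rw [mon_eq_monomial, smul_monomial, smul_eq_mul, mul_one]
  simp [cf_apply]

theorem ext_cf {f g : MvPolynomial (Fin n) K} (h : ∀ μ, cf μ f = cf μ g) : f = g := by
  ext d
  have := h (Finsupp.equivFunOnFinite d)
  simpa [cf_apply] using this

theorem mem_span_mon {S : Set (Fin n → ℕ)} {f : MvPolynomial (Fin n) K}
    (h : ∀ μ, cf μ f ≠ 0 → μ ∈ S) : f ∈ Submodule.span K (mon K '' S) := by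
  rw [eq_sum_mon f]
  exact Submodule.sum_mem _ fun μ hμ => Submodule.smul_mem _ _
    (Submodule.subset_span ⟨μ, h μ (mem_supp.1 hμ), rfl⟩)

theorem linearMap_ext_mon {M : Type*} [AddCommGroup M] [Module K M]
    {A B : MvPolynomial (Fin n) K →ₗ[K] M} (h : ∀ μ, A (mon K μ) = B (mon K μ)) : A = B := by
  refine LinearMap.ext fun f => ?_
  rw [eq_sum_mon f, map_sum, map_sum]
  exact Finset.sum_congr rfl fun μ _ => by rw [map_smul, map_smul, h]

/-- `∑_i (μ_i - k)⁺`. -/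
def excess (k : ℕ) (μ : Fin n → ℕ) : ℕ := ∑ i, (μ i - k)

/-- Dominance of the underlying partitions, in terms of the excesses. -/
def DomLE (ν μ : Fin n → ℕ) : Prop := ∑ i, ν i = ∑ i, μ i ∧ ∀ k, excess k ν ≤ excess k μ

/-- A strict form of `DomLE`. -/
def DomStrict (ν μ : Fin n → ℕ) : Prop := DomLE ν μ ∧ ∑ i, ν i ^ 2 < ∑ i, μ i ^ 2

theorem DomLE.refl (μ : Fin n → ℕ) : DomLE μ μ := ⟨rfl, fun _ => le_rfl⟩

theorem DomLE.trans {ν μ ρ : Fin n → ℕ} (h : DomLE ν μ) (h' : DomLE μ ρ) : DomLE ν ρ :=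
  ⟨h.1.trans h'.1, fun k => (h.2 k).trans (h'.2 k)⟩

theorem DomStrict.trans_le {ν μ ρ : Fin n → ℕ} (h : DomStrict ν μ) (h' : DomLE μ ρ)
    (h'' : ∑ i, μ i ^ 2 ≤ ∑ i, ρ i ^ 2) : DomStrict ν ρ :=
  ⟨h.1.trans h', h.2.trans_le h''⟩

theorem sum_comp_perm {M : Type*} [AddCommMonoid M] (F : ℕ → M) (μ : Fin n → ℕ)
    (σ : Equiv.Perm (Fin n)) : ∑ i, F ((μ ∘ σ) i) = ∑ i, F (μ i) :=
  Equiv.sum_comp σ fun i => F (μ i)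

theorem excess_comp (k : ℕ) (μ : Fin n → ℕ) (σ : Equiv.Perm (Fin n)) :
    excess k (μ ∘ σ) = excess k μ := sum_comp_perm (fun a => a - k) μ σ

theorem domLE_comp_left {ν μ : Fin n → ℕ} (σ : Equiv.Perm (Fin n)) :
    DomLE (ν ∘ σ) μ ↔ DomLE ν μ := by
  unfold DomLE
  simp only [excess_comp, sum_comp_perm (fun a => a)]

theorem domLE_comp_right {ν μ : Fin n → ℕ} (σ : Equiv.Perm (Fin n)) :
    DomLE ν (μ ∘ σ) ↔ DomLE ν μ := by
  unfold DomLE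
  simp only [excess_comp, sum_comp_perm (fun a => a)]

theorem domStrict_comp_left {ν μ : Fin n → ℕ} (σ : Equiv.Perm (Fin n)) :
    DomStrict (ν ∘ σ) μ ↔ DomStrict ν μ := by
  unfold DomStrict
  rw [domLE_comp_left, sum_comp_perm fun a => a ^ 2]

theorem domStrict_comp_right {ν μ : Fin n → ℕ} (σ : Equiv.Perm (Fin n)) :
    DomStrict ν (μ ∘ σ) ↔ DomStrict ν μ := by
  unfold DomStrict
  rw [domLE_comp_right, sum_comp_perm fun a => a ^ 2]

/-- The polynomials in whose monomials `x ^ μ` the exponent `μ` is not strictly above `κ`. -/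
def notAbove (K : Type*) [Field K] (κ : Fin n → ℕ) : Submodule K (MvPolynomial (Fin n) K) :=
  Submodule.span K (mon K '' {μ | ¬ DomStrict κ μ})

theorem mon_mem_notAbove {κ μ : Fin n → ℕ} (h : ¬ DomStrict κ μ) : mon K μ ∈ notAbove K κ :=
  Submodule.subset_span ⟨μ, h, rfl⟩

theorem notAbove_comp (κ : Fin n → ℕ) (σ : Equiv.Perm (Fin n)) :
    notAbove K (κ ∘ σ) = notAbove K κ := by
  simp only [notAbove, domStrict_comp_left]

end Monomials

section HeckeMonomial

variable {m : ℕ} {K : Type*} [Field K]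

/-- The tuple `μ` with the entries in positions `i`, `i + 1` replaced by `p`, `r`. -/
def mix (i : Fin m) (μ : Fin (m + 1) → ℕ) (p r : ℕ) (k : Fin (m + 1)) : ℕ :=
  if k = i.castSucc then p else if k = i.succ then r else μ k

@[to_additive]
theorem prod_mix {M : Type*} [CommMonoid M] (F : Fin (m + 1) → ℕ → M) (i : Fin m)
    (μ : Fin (m + 1) → ℕ) (p r : ℕ) :
    ∏ k, F k (mix i μ p r k) =
      F i.castSucc p * (F i.succ r *
        ∏ k ∈ (Finset.univ.erase i.castSucc).erase i.succ, F k (μ k)) := by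
  have h : i.succ ∈ Finset.univ.erase i.castSucc :=
    Finset.mem_erase.2 ⟨(castSucc_ne_succ i).symm, Finset.mem_univ _⟩
  rw [← Finset.mul_prod_erase _ _ (Finset.mem_univ i.castSucc), ← Finset.mul_prod_erase _ _ h]
  have h1 : mix i μ p r i.castSucc = p := if_pos rfl
  have h2 : mix i μ p r i.succ = r := by
    rw [mix, if_neg (castSucc_ne_succ i).symm, if_pos rfl]
  rw [h1, h2]
  congr 2
  refine Finset.prod_congr rfl fun k hk => ?_
  simp only [Finset.mem_erase] at hk
  rw [mix, if_neg hk.2.1, if_neg hk.1]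

theorem mix_self (i : Fin m) (μ : Fin (m + 1) → ℕ) : mix i μ (μ i.castSucc) (μ i.succ) = μ := by
  funext k
  unfold mix
  split_ifs with h1 h2
  · rw [h1]
  · rw [h2]
  · rfl

theorem mix_swap (i : Fin m) (μ : Fin (m + 1) → ℕ) :
    mix i μ (μ i.succ) (μ i.castSucc) = μ ∘ adj i := by
  funext k
  unfold mix adj
  rw [Function.comp_apply, Equiv.swap_apply_def]
  split_ifs <;> rfl

theorem comp_adj_of_eq {i : Fin m} {μ : Fin (m + 1) → ℕ} (h : μ i.castSucc = μ i.succ) :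
    μ ∘ adj i = μ := by
  rw [← mix_swap]
  conv_rhs => rw [← mix_self i μ]
  rw [h]

theorem comp_adj_adj (i : Fin m) (μ : Fin (m + 1) → ℕ) : (μ ∘ adj i) ∘ adj i = μ := by
  funext k
  simp [adj]

theorem adj_castSucc (i : Fin m) : adj i i.castSucc = i.succ := Equiv.swap_apply_left _ _

theorem adj_succ (i : Fin m) : adj i i.succ = i.castSucc := Equiv.swap_apply_right _ _

theorem rename_mon {n : ℕ} (σ : Equiv.Perm (Fin n)) (μ : Fin n → ℕ) :
    rename σ (mon K (μ ∘ σ)) = mon K μ := by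
  simp only [mon, map_prod, map_pow, rename_X, Function.comp_apply]
  exact Equiv.prod_comp σ fun i => X i ^ μ i

theorem domStrict_mix {i : Fin m} {μ : Fin (m + 1) → ℕ} {p r : ℕ}
    (h : p + r = μ i.castSucc + μ i.succ)
    (h1 : min (μ i.castSucc) (μ i.succ) < p) (h2 : min (μ i.castSucc) (μ i.succ) < r) :
    DomStrict (mix i μ p r) μ := by
  set a := μ i.castSucc with ha
  set b := μ i.succ with hb
  have hμ : μ = mix i μ a b := (mix_self i μ).symm
  refine ⟨⟨?_, fun k => ?_⟩, ?_⟩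
  · conv_rhs => rw [hμ]
    rw [sum_mix (fun _ x => x), sum_mix (fun _ x => x)]
    omega
  · conv_rhs => rw [hμ]
    unfold excess
    rw [sum_mix (fun _ x => x - k), sum_mix (fun _ x => x - k)]
    omega
  · conv_rhs => rw [hμ]
    rw [sum_mix (fun _ x => x ^ 2), sum_mix (fun _ x => x ^ 2), ← add_assoc, ← add_assoc]
    refine Nat.add_lt_add_right ?_ _
    rcases le_total a b with hab | hab
    · rw [min_eq_left hab] at h1 h2
      obtain ⟨x, hx⟩ := Nat.exists_eq_add_of_lt h1
      obtain ⟨y, hy⟩ := Nat.exists_eq_add_of_lt h2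
      have hb' : b = a + x + y + 2 := by omega
      rw [hx, hy, hb']
      nlinarith [Nat.zero_le (x * y)]
    · rw [min_eq_right hab] at h1 h2
      obtain ⟨x, hx⟩ := Nat.exists_eq_add_of_lt h1
      obtain ⟨y, hy⟩ := Nat.exists_eq_add_of_lt h2
      have hb' : a = b + x + y + 2 := by omega
      rw [hx, hy, hb']
      nlinarith [Nat.zero_le (x * y)]

/-- The span of the monomials strictly below `x ^ μ`. -/
def belowSpan (K : Type*) [Field K] {n : ℕ} (μ : Fin n → ℕ) :
    Submodule K (MvPolynomial (Fin n) K) :=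
  Submodule.span K (mon K '' {ν | DomStrict ν μ})

theorem hecke_mon_of_eq (t : K) (i : Fin m) {μ : Fin (m + 1) → ℕ}
    (h : μ i.castSucc = μ i.succ) : hecke t i (mon K μ) = t • mon K μ := by
  refine hecke_of_symm t i ?_
  nth_rw 1 [← comp_adj_of_eq h]
  exact rename_mon _ _

theorem mon_mix (i : Fin m) (μ : Fin (m + 1) → ℕ) (p r : ℕ) :
    mon K (mix i μ p r) = X i.castSucc ^ p * (X i.succ ^ r *
      ∏ k ∈ (Finset.univ.erase i.castSucc).erase i.succ, X k ^ μ k) :=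
  prod_mix (fun k a => (X k : MvPolynomial (Fin (m + 1)) K) ^ a) i μ p r

theorem rename_adj_mon (i : Fin m) (μ : Fin (m + 1) → ℕ) :
    rename (adj i) (mon K μ) = mon K (μ ∘ adj i) := by
  nth_rw 1 [← comp_adj_adj i μ]
  exact rename_mon _ _

theorem exists_hecke_mon_of_gt (t : K) (i : Fin m) {μ : Fin (m + 1) → ℕ}
    (h : μ i.succ < μ i.castSucc) :
    ∃ g ∈ belowSpan K μ, hecke t i (mon K μ) = mon K (μ ∘ adj i) + g := by
  obtain ⟨d, hd⟩ := Nat.exists_eq_add_of_lt h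
  set b := μ i.succ with hb
  refine ⟨(1 - t) • ∑ j ∈ Finset.range d, mon K (mix i μ (b + 1 + j) (b + 1 + (d - 1 - j))),
    Submodule.smul_mem _ _ (Submodule.sum_mem _ fun j hj => Submodule.subset_span
      ⟨_, domStrict_mix ?_ ?_ ?_, rfl⟩), hecke_unique ?_⟩
  · rw [Finset.mem_range] at hj
    omega
  · omega
  · omega
  have h1 : mon K μ = mon K (mix i μ (b + d + 1) b) := by rw [← hd, hb, mix_self]
  have h2 : mon K (μ ∘ adj i) = mon K (mix i μ b (b + d + 1)) := by rw [← hd, hb, mix_swap]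
  have h3 := geom_sum₂_mul (X i.castSucc : MvPolynomial (Fin (m + 1)) K) (X i.succ) d
  rw [rename_adj_mon, h1, h2, smul_eq_C_mul, map_sub, C_1]
  simp only [mon_mix]
  generalize (∏ k ∈ (Finset.univ.erase i.castSucc).erase i.succ, X k ^ μ k :
    MvPolynomial (Fin (m + 1)) K) = R
  have h4 : ∑ j ∈ Finset.range d, (X i.castSucc ^ (b + 1 + j) * (X i.succ ^ (b + 1 + (d - 1 - j))
      * R) : MvPolynomial (Fin (m + 1)) K) = (X i.castSucc * X i.succ) ^ (b + 1) * R *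
      ∑ j ∈ Finset.range d, X i.castSucc ^ j * X i.succ ^ (d - 1 - j) := by
    rw [Finset.mul_sum]
    exact Finset.sum_congr rfl fun j _ => by ring
  rw [h4]
  linear_combination ((X i.castSucc * X i.succ) ^ (b + 1) * R * (1 - C t)) * h3

theorem exists_hecke_mon_of_lt (t : K) (i : Fin m) {μ : Fin (m + 1) → ℕ}
    (h : μ i.castSucc < μ i.succ) :
    ∃ g ∈ belowSpan K μ,
      hecke t i (mon K μ) = t • mon K (μ ∘ adj i) + (t - 1) • mon K μ + g := by
  obtain ⟨d, hd⟩ := Nat.exists_eq_add_of_lt h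
  set b := μ i.castSucc with hb
  refine ⟨(t - 1) • ∑ j ∈ Finset.range d, mon K (mix i μ (b + 1 + j) (b + 1 + (d - 1 - j))),
    Submodule.smul_mem _ _ (Submodule.sum_mem _ fun j hj => Submodule.subset_span
      ⟨_, domStrict_mix ?_ ?_ ?_, rfl⟩), hecke_unique ?_⟩
  · rw [Finset.mem_range] at hj
    omega
  · omega
  · omega
  have h1 : mon K μ = mon K (mix i μ b (b + d + 1)) := by rw [← hd, hb, mix_self]
  have h2 : mon K (μ ∘ adj i) = mon K (mix i μ (b + d + 1) b) := by rw [← hd, hb, mix_swap]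
  have h3 := geom_sum₂_mul (X i.castSucc : MvPolynomial (Fin (m + 1)) K) (X i.succ) d
  rw [rename_adj_mon, h1, h2, smul_eq_C_mul, smul_eq_C_mul, smul_eq_C_mul, map_sub, C_1]
  simp only [mon_mix]
  generalize (∏ k ∈ (Finset.univ.erase i.castSucc).erase i.succ, X k ^ μ k :
    MvPolynomial (Fin (m + 1)) K) = R
  have h4 : ∑ j ∈ Finset.range d, (X i.castSucc ^ (b + 1 + j) * (X i.succ ^ (b + 1 + (d - 1 - j))
      * R) : MvPolynomial (Fin (m + 1)) K) = (X i.castSucc * X i.succ) ^ (b + 1) * R *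
      ∑ j ∈ Finset.range d, X i.castSucc ^ j * X i.succ ^ (d - 1 - j) := by
    rw [Finset.mul_sum]
    exact Finset.sum_congr rfl fun j _ => by ring
  rw [h4]
  linear_combination ((X i.castSucc * X i.succ) ^ (b + 1) * R * (C t - 1)) * h3

theorem below_le_notAbove {κ μ : Fin (m + 1) → ℕ} (h : ¬ DomStrict κ μ) :
    belowSpan K μ ≤ notAbove K κ := by
  refine Submodule.span_le.2 ?_
  rintro _ ⟨ν, hν, rfl⟩
  exact mon_mem_notAbove fun h' => h (h'.trans_le hν.1 hν.2.le)

theorem hecke_mem_notAbove (t : K) (i : Fin m) {κ : Fin (m + 1) → ℕ}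
    {f : MvPolynomial (Fin (m + 1)) K} (hf : f ∈ notAbove K κ) :
    hecke t i f ∈ notAbove K κ := by
  suffices h : notAbove K κ ≤ (notAbove K κ).comap (hecke t i) from h hf
  refine Submodule.span_le.2 ?_
  rintro _ ⟨μ, hμ, rfl⟩
  have hμ' : ¬ DomStrict κ (μ ∘ adj i) := by rwa [domStrict_comp_right]
  rw [SetLike.mem_coe, Submodule.mem_comap]
  rcases lt_trichotomy (μ i.castSucc) (μ i.succ) with h | h | h
  · obtain ⟨g, hg, e⟩ := exists_hecke_mon_of_lt t i h
    rw [e]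
    exact Submodule.add_mem _ (Submodule.add_mem _
      (Submodule.smul_mem _ _ (mon_mem_notAbove hμ'))
      (Submodule.smul_mem _ _ (mon_mem_notAbove hμ)))
      (below_le_notAbove hμ hg)
  · rw [hecke_mon_of_eq t i h]
    exact Submodule.smul_mem _ _ (mon_mem_notAbove hμ)
  · obtain ⟨g, hg, e⟩ := exists_hecke_mon_of_gt t i h
    rw [e]
    exact Submodule.add_mem _ (mon_mem_notAbove hμ') (below_le_notAbove hμ hg)

theorem cf_eq_zero_of_mem_below {ν μ : Fin (m + 1) → ℕ} (h : ¬ DomStrict ν μ)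
    {g : MvPolynomial (Fin (m + 1)) K} (hg : g ∈ belowSpan K μ) : cf ν g = 0 := by
  suffices h' : belowSpan K μ ≤ LinearMap.ker (cf (K := K) ν) from h' hg
  refine Submodule.span_le.2 ?_
  rintro _ ⟨ρ, hρ, rfl⟩
  rw [SetLike.mem_coe, LinearMap.mem_ker, cf_mon_of_ne]
  rintro rfl
  exact h hρ

theorem comp_adj_eq_iff {i : Fin m} {μ ν : Fin (m + 1) → ℕ} : μ ∘ adj i = ν ↔ μ = ν ∘ adj i := by
  constructor
  · rintro rfl
    exact (comp_adj_adj i μ).symm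
  · rintro rfl
    exact comp_adj_adj i ν

theorem cf_hecke_of_le (t : K) (i : Fin m) {ν : Fin (m + 1) → ℕ}
    (h : ν i.succ ≤ ν i.castSucc) {f : MvPolynomial (Fin (m + 1)) K} (hf : f ∈ notAbove K ν) :
    cf ν (hecke t i f) = t * cf (ν ∘ adj i) f := by
  suffices h' : notAbove K ν ≤ LinearMap.ker (cf ν ∘ₗ hecke t i - t • cf (K := K) (ν ∘ adj i)) by
    have := h' hf
    rw [LinearMap.mem_ker] at this
    exact sub_eq_zero.1 this
  refine Submodule.span_le.2 ?_
  rintro _ ⟨μ, hμ, rfl⟩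
  rw [SetLike.mem_coe, LinearMap.mem_ker, LinearMap.sub_apply, LinearMap.smul_apply,
    LinearMap.comp_apply, smul_eq_mul, sub_eq_zero]
  rcases lt_trichotomy (μ i.castSucc) (μ i.succ) with h1 | h1 | h1
  · obtain ⟨g, hg, e⟩ := exists_hecke_mon_of_lt t i h1
    have h2 : μ ≠ ν := by
      rintro rfl
      omega
    rw [e, map_add, map_add, map_smul, map_smul, cf_eq_zero_of_mem_below hμ hg, add_zero,
      cf_mon_of_ne h2, smul_zero, add_zero, cf_mon, cf_mon, smul_eq_mul]
    simp only [comp_adj_eq_iff]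
  · rw [hecke_mon_of_eq t i h1, map_smul, cf_mon, cf_mon, smul_eq_mul]
    have h3 : μ = ν ↔ μ = ν ∘ adj i := by rw [← comp_adj_eq_iff, comp_adj_of_eq h1]
    simp only [h3]
  · obtain ⟨g, hg, e⟩ := exists_hecke_mon_of_gt t i h1
    have h2 : μ ≠ ν ∘ adj i := by
      rintro rfl
      simp only [Function.comp_apply, adj_castSucc, adj_succ] at h1
      omega
    rw [e, map_add, cf_eq_zero_of_mem_below hμ hg, add_zero, cf_mon_of_ne h2, mul_zero,
      cf_mon_of_ne (comp_adj_eq_iff.not.2 h2)]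

theorem cf_hecke_of_lt (t : K) (i : Fin m) {ν : Fin (m + 1) → ℕ}
    (h : ν i.castSucc < ν i.succ) {f : MvPolynomial (Fin (m + 1)) K} (hf : f ∈ notAbove K ν) :
    cf ν (hecke t i f) = cf (ν ∘ adj i) f + (t - 1) * cf ν f := by
  suffices h' : notAbove K ν ≤ LinearMap.ker
      (cf ν ∘ₗ hecke t i - (cf (K := K) (ν ∘ adj i) + (t - 1) • cf ν)) by
    have := h' hf
    rw [LinearMap.mem_ker] at this
    exact sub_eq_zero.1 this
  refine Submodule.span_le.2 ?_
  rintro _ ⟨μ, hμ, rfl⟩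
  rw [SetLike.mem_coe, LinearMap.mem_ker, LinearMap.sub_apply, LinearMap.add_apply,
    LinearMap.smul_apply, LinearMap.comp_apply, smul_eq_mul, sub_eq_zero]
  rcases lt_trichotomy (μ i.castSucc) (μ i.succ) with h1 | h1 | h1
  · obtain ⟨g, hg, e⟩ := exists_hecke_mon_of_lt t i h1
    have h2 : μ ≠ ν ∘ adj i := by
      rintro rfl
      simp only [Function.comp_apply, adj_castSucc, adj_succ] at h1
      omega
    rw [e, map_add, map_add, map_smul, map_smul, cf_eq_zero_of_mem_below hμ hg, add_zero,
      cf_mon_of_ne h2, cf_mon_of_ne (comp_adj_eq_iff.not.2 h2), smul_zero, smul_eq_mul]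
  · have h2 : μ ≠ ν := by
      rintro rfl
      omega
    have h3 : μ ≠ ν ∘ adj i := by
      rintro rfl
      simp only [Function.comp_apply, adj_castSucc, adj_succ] at h1
      omega
    rw [hecke_mon_of_eq t i h1, map_smul, cf_mon_of_ne h2, cf_mon_of_ne h3]
    simp
  · obtain ⟨g, hg, e⟩ := exists_hecke_mon_of_gt t i h1
    have h2 : μ ≠ ν := by
      rintro rfl
      omega
    rw [e, map_add, cf_eq_zero_of_mem_below hμ hg, cf_mon_of_ne h2, cf_mon, cf_mon]
    simp only [comp_adj_eq_iff, mul_zero]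

theorem rot_mon (q : K) (μ : Fin (m + 1) → ℕ) :
    rot q (mon K μ) = q ^ μ 0 • mon K (Fin.snoc (fun k : Fin m => μ k.succ) (μ 0)) := by
  unfold mon
  rw [map_prod, Fin.prod_univ_succ, Fin.prod_univ_castSucc]
  simp only [map_pow, rot_X_zero, rot_X_succ, Fin.snoc_castSucc, Fin.snoc_last, mul_pow,
    smul_eq_C_mul]
  ring

theorem snoc_eq_iff_cons {x : ℕ} {β : Fin m → ℕ} {μ : Fin (m + 1) → ℕ} :
    (Fin.snoc (fun k : Fin m => μ k.succ) (μ 0) : Fin (m + 1) → ℕ) = Fin.snoc β x ↔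
      μ = Fin.cons x β := by
  constructor
  · intro h
    have h1 := congrFun h (Fin.last m)
    simp only [Fin.snoc_last] at h1
    funext k
    refine Fin.cases ?_ (fun l => ?_) k
    · simpa using h1
    · have h2 := congrFun h l.castSucc
      simpa only [Fin.snoc_castSucc, Fin.cons_succ] using h2
  · rintro rfl
    simp

theorem cf_rot (q : K) (x : ℕ) (β : Fin m → ℕ) (f : MvPolynomial (Fin (m + 1)) K) :
    cf (Fin.snoc β x : Fin (m + 1) → ℕ) (rot q f) =
      q ^ x * cf (Fin.cons x β : Fin (m + 1) → ℕ) f := by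
  suffices h : cf (Fin.snoc β x : Fin (m + 1) → ℕ) ∘ₗ (rot q).toLinearMap =
      q ^ x • cf (K := K) (Fin.cons x β : Fin (m + 1) → ℕ) from LinearMap.congr_fun h f
  refine linearMap_ext_mon fun μ => ?_
  rw [LinearMap.comp_apply, LinearMap.smul_apply, AlgHom.toLinearMap_apply, rot_mon, map_smul,
    cf_mon, cf_mon]
  simp only [snoc_eq_iff_cons, smul_eq_mul]
  split_ifs with h
  · rw [h, Fin.cons_zero]
  · simp

theorem rot_mem_notAbove (q : K) {κ : Fin (m + 1) → ℕ}
    {f : MvPolynomial (Fin (m + 1)) K} (hf : f ∈ notAbove K κ) : rot q f ∈ notAbove K κ := by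
  suffices h : notAbove K κ ≤ (notAbove K κ).comap (rot q).toLinearMap from h hf
  refine Submodule.span_le.2 ?_
  rintro _ ⟨μ, hμ, rfl⟩
  rw [SetLike.mem_coe, Submodule.mem_comap, AlgHom.toLinearMap_apply, rot_mon]
  refine Submodule.smul_mem _ _ (mon_mem_notAbove fun h => hμ ?_)
  have e : (Fin.snoc (fun k : Fin m => μ k.succ) (μ 0) : Fin (m + 1) → ℕ) =
      μ ∘ finRotate (m + 1) := by
    funext k
    refine Fin.lastCases ?_ (fun l => ?_) k
    · simp
    · rw [Fin.snoc_castSucc, Function.comp_apply, finRotate_apply, Fin.coeSucc_eq_succ]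
  rwa [e, domStrict_comp_right] at h

end HeckeMonomial

end

section

open MvPolynomial

section Stability

variable {m : ℕ} {K : Type*} [Field K] {q t : K} {κ : Fin (m + 1) → ℕ}
  {f : MvPolynomial (Fin (m + 1)) K}

theorem heckeN_mem (k : ℕ) (hf : f ∈ notAbove K κ) : heckeN m t k f ∈ notAbove K κ := by
  unfold heckeN
  split_ifs
  · exact hecke_mem_notAbove t _ hf
  · exact hf

theorem heckeInv_mem (k : ℕ) (hf : f ∈ notAbove K κ) : heckeInv m t k f ∈ notAbove K κ :=
  Submodule.smul_mem _ _ (Submodule.sub_mem _ (heckeN_mem k hf) (Submodule.smul_mem _ _ hf))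

theorem headInv_mem (k : ℕ) : ∀ {f : MvPolynomial (Fin (m + 1)) K}, f ∈ notAbove K κ →
    headInv m t k f ∈ notAbove K κ := by
  induction k with
  | zero => exact fun hf => hf
  | succ k ih => exact fun hf => ih (heckeInv_mem k hf)

theorem tail_mem {k : ℕ} (hk : k ≤ m) (hf : f ∈ notAbove K κ) : tail m t k f ∈ notAbove K κ := by
  obtain ⟨d, hd⟩ : ∃ d, m = k + d := ⟨m - k, by omega⟩
  induction d generalizing k with
  | zero =>
    have : k = m := by omega
    rw [this, tail_self]
    exact hf
  | succ d ih =>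
    rw [tail_of_lt t (by omega), Module.End.mul_apply]
    exact heckeN_mem k (ih (by omega) (by omega))

end Stability

section LeadingCoefficient

variable {m : ℕ} {K : Type*} [Field K] {q t : K}

/-- The tuple `β` with the entry `x` inserted in position `k`. -/
def ins (k : Fin (m + 1)) (x : ℕ) (β : Fin m → ℕ) : Fin (m + 1) → ℕ :=
  Fin.insertNth (α := fun _ => ℕ) k x β

theorem adj_succAbove (i j : Fin m) : adj i (i.succ.succAbove j) = i.castSucc.succAbove j := by
  unfold adj
  rw [Equiv.swap_apply_def]
  simp only [Fin.succAbove, Fin.lt_def, Fin.ext_iff, Fin.val_castSucc, Fin.val_succ]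
  split_ifs <;> simp only [Fin.val_castSucc, Fin.val_succ] at * <;> omega

theorem ins_comp_adj (i : Fin m) (x : ℕ) (β : Fin m → ℕ) :
    ins i.castSucc x β ∘ adj i = ins i.succ x β := by
  refine (Fin.eq_insertNth_iff (α := fun _ => ℕ)).2 ⟨?_, ?_⟩
  · rw [Function.comp_apply, adj_succ]
    exact Fin.insertNth_apply_same (α := fun _ => ℕ) _ _ _
  · funext j
    rw [Fin.removeNth, Function.comp_apply, adj_succAbove]
    exact Fin.insertNth_apply_succAbove (α := fun _ => ℕ) _ _ _ _

theorem ins_castSucc_castSucc (i : Fin m) (x : ℕ) (β : Fin m → ℕ) :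
    ins i.castSucc x β i.castSucc = x :=
  Fin.insertNth_apply_same (α := fun _ => ℕ) _ _ _

theorem ins_castSucc_succ (i : Fin m) (x : ℕ) (β : Fin m → ℕ) :
    ins i.castSucc x β i.succ = β i := by
  have h := Fin.insertNth_apply_succAbove (α := fun _ => ℕ) i.castSucc x β i
  rwa [Fin.succAbove_castSucc_self] at h

theorem notAbove_ins (k : Fin (m + 1)) (x : ℕ) (β : Fin m → ℕ) :
    notAbove K (ins k x β) = notAbove K (ins 0 x β) := by
  induction k using Fin.induction with
  | zero => rfl
  | succ i ih => rw [← ins_comp_adj, notAbove_comp, ih]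

theorem cf_tail {x : ℕ} {β : Fin m → ℕ} {k : ℕ} (hk : k < m + 1)
    (h : ∀ j : Fin m, k ≤ j → β j ≤ x) {f : MvPolynomial (Fin (m + 1)) K}
    (hf : f ∈ notAbove K (ins 0 x β)) :
    cf (ins ⟨k, hk⟩ x β) (tail m t k f) = t ^ (m - k) * cf (ins (Fin.last m) x β) f := by
  obtain ⟨d, hd⟩ : ∃ d, m = k + d := ⟨m - k, by omega⟩
  induction d generalizing k with
  | zero =>
    have hk' : k = m := by omega
    subst hk'
    simp only [tail_self, Module.End.one_apply, Nat.sub_self, pow_zero, one_mul]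
    rfl
  | succ d ih =>
    have hkm : k < m := by omega
    rw [tail_of_lt t hkm, Module.End.mul_apply, heckeN_of_lt t hkm]
    have h1 : (ins ⟨k, hk⟩ x β : Fin (m + 1) → ℕ) = ins (⟨k, hkm⟩ : Fin m).castSucc x β := rfl
    rw [h1, cf_hecke_of_le, ins_comp_adj]
    · have := ih (k := k + 1) (by omega) (fun j hj => h j (by omega)) (by omega)
      rw [Fin.succ_mk, this, ← mul_assoc, ← pow_succ', show m - (k + 1) + 1 = m - k by omega]
    · rw [ins_castSucc_castSucc, ins_castSucc_succ]
      exact h _ le_rfl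
    · rw [notAbove_ins]
      exact tail_mem (by omega) hf

theorem cf_heckeInv {k : ℕ} (hk : k < m) {ν : Fin (m + 1) → ℕ}
    (h : ν (⟨k, hk⟩ : Fin m).castSucc ≤ ν (⟨k, hk⟩ : Fin m).succ)
    {f : MvPolynomial (Fin (m + 1)) K} (hf : f ∈ notAbove K ν) :
    cf ν (heckeInv m t k f) = t⁻¹ * cf (ν ∘ adj ⟨k, hk⟩) f := by
  rw [heckeInv, LinearMap.smul_apply, LinearMap.sub_apply, LinearMap.smul_apply,
    Module.End.one_apply, heckeN_of_lt t hk, map_smul, map_sub, map_smul, smul_eq_mul, smul_eq_mul]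
  rcases h.lt_or_eq with h | h
  · rw [cf_hecke_of_lt t _ h hf, add_sub_cancel_right]
  · rw [cf_hecke_of_le t _ h.ge hf, comp_adj_of_eq h]
    ring

theorem cf_headInv {x : ℕ} {β : Fin m → ℕ} {k : ℕ} (hk : k < m + 1)
    (h : ∀ j : Fin m, (j : ℕ) < k → x ≤ β j) {f : MvPolynomial (Fin (m + 1)) K}
    (hf : f ∈ notAbove K (ins 0 x β)) :
    cf (ins 0 x β) (headInv m t k f) = (t ^ k)⁻¹ * cf (ins ⟨k, hk⟩ x β) f := by
  induction k generalizing f with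
  | zero => simp [headInv]
  | succ k ih =>
    have hkm : k < m := by omega
    rw [headInv, Module.End.mul_apply, ih (by omega) (fun j hj => h j (by omega))
      (heckeInv_mem k hf)]
    have h1 : (ins ⟨k, by omega⟩ x β : Fin (m + 1) → ℕ) =
      ins (⟨k, hkm⟩ : Fin m).castSucc x β := rfl
    rw [h1, cf_heckeInv hkm, ins_comp_adj, Fin.succ_mk, pow_succ, mul_inv, mul_assoc]
    · rw [ins_castSucc_castSucc, ins_castSucc_succ]
      exact h _ (by simp)
    · rwa [notAbove_ins]

theorem cf_cherednik (ht : t ≠ 0) {κ : Fin (m + 1) → ℕ} (hκ : Antitone κ)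
    {f : MvPolynomial (Fin (m + 1)) K} (hf : f ∈ notAbove K κ) (k : Fin (m + 1)) :
    cf κ (cherednik m q t k f) = spec q t κ k * cf κ f := by
  obtain ⟨β, hβ⟩ : ∃ β : Fin m → ℕ, β = fun j => κ (k.succAbove j) := ⟨_, rfl⟩
  have e : κ = ins k (κ k) β := (Fin.eq_insertNth_iff (α := fun _ => ℕ)).2 ⟨rfl, hβ.symm⟩
  have hf' : f ∈ notAbove K (ins 0 (κ k) β) := by rwa [← notAbove_ins k, ← e]
  have hm : ∀ g : MvPolynomial (Fin (m + 1)) K,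
      cf (ins (Fin.last m) (κ k) β) (rot q g) = q ^ κ k * cf (ins 0 (κ k) β) g := by
    intro g
    have h1 : ins (Fin.last m) (κ k) β = Fin.snoc β (κ k) := Fin.insertNth_last' _ _
    have h2 : ins 0 (κ k) β = Fin.cons (κ k) β := Fin.insertNth_zero' _ _
    rw [h1, h2, cf_rot]
  have hh : cf (ins k (κ k) β) (cherednik m q t k f) =
      spec q t κ k * cf (ins k (κ k) β) f := by
    rw [cherednik, LinearMap.smul_apply, Module.End.mul_apply, Module.End.mul_apply, map_smul,
      smul_eq_mul, omg_apply]
    have h1 := cf_tail (t := t) (x := κ k) (β := β) k.2 (fun j hj => ?_)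
      (rot_mem_notAbove q (headInv_mem (t := t) k hf'))
    · have h2 : (ins ⟨k, k.2⟩ (κ k) β : Fin (m + 1) → ℕ) = ins k (κ k) β := rfl
      rw [h2] at h1
      rw [h1, hm, cf_headInv k.2 (fun j hj => ?_) hf', spec, coleg_antitone hκ, h2]
      · have := pow_ne_zero k ht
        field_simp
        simp only [Nat.add_sub_cancel]
        ring
      · rw [hβ]
        refine hκ (le_of_lt ?_)
        rw [Fin.succAbove_of_castSucc_lt _ _ (by simpa [Fin.lt_def] using hj)]
        simpa [Fin.lt_def] using hj
    · rw [hβ]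
      refine hκ ?_
      rw [Fin.succAbove_of_le_castSucc _ _ (by simpa [Fin.le_def] using hj)]
      simp only [Fin.le_def, Fin.val_succ]
      omega
  rwa [← e] at hh

end LeadingCoefficient

section Intertwiner

variable {m : ℕ} {K : Type*} [Field K] {q t : K}

theorem heckeN_mul_cherednik (ht : t ≠ 0) {k : ℕ} (hk : k < m) :
    heckeN m t k * cherednik m q t k =
      cherednik m q t (k + 1) * heckeN m t k + (t - 1) • cherednik m q t k := by
  have h := congrArg (fun A => heckeN m t k * A) (heckeN_cherednik_heckeN (q := q) ht hk)
  simp only [← mul_assoc, heckeN_sq t hk, mul_smul_comm] at h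
  rw [add_mul, add_mul, smul_mul_assoc, smul_mul_assoc, smul_mul_assoc, smul_mul_assoc, one_mul,
    heckeN_cherednik_heckeN ht hk] at h
  refine smul_right_injective _ ht ?_
  simp only
  rw [← h, smul_add, smul_comm t (t - 1), add_comm ((t - 1) • t • _)]

theorem heckeN_mul_cherednik_succ (ht : t ≠ 0) {k : ℕ} (hk : k < m) :
    heckeN m t k * cherednik m q t (k + 1) =
      cherednik m q t k * heckeN m t k - (t - 1) • cherednik m q t k := by
  have h := congrArg (fun A => A * heckeN m t k) (heckeN_cherednik_heckeN (q := q) ht hk)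
  simp only [mul_assoc, heckeN_sq t hk, smul_mul_assoc] at h
  rw [mul_add, mul_add, mul_smul_comm, mul_smul_comm, mul_smul_comm, mul_smul_comm, mul_one,
    ← mul_assoc, heckeN_cherednik_heckeN ht hk] at h
  refine smul_right_injective _ ht ?_
  simp only
  rw [smul_sub, ← h, smul_comm, add_sub_cancel_left]

/-- The coefficient `c` for which `T_i + c` intertwines the weights of `η` and `s_i η`. -/
def shiftCoeff (q t : K) (η : Fin (m + 1) → ℕ) (i : Fin m) : K :=
  (1 - t) * spec q t η i.castSucc / (spec q t η i.castSucc - spec q t η i.succ)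

theorem shiftCoeff_mul (h : Admissible q t) (η : Fin (m + 1) → ℕ) (i : Fin m) :
    shiftCoeff q t η i * (spec q t η i.castSucc - spec q t η i.succ) =
      (1 - t) * spec q t η i.castSucc :=
  div_mul_cancel₀ _ (sub_ne_zero.2 fun e => castSucc_ne_succ i (spec_injective h η e))

/-- `f` is a joint eigenfunction of the Cherednik operators, with the eigenvalues of `η`. -/
def IsJoint (q t : K) (η : Fin (m + 1) → ℕ) (f : MvPolynomial (Fin (m + 1)) K) : Prop :=
  ∀ k : Fin (m + 1), cherednik m q t k f = spec q t η k • f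

theorem eq_or_eq_or_ne (i : Fin m) (k : Fin (m + 1)) :
    k = i.castSucc ∨ k = i.succ ∨ ((k : ℕ) ≠ i ∧ (k : ℕ) ≠ i + 1) := by
  simp only [Fin.ext_iff, Fin.val_castSucc, Fin.val_succ]
  omega

theorem adj_of_ne {i : Fin m} {k : Fin (m + 1)} (h : (k : ℕ) ≠ i ∧ (k : ℕ) ≠ i + 1) :
    adj i k = k :=
  Equiv.swap_apply_of_ne_of_ne (fun e => h.1 (by rw [e]; rfl)) (fun e => h.2 (by rw [e]; rfl))

theorem hecke_cherednik_castSucc (ht : t ≠ 0) (i : Fin m) (f : MvPolynomial (Fin (m + 1)) K) :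
    hecke t i (cherednik m q t i.castSucc f) =
      cherednik m q t i.succ (hecke t i f) + (t - 1) • cherednik m q t i.castSucc f := by
  have h := LinearMap.congr_fun (heckeN_mul_cherednik (q := q) ht i.2) f
  rwa [heckeN_fin] at h

theorem hecke_cherednik_succ (ht : t ≠ 0) (i : Fin m) (f : MvPolynomial (Fin (m + 1)) K) :
    hecke t i (cherednik m q t i.succ f) =
      cherednik m q t i.castSucc (hecke t i f) - (t - 1) • cherednik m q t i.castSucc f := by
  have h := LinearMap.congr_fun (heckeN_mul_cherednik_succ (q := q) ht i.2) f
  rwa [heckeN_fin] at h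

theorem hecke_cherednik_of_ne (ht : t ≠ 0) (i : Fin m) {k : Fin (m + 1)}
    (hk : (k : ℕ) ≠ i ∧ (k : ℕ) ≠ i + 1) (f : MvPolynomial (Fin (m + 1)) K) :
    hecke t i (cherednik m q t k f) = cherednik m q t k (hecke t i f) := by
  have h := LinearMap.congr_fun
    (heckeN_cherednik (q := q) ht i.2 (by omega : (k : ℕ) ≤ m) hk.1 hk.2) f
  rwa [heckeN_fin] at h

theorem cherednik_intertwine (h : Admissible q t) {η : Fin (m + 1) → ℕ} (i : Fin m)
    {f : MvPolynomial (Fin (m + 1)) K} (hf : IsJoint q t η f) (k : Fin (m + 1)) :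
    cherednik m q t k (hecke t i f + shiftCoeff q t η i • f) =
      spec q t η (adj i k) • (hecke t i f + shiftCoeff q t η i • f) := by
  have hc := shiftCoeff_mul h η i
  generalize shiftCoeff q t η i = c at hc
  rw [map_add, map_smul, hf k]
  rcases eq_or_eq_or_ne i k with rfl | rfl | hk
  · have h1 := hecke_cherednik_succ (q := q) h.t_ne i f
    rw [hf, hf, map_smul] at h1
    rw [adj_castSucc]
    simp only [smul_eq_C_mul, map_sub, C_1] at h1 ⊢
    have hc' := congrArg (C : K → MvPolynomial (Fin (m + 1)) K) hc
    simp only [map_mul, map_sub, C_1] at hc'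
    linear_combination (-1) * h1 + f * hc'
  · have h1 := hecke_cherednik_castSucc (q := q) h.t_ne i f
    rw [hf, map_smul] at h1
    rw [adj_succ]
    simp only [smul_eq_C_mul, map_sub, C_1] at h1 ⊢
    have hc' := congrArg (C : K → MvPolynomial (Fin (m + 1)) K) hc
    simp only [map_mul, map_sub, C_1] at hc'
    linear_combination (-1) * h1 - f * hc'
  · have h1 := hecke_cherednik_of_ne (q := q) h.t_ne i hk f
    rw [hf, map_smul] at h1
    rw [adj_of_ne hk, ← h1, smul_add, smul_comm]

theorem IsJoint.intertwine (h : Admissible q t) {η : Fin (m + 1) → ℕ} {i : Fin m}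
    (hi : η i.castSucc ≠ η i.succ) {f : MvPolynomial (Fin (m + 1)) K} (hf : IsJoint q t η f) :
    IsJoint q t (η ∘ adj i) (hecke t i f + shiftCoeff q t η i • f) := fun k => by
  rw [spec_adj hi, cherednik_intertwine h i hf]

theorem functional_intertwine (h : Admissible q t) {η : Fin (m + 1) → ℕ} {i : Fin m}
    (hi : η i.castSucc ≠ η i.succ) {S : Submodule K (MvPolynomial (Fin (m + 1)) K)}
    (hS : ∀ f ∈ S, hecke t i f ∈ S) {l : MvPolynomial (Fin (m + 1)) K →ₗ[K] K}
    (hl : ∀ f ∈ S, ∀ k : Fin (m + 1), l (cherednik m q t k f) = spec q t η k * l f) :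
    ∀ f ∈ S, ∀ k : Fin (m + 1),
      l (hecke t i (cherednik m q t k f) + shiftCoeff q t η i • cherednik m q t k f) =
        spec q t (η ∘ adj i) k * l (hecke t i f + shiftCoeff q t η i • f) := by
  intro f hf k
  have hc := shiftCoeff_mul h η i
  generalize shiftCoeff q t η i = c at hc
  rw [spec_adj hi, map_add, map_add, map_smul, map_smul, hl f hf, smul_eq_mul, smul_eq_mul]
  rcases eq_or_eq_or_ne i k with rfl | rfl | hk
  · rw [adj_castSucc, hecke_cherednik_castSucc h.t_ne, map_add, map_smul, hl _ (hS f hf), hl f hf,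
      smul_eq_mul]
    linear_combination l f * hc
  · rw [adj_succ, hecke_cherednik_succ h.t_ne, map_sub, map_smul, hl _ (hS f hf), hl f hf,
      smul_eq_mul]
    linear_combination (-l f) * hc
  · rw [adj_of_ne hk, hecke_cherednik_of_ne h.t_ne i hk, hl _ (hS f hf)]
    ring

end Intertwiner

section Functional

variable {m : ℕ} {K : Type*} [Field K] {q t : K}

theorem legSum_adj_le (η : Fin (m + 1) → ℕ) (i : Fin m) :
    legSum (η ∘ adj i) ≤ legSum η + 1 := by
  rcases lt_trichotomy (η i.castSucc) (η i.succ) with h | h | h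
  · have := legSum_adj (η := η ∘ adj i) (i := i) (by
      rw [Function.comp_apply, Function.comp_apply, adj_succ, adj_castSucc]; exact h)
    rw [comp_adj_adj] at this
    omega
  · rw [comp_adj_of_eq h]
    omega
  · rw [legSum_adj h]

theorem exists_functional (h : Admissible q t) (ν : Fin (m + 1) → ℕ) :
    ∃ l : MvPolynomial (Fin (m + 1)) K →ₗ[K] K,
      (∀ f ∈ notAbove K ν, ∀ k : Fin (m + 1),
        l (cherednik m q t k f) = spec q t ν k * l f) ∧
      ∃ a : K, a ≠ 0 ∧ ∀ f ∈ notAbove K ν,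
        (∀ σ : Equiv.Perm (Fin (m + 1)), legSum (ν ∘ σ) < legSum ν → cf (ν ∘ σ) f = 0) →
          l f = a * cf ν f := by
  obtain ⟨N, hN⟩ : ∃ N, N = legSum ν := ⟨_, rfl⟩
  induction N using Nat.strong_induction_on generalizing ν with
  | _ N ih =>
  by_cases hν : Antitone ν
  · exact ⟨cf ν, fun f hf k => cf_cherednik h.t_ne hν hf k, 1, one_ne_zero,
      fun f _ _ => (one_mul _).symm⟩
  rw [Fin.antitone_iff_succ_le] at hν
  push Not at hν
  obtain ⟨i, hi⟩ := hν
  obtain ⟨μ, rfl⟩ : ∃ μ, ν = μ ∘ adj i := ⟨ν ∘ adj i, (comp_adj_adj i ν).symm⟩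
  simp only [Function.comp_apply, adj_succ, adj_castSucc] at hi
  have hN' := legSum_adj hi
  obtain ⟨l, h1, a, ha, h2⟩ := ih (legSum μ) (by omega) μ rfl
  rw [notAbove_comp]
  refine ⟨l ∘ₗ (hecke t i + shiftCoeff q t μ i • 1),
    functional_intertwine h hi.ne' (fun f hf => hecke_mem_notAbove t i hf) h1, a * t,
    mul_ne_zero ha h.t_ne, fun f hf hf' => ?_⟩
  have hz : ∀ σ : Equiv.Perm (Fin (m + 1)), legSum (μ ∘ σ) < legSum μ + 1 →
      cf (μ ∘ σ) f = 0 := by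
    intro σ hσ
    have := hf' (adj i * σ)
    rw [Equiv.Perm.coe_mul, ← Function.comp_assoc, comp_adj_adj] at this
    exact this (by omega)
  have hg : l (hecke t i f + shiftCoeff q t μ i • f) =
      a * cf μ (hecke t i f + shiftCoeff q t μ i • f) := by
    refine h2 _ (Submodule.add_mem _ (hecke_mem_notAbove t i hf) (Submodule.smul_mem _ _ hf))
      fun σ hσ => ?_
    have e1 := hz σ (by omega)
    have e2 : cf (μ ∘ σ ∘ adj i) f = 0 := by
      refine hz (σ * adj i) (lt_of_le_of_lt (legSum_adj_le (μ ∘ σ) i) (by omega))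
    have hf2 : f ∈ notAbove K (μ ∘ σ) := by rwa [notAbove_comp]
    rw [map_add, map_smul, e1, smul_zero, add_zero]
    rcases le_or_gt ((μ ∘ σ) i.succ) ((μ ∘ σ) i.castSucc) with h3 | h3
    · rw [cf_hecke_of_le t i h3 hf2, Function.comp_assoc, e2, mul_zero]
    · rw [cf_hecke_of_lt t i h3 hf2, Function.comp_assoc, e2, e1, mul_zero, add_zero]
  have e3 : cf μ f = 0 := hz 1 (by simp)
  rw [LinearMap.comp_apply, LinearMap.add_apply, LinearMap.smul_apply, Module.End.one_apply, hg,
    map_add, map_smul, e3, smul_zero, add_zero, cf_hecke_of_le t i hi.le hf, mul_assoc]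

theorem spec_eq_of_extremal (h : Admissible q t) {y : Fin (m + 1) → K} {ν : Fin (m + 1) → ℕ}
    {f : MvPolynomial (Fin (m + 1)) K}
    (hf : ∀ k : Fin (m + 1), cherednik m q t k f = y k • f) (hν : cf ν f ≠ 0)
    (hmax : ∀ μ, cf μ f ≠ 0 → ¬ DomStrict ν μ)
    (hmin : ∀ σ : Equiv.Perm (Fin (m + 1)), legSum (ν ∘ σ) < legSum ν → cf (ν ∘ σ) f = 0)
    (k : Fin (m + 1)) : spec q t ν k = y k := by
  obtain ⟨l, h1, a, ha, h2⟩ := exists_functional h ν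
  have hm : f ∈ notAbove K ν := mem_span_mon hmax
  have h3 := h2 f hm hmin
  have h4 := h1 f hm k
  rw [hf k, map_smul, smul_eq_mul, h3] at h4
  exact (mul_right_cancel₀ (mul_ne_zero ha hν) h4).symm

theorem IsJoint.eq_of_extremal (h : Admissible q t) {η ν : Fin (m + 1) → ℕ}
    {f : MvPolynomial (Fin (m + 1)) K} (hf : IsJoint q t η f) (hν : cf ν f ≠ 0)
    (hmax : ∀ μ, cf μ f ≠ 0 → ¬ DomStrict ν μ)
    (hmin : ∀ σ : Equiv.Perm (Fin (m + 1)), legSum (ν ∘ σ) < legSum ν → cf (ν ∘ σ) f = 0) :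
    ν = η :=
  spec_separates h (spec_eq_of_extremal h hf hν hmax hmin)

theorem exists_maximal_supp (f : MvPolynomial (Fin (m + 1)) K) {μ : Fin (m + 1) → ℕ}
    (hμ : cf μ f ≠ 0) : ∃ ν, cf ν f ≠ 0 ∧ DomLE μ ν ∧ ∀ ρ, cf ρ f ≠ 0 → ¬ DomStrict ν ρ := by
  classical
  obtain ⟨ν, hν, hmax⟩ := Finset.exists_max_image ((supp f).filter fun ν => DomLE μ ν)
    (fun ν => ∑ i, ν i ^ 2) ⟨μ, Finset.mem_filter.2 ⟨mem_supp.2 hμ, DomLE.refl μ⟩⟩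
  rw [Finset.mem_filter, mem_supp] at hν
  refine ⟨ν, hν.1, hν.2, fun ρ hρ hs => absurd hs.2 (not_lt.2 (hmax ρ ?_))⟩
  exact Finset.mem_filter.2 ⟨mem_supp.2 hρ, hν.2.trans hs.1⟩

theorem exists_minimal_legSum (f : MvPolynomial (Fin (m + 1)) K) {ν : Fin (m + 1) → ℕ}
    (hν : cf ν f ≠ 0) : ∃ τ : Equiv.Perm (Fin (m + 1)), cf (ν ∘ τ) f ≠ 0 ∧
      ∀ σ : Equiv.Perm (Fin (m + 1)), cf (ν ∘ σ) f ≠ 0 → legSum (ν ∘ τ) ≤ legSum (ν ∘ σ) := by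
  classical
  obtain ⟨τ, hτ, hmin⟩ := Finset.exists_min_image
    (Finset.univ.filter fun σ : Equiv.Perm (Fin (m + 1)) => cf (ν ∘ σ) f ≠ 0)
    (fun σ => legSum (ν ∘ σ)) ⟨1, Finset.mem_filter.2 ⟨Finset.mem_univ _, hν⟩⟩
  exact ⟨τ, (Finset.mem_filter.1 hτ).2,
    fun σ hσ => hmin σ (Finset.mem_filter.2 ⟨Finset.mem_univ _, hσ⟩)⟩

theorem IsJoint.exists_perm (h : Admissible q t) {η ν : Fin (m + 1) → ℕ}
    {f : MvPolynomial (Fin (m + 1)) K} (hf : IsJoint q t η f) (hν : cf ν f ≠ 0)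
    (hmax : ∀ μ, cf μ f ≠ 0 → ¬ DomStrict ν μ) :
    cf η f ≠ 0 ∧ ∃ τ : Equiv.Perm (Fin (m + 1)), η = ν ∘ τ ∧
      ∀ σ : Equiv.Perm (Fin (m + 1)), cf (ν ∘ σ) f ≠ 0 → legSum η ≤ legSum (ν ∘ σ) := by
  obtain ⟨τ, h1, h2⟩ := exists_minimal_legSum f hν
  have e : ν ∘ τ = η := hf.eq_of_extremal h h1
    (fun μ hμ => by rw [domStrict_comp_left]; exact hmax μ hμ) fun σ hσ => by
      by_contra hne
      have := h2 (τ * σ) hne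
      rw [Equiv.Perm.coe_mul, ← Function.comp_assoc] at this
      omega
  rw [e] at h1 h2
  exact ⟨h1, τ, e.symm, h2⟩

theorem exists_cf_ne_zero {n : ℕ} {f : MvPolynomial (Fin n) K} (hf : f ≠ 0) :
    ∃ μ, cf μ f ≠ 0 := by
  by_contra h
  push Not at h
  exact hf (ext_cf fun μ => by rw [h μ, map_zero])

/-- The joint eigenvalues of the Cherednik operators are those of compositions. -/
theorem exists_spec_eq (h : Admissible q t) {y : Fin (m + 1) → K}
    {f : MvPolynomial (Fin (m + 1)) K}
    (hf : ∀ k : Fin (m + 1), cherednik m q t k f = y k • f) (h0 : f ≠ 0) :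
    ∃ ν, ∀ k, spec q t ν k = y k := by
  obtain ⟨μ, hμ⟩ := exists_cf_ne_zero h0
  obtain ⟨ν, h1, -, h3⟩ := exists_maximal_supp f hμ
  obtain ⟨τ, h4, h5⟩ := exists_minimal_legSum f h1
  refine ⟨ν ∘ τ, spec_eq_of_extremal h hf h4
    (fun μ hμ => by rw [domStrict_comp_left]; exact h3 μ hμ) fun σ hσ => ?_⟩
  by_contra hne
  have := h5 (τ * σ) hne
  rw [Equiv.Perm.coe_mul, ← Function.comp_assoc] at this
  omega

theorem IsJoint.domLE (h : Admissible q t) {η μ : Fin (m + 1) → ℕ}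
    {f : MvPolynomial (Fin (m + 1)) K} (hf : IsJoint q t η f) (hμ : cf μ f ≠ 0) : DomLE μ η := by
  obtain ⟨ν, h1, h2, h3⟩ := exists_maximal_supp f hμ
  obtain ⟨-, τ, rfl, -⟩ := hf.exists_perm h h1 h3
  rwa [domLE_comp_right]

theorem IsJoint.cf_ne_zero (h : Admissible q t) {η : Fin (m + 1) → ℕ}
    {f : MvPolynomial (Fin (m + 1)) K} (hf : IsJoint q t η f) (hf0 : f ≠ 0) : cf η f ≠ 0 := by
  obtain ⟨μ, hμ⟩ := exists_cf_ne_zero hf0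
  obtain ⟨ν, h1, -, h3⟩ := exists_maximal_supp f hμ
  exact (hf.exists_perm h h1 h3).1

theorem IsJoint.not_domStrict (h : Admissible q t) {η μ : Fin (m + 1) → ℕ}
    {f : MvPolynomial (Fin (m + 1)) K} (hf : IsJoint q t η f) (hμ : cf μ f ≠ 0) :
    ¬ DomStrict η μ := by
  obtain ⟨ν, h1, -, h3⟩ := exists_maximal_supp f hμ
  obtain ⟨-, τ, rfl, -⟩ := hf.exists_perm h h1 h3
  rw [domStrict_comp_left]
  exact h3 μ hμ

theorem IsJoint.legSum_lt (h : Admissible q t) {η : Fin (m + 1) → ℕ}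
    {f : MvPolynomial (Fin (m + 1)) K} (hf : IsJoint q t η f) {σ : Equiv.Perm (Fin (m + 1))}
    (hσ : cf (η ∘ σ) f ≠ 0) (hne : η ∘ σ ≠ η) : legSum η < legSum (η ∘ σ) := by
  have hm : ∀ μ, cf μ f ≠ 0 → ¬ DomStrict (η ∘ σ) μ := fun μ hμ => by
    rw [domStrict_comp_left]
    exact hf.not_domStrict h hμ
  obtain ⟨-, τ, e, h2⟩ := hf.exists_perm h hσ hm
  have h3 := h2 1 hσ
  refine lt_of_le_of_ne h3 fun h4 => hne ?_
  refine hf.eq_of_extremal h hσ hm fun ρ hρ => ?_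
  by_contra h5
  have := h2 ρ h5
  have h6 : legSum η = legSum (η ∘ σ) := h4
  omega

theorem IsJoint.eq_zero (h : Admissible q t) {η : Fin (m + 1) → ℕ}
    {f : MvPolynomial (Fin (m + 1)) K} (hf : IsJoint q t η f) (h0 : cf η f = 0) : f = 0 := by
  by_contra hne
  exact hf.cf_ne_zero h hne h0

theorem IsJoint.add_smul {η : Fin (m + 1) → ℕ} {f g : MvPolynomial (Fin (m + 1)) K}
    (hf : IsJoint q t η f) (hg : IsJoint q t η g) (c : K) : IsJoint q t η (f + c • g) := fun k => by
  rw [map_add, map_smul, hf k, hg k, smul_add, smul_comm]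

theorem IsJoint.eq_smul (h : Admissible q t) {η : Fin (m + 1) → ℕ}
    {f g : MvPolynomial (Fin (m + 1)) K} (hf : IsJoint q t η f) (hg : IsJoint q t η g)
    (h1 : cf η g = 1) : f = cf η f • g := by
  have := (hf.add_smul hg (-cf η f)).eq_zero h (by
    rw [map_add, map_smul, h1, smul_eq_mul]; ring)
  rw [neg_smul] at this
  exact eq_of_sub_eq_zero (by rw [sub_eq_add_neg]; exact this)

end Functional

end

section

open MvPolynomial

section Induction

variable {m : ℕ}

theorem leg_le (η : Fin (m + 1) → ℕ) (i : Fin (m + 1)) (j : ℕ) : leg η i j ≤ 2 * (m + 1) := by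
  have h1 := Finset.card_filter_le (Finset.univ : Finset (Fin (m + 1)))
    fun k => i < k ∧ j ≤ η k ∧ η k ≤ η i
  have h2 := Finset.card_filter_le (Finset.univ : Finset (Fin (m + 1)))
    fun k => k < i ∧ j ≤ η k + 1 ∧ η k + 1 ≤ η i
  rw [Finset.card_univ, Fintype.card_fin] at h1 h2
  unfold leg
  omega

theorem legSum_le (η : Fin (m + 1) → ℕ) : legSum η ≤ (∑ i, η i) * (2 * (m + 1)) := by
  rw [Finset.sum_mul]
  refine Finset.sum_le_sum fun i _ => ?_
  calc ∑ j ∈ Finset.Icc 1 (η i), leg η i j ≤ ∑ _j ∈ Finset.Icc 1 (η i), 2 * (m + 1) :=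
        Finset.sum_le_sum fun j _ => leg_le η i j
    _ = η i * (2 * (m + 1)) := by simp

theorem sum_raise (η : Fin (m + 1) → ℕ) : ∑ i, raise η i = ∑ i, η i + 1 := by
  rw [Fin.sum_univ_castSucc, Fin.sum_univ_succ]
  simp only [raise_castSucc, raise_last]
  ring

/-- Every composition arises from `0` by raising and by exchanging ascents. -/
theorem composition_induction {P : (Fin (m + 1) → ℕ) → Prop} (zero : P 0)
    (raise : ∀ η, P η → P (raise η))
    (adj : ∀ η (i : Fin m), η i.castSucc < η i.succ → P η → P (η ∘ adj i))
    (η : Fin (m + 1) → ℕ) : P η := by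
  obtain ⟨s, hs⟩ : ∃ s, s = ∑ i, η i := ⟨_, rfl⟩
  induction s generalizing η with
  | zero =>
    have h0 : η = 0 := by
      funext i
      have := (Finset.sum_eq_zero_iff.1 hs.symm) i (Finset.mem_univ i)
      simpa using this
    rw [h0]
    exact zero
  | succ s ih =>
    obtain ⟨d, hd⟩ : ∃ d, d = (s + 1) * (2 * (m + 1)) - legSum η := ⟨_, rfl⟩
    induction d using Nat.strong_induction_on generalizing η with
    | _ d ihd =>
    by_cases hm : Monotone η
    · have hlast : 0 < η (Fin.last m) := by
        by_contra hcon
        have : ∑ i, η i = 0 := Finset.sum_eq_zero fun i _ => by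
          have := hm (Fin.le_last i)
          omega
        omega
      obtain ⟨ν, rfl⟩ : ∃ ν, η = Macdonald.raise ν := by
        refine ⟨Fin.cons (η (Fin.last m) - 1) fun k => η k.castSucc, ?_⟩
        funext k
        refine Fin.lastCases ?_ (fun l => ?_) k
        · rw [raise_last, Fin.cons_zero]
          omega
        · rw [raise_castSucc, Fin.cons_succ]
      refine raise ν (ih ν ?_)
      rw [sum_raise] at hs
      omega
    · rw [Fin.monotone_iff_le_succ] at hm
      push Not at hm
      obtain ⟨i, hi⟩ := hm
      obtain ⟨ν, rfl⟩ : ∃ ν, η = ν ∘ Macdonald.adj i := ⟨η ∘ Macdonald.adj i,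
        (comp_adj_adj i η).symm⟩
      have h1 := legSum_adj hi
      rw [comp_adj_adj] at h1
      have h2 := legSum_le ν
      have h3 : ∑ k, ν k = s + 1 := by
        rw [hs]
        exact (sum_comp_perm (fun a => a) ν _).symm
      simp only [Function.comp_apply, adj_succ, adj_castSucc] at hi
      rw [h3] at h2
      exact adj ν i hi (ihd _ (by omega) ν h3.symm rfl)

end Induction

section Nonsymmetric

variable {m : ℕ} {K : Type*} [Field K] {q t : K}

theorem hecke_one (t : K) (i : Fin m) : hecke t i 1 = t • 1 := hecke_of_symm t i (map_one _)

theorem tail_one {k : ℕ} (hk : k ≤ m) :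
    tail m t k (1 : MvPolynomial (Fin (m + 1)) K) = t ^ (m - k) • 1 := by
  obtain ⟨d, hd⟩ : ∃ d, m = k + d := ⟨m - k, by omega⟩
  induction d generalizing k with
  | zero =>
    have : k = m := by omega
    subst this
    simp
  | succ d ih =>
    rw [tail_of_lt t (by omega), Module.End.mul_apply, ih (k := k + 1) (by omega) (by omega),
      map_smul, heckeN_of_lt t (by omega : k < m), hecke_one, smul_smul, ← pow_succ,
      show m - (k + 1) + 1 = m - k by omega]

theorem heckeInv_one {k : ℕ} (hk : k < m) :
    heckeInv m t k (1 : MvPolynomial (Fin (m + 1)) K) = t⁻¹ • 1 := by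
  rw [heckeInv, LinearMap.smul_apply, LinearMap.sub_apply, LinearMap.smul_apply,
    Module.End.one_apply, heckeN_of_lt t hk, hecke_one, ← sub_smul, sub_sub_cancel, one_smul]

theorem headInv_one {k : ℕ} (hk : k ≤ m) :
    headInv m t k (1 : MvPolynomial (Fin (m + 1)) K) = (t ^ k)⁻¹ • 1 := by
  induction k with
  | zero => simp [headInv]
  | succ k ih =>
    rw [headInv, Module.End.mul_apply, heckeInv_one hk, map_smul, ih (by omega), smul_smul,
      pow_succ', mul_inv]

theorem isJoint_one (ht : t ≠ 0) : IsJoint q t (0 : Fin (m + 1) → ℕ) 1 := fun k => by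
  have hk : (k : ℕ) ≤ m := by omega
  rw [cherednik, LinearMap.smul_apply, Module.End.mul_apply, Module.End.mul_apply,
    headInv_one hk, map_smul, omg_apply, map_one, map_smul, tail_one hk, smul_smul, smul_smul,
    spec, coleg_antitone (fun _ _ _ => le_rfl)]
  congr 1
  have := pow_ne_zero (k : ℕ) ht
  simp only [Pi.zero_apply, pow_zero, one_mul, Nat.add_sub_cancel]
  field_simp

theorem IsJoint.raise (h : Admissible q t) {η : Fin (m + 1) → ℕ}
    {f : MvPolynomial (Fin (m + 1)) K} (hf : IsJoint q t η f) :
    IsJoint q t (raise η) (raiseOp m q f) := by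
  intro k
  refine Fin.lastCases ?_ (fun l => ?_) k
  · have h1 := LinearMap.congr_fun (cherednik_last_raiseOp (m := m) (q := q) h.t_ne) f
    rw [Module.End.mul_apply, LinearMap.smul_apply, Module.End.mul_apply] at h1
    have h2 := hf 0
    rw [Fin.val_zero] at h2
    rw [Fin.val_last, h1, h2, map_smul, smul_smul, spec_raise_last]
  · have h1 := LinearMap.congr_fun (cherednik_raiseOp (m := m) (q := q) h.q_ne h.t_ne l.2) f
    rw [Module.End.mul_apply, Module.End.mul_apply] at h1
    have h2 := hf l.succ
    rw [Fin.val_succ] at h2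
    rw [Fin.val_castSucc, h1, h2, map_smul, spec_raise_castSucc]

theorem raise_injective : Function.Injective (raise (m := m)) := by
  intro η ν h
  funext k
  refine Fin.cases ?_ (fun l => ?_) k
  · simpa using congrFun h (Fin.last m)
  · simpa using congrFun h l.castSucc

theorem raiseOp_mon (q : K) (μ : Fin (m + 1) → ℕ) :
    raiseOp m q (mon K μ) = q ^ μ 0 • mon K (raise μ) := by
  rw [raiseOp, Module.End.mul_apply, mulX_apply, omg_apply, rot_mon, mul_smul_comm]
  congr 1
  unfold mon
  rw [Fin.prod_univ_castSucc, Fin.prod_univ_castSucc]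
  simp only [raise_castSucc, raise_last, Fin.snoc_castSucc, Fin.snoc_last]
  ring

theorem cf_raiseOp (q : K) (η : Fin (m + 1) → ℕ) (f : MvPolynomial (Fin (m + 1)) K) :
    cf (raise η) (raiseOp m q f) = q ^ η 0 * cf η f := by
  suffices h : cf (raise η) ∘ₗ raiseOp m q = q ^ η 0 • cf (K := K) η from LinearMap.congr_fun h f
  refine linearMap_ext_mon fun μ => ?_
  rw [LinearMap.comp_apply, LinearMap.smul_apply, raiseOp_mon, map_smul, cf_mon, cf_mon]
  simp only [raise_injective.eq_iff, smul_eq_mul]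
  split_ifs with h
  · rw [h]
  · simp

theorem IsJoint.mem_notAbove (h : Admissible q t) {η : Fin (m + 1) → ℕ}
    {f : MvPolynomial (Fin (m + 1)) K} (hf : IsJoint q t η f) : f ∈ notAbove K η :=
  mem_span_mon fun _ hμ => hf.not_domStrict h hμ

theorem IsJoint.cf_adj_eq_zero (h : Admissible q t) {η : Fin (m + 1) → ℕ} {i : Fin m}
    (hi : η i.castSucc < η i.succ) {f : MvPolynomial (Fin (m + 1)) K} (hf : IsJoint q t η f) :
    cf (η ∘ adj i) f = 0 := by
  by_contra hne
  have h1 : legSum ((η ∘ adj i) ∘ adj i) = legSum (η ∘ adj i) + 1 := legSum_adj (by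
    simpa only [Function.comp_apply, adj_succ, adj_castSucc] using hi)
  rw [comp_adj_adj] at h1
  have h2 := hf.legSum_lt h hne fun e => by
    have := congrFun e i.succ
    rw [Function.comp_apply, adj_succ] at this
    omega
  omega

theorem IsJoint.cf_intertwine (h : Admissible q t) {η : Fin (m + 1) → ℕ} {i : Fin m}
    (hi : η i.castSucc < η i.succ) {f : MvPolynomial (Fin (m + 1)) K} (hf : IsJoint q t η f) :
    cf (η ∘ adj i) (hecke t i f + shiftCoeff q t η i • f) = t * cf η f := by
  rw [map_add, map_smul, hf.cf_adj_eq_zero h hi, smul_zero, add_zero, cf_hecke_of_le,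
    comp_adj_adj]
  · simpa only [Function.comp_apply, adj_succ, adj_castSucc] using hi.le
  · rw [notAbove_comp]
    exact hf.mem_notAbove h

theorem exists_isJoint (h : Admissible q t) (η : Fin (m + 1) → ℕ) :
    ∃ f : MvPolynomial (Fin (m + 1)) K, IsJoint q t η f ∧ cf η f = 1 := by
  induction η using composition_induction with
  | zero =>
    refine ⟨1, isJoint_one h.t_ne, ?_⟩
    have : (1 : MvPolynomial (Fin (m + 1)) K) = mon K 0 := by simp [mon]
    rw [this, cf_mon_self]
  | raise η ih =>
    obtain ⟨f, hf, h1⟩ := ih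
    refine ⟨(q ^ η 0)⁻¹ • raiseOp m q f, fun k => ?_, ?_⟩
    · rw [map_smul, hf.raise h k, smul_comm]
    · rw [map_smul, cf_raiseOp, h1, mul_one, smul_eq_mul, inv_mul_cancel₀ (pow_ne_zero _ h.q_ne)]
  | adj η i hi ih =>
    obtain ⟨f, hf, h1⟩ := ih
    refine ⟨t⁻¹ • (hecke t i f + shiftCoeff q t η i • f), fun k => ?_, ?_⟩
    · rw [map_smul, hf.intertwine h hi.ne k, smul_comm]
    · rw [map_smul, hf.cf_intertwine h hi, h1, mul_one, smul_eq_mul, inv_mul_cancel₀ h.t_ne]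

open Classical in
/-- The nonsymmetric Macdonald polynomial `E_η(x;q,t)`. -/
def nonsymm (q t : K) (η : Fin (m + 1) → ℕ) : MvPolynomial (Fin (m + 1)) K :=
  if h : ∃ f : MvPolynomial (Fin (m + 1)) K, IsJoint q t η f ∧ cf η f = 1 then h.choose else 0

theorem isJoint_nonsymm (h : Admissible q t) (η : Fin (m + 1) → ℕ) :
    IsJoint q t η (nonsymm q t η) := by
  rw [nonsymm, dif_pos (exists_isJoint h η)]
  exact (exists_isJoint h η).choose_spec.1

theorem cf_nonsymm (h : Admissible q t) (η : Fin (m + 1) → ℕ) : cf η (nonsymm q t η) = 1 := by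
  rw [nonsymm, dif_pos (exists_isJoint h η)]
  exact (exists_isJoint h η).choose_spec.2

theorem IsJoint.eq_smul_nonsymm (h : Admissible q t) {η : Fin (m + 1) → ℕ}
    {f : MvPolynomial (Fin (m + 1)) K} (hf : IsJoint q t η f) : f = cf η f • nonsymm q t η :=
  hf.eq_smul h (isJoint_nonsymm h η) (cf_nonsymm h η)

theorem nonsymm_zero (h : Admissible q t) : nonsymm q t (0 : Fin (m + 1) → ℕ) = 1 := by
  have h1 := (isJoint_one (m := m) (q := q) h.t_ne).eq_smul_nonsymm h
  have : (1 : MvPolynomial (Fin (m + 1)) K) = mon K 0 := by simp [mon]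
  rw [h1, this, cf_mon_self, one_smul]

theorem raiseOp_nonsymm (h : Admissible q t) (η : Fin (m + 1) → ℕ) :
    raiseOp m q (nonsymm q t η) = q ^ η 0 • nonsymm q t (raise η) := by
  rw [((isJoint_nonsymm h η).raise h).eq_smul_nonsymm h, cf_raiseOp, cf_nonsymm h, mul_one]

theorem hecke_nonsymm_of_lt (h : Admissible q t) {η : Fin (m + 1) → ℕ} {i : Fin m}
    (hi : η i.castSucc < η i.succ) :
    hecke t i (nonsymm q t η) + shiftCoeff q t η i • nonsymm q t η =
      t • nonsymm q t (η ∘ adj i) := by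
  rw [((isJoint_nonsymm h η).intertwine h hi.ne).eq_smul_nonsymm h,
    (isJoint_nonsymm h η).cf_intertwine h hi, cf_nonsymm h, mul_one]

theorem hecke_nonsymm_of_eq (h : Admissible q t) {η : Fin (m + 1) → ℕ} {i : Fin m}
    (hi : η i.castSucc = η i.succ) : hecke t i (nonsymm q t η) = t • nonsymm q t η := by
  have hj := isJoint_nonsymm h η
  have h0 : hecke t i (nonsymm q t η) + shiftCoeff q t η i • nonsymm q t η = 0 := by
    by_contra hne
    obtain ⟨ν, hν⟩ := exists_spec_eq h (cherednik_intertwine h i hj) hne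
    obtain ⟨h1, h2⟩ := spec_separates_comp h hν
    rw [comp_adj_of_eq hi] at h1
    rw [h1] at h2
    have h3 := congrFun h2 i.succ
    rw [Function.comp_apply, adj_succ] at h3
    exact castSucc_ne_succ i (coleg_injective η h3).symm
  have h1 := congrArg (cf η) h0
  rw [map_add, map_smul, cf_hecke_of_le t i hi.ge (hj.mem_notAbove h), comp_adj_of_eq hi,
    cf_nonsymm h, map_zero, mul_one, smul_eq_mul, mul_one] at h1
  rw [eq_neg_of_add_eq_zero_right h1, neg_smul] at h0
  exact (sub_eq_add_neg _ _).trans h0 |> sub_eq_zero.1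

end Nonsymmetric

section Evaluation

variable {m : ℕ} {K : Type*} [Field K] {q t : K}

/-- Evaluation at `(1, t, …, t ^ (n - 1))`. -/
def evalT {n : ℕ} (t : K) : MvPolynomial (Fin n) K →+* K := eval fun i : Fin n => t ^ (i : ℕ)

theorem evalT_smul {n : ℕ} (c : K) (f : MvPolynomial (Fin n) K) :
    evalT t (c • f) = c * evalT t f := by
  simp [evalT, smul_eval]

theorem evalT_hecke (ht : t ≠ 0) (ht1 : t ≠ 1) (i : Fin m) (f : MvPolynomial (Fin (m + 1)) K) :
    evalT t (hecke t i f) = t * evalT t f := by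
  have h := congrArg (evalT t) (hecke_spec t i f)
  have hX : ∀ k : Fin (m + 1), evalT t (X k) = t ^ (k : ℕ) := fun k => by simp [evalT]
  have hC : ∀ c : K, evalT (n := m + 1) t (C c) = c := fun k => by simp [evalT]
  simp only [map_mul, map_sub, map_add, map_one, hX, hC, Fin.val_castSucc, Fin.val_succ] at h
  refine mul_left_cancel₀ (mul_ne_zero (pow_ne_zero i ht) (sub_ne_zero.2 ht1.symm)) ?_
  linear_combination h

theorem evalT_tail (ht : t ≠ 0) (ht1 : t ≠ 1) {k : ℕ} (hk : k ≤ m)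
    (f : MvPolynomial (Fin (m + 1)) K) : evalT t (tail m t k f) = t ^ (m - k) * evalT t f := by
  obtain ⟨d, hd⟩ : ∃ d, m = k + d := ⟨m - k, by omega⟩
  induction d generalizing k with
  | zero =>
    have : k = m := by omega
    subst this
    simp
  | succ d ih =>
    rw [tail_of_lt t (by omega), Module.End.mul_apply, heckeN_of_lt t (by omega : k < m),
      evalT_hecke ht ht1, ih (k := k + 1) (by omega) (by omega), ← mul_assoc, ← pow_succ',
      show m - (k + 1) + 1 = m - k by omega]

theorem shiftCoeff_of_lt (h : Admissible q t) {η : Fin (m + 1) → ℕ} {i : Fin m}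
    (hi : η i.castSucc < η i.succ) :
    shiftCoeff q t η i * (1 - q ^ (η i.succ - η i.castSucc) *
      t ^ (coleg η i.castSucc - coleg η i.succ)) = 1 - t := by
  have h1 : Prec η i.succ i.castSucc := by
    unfold Prec
    omega
  have h2 := shiftCoeff_mul h η i
  rw [spec_of_prec h1] at h2
  refine mul_left_cancel₀ (spec_ne_zero h η i.castSucc) ?_
  linear_combination h2

theorem evalT_nonsymm (h : Admissible q t) (η : Fin (m + 1) → ℕ) :
    evalT t (nonsymm q t η) = t ^ legSum η * (eConst q t η / dConst q t η) := by
  induction η using composition_induction with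
  | zero => simp [nonsymm_zero h, legSum, eConst, dConst]
  | raise η ih =>
    have h1 := congrArg (evalT t) (raiseOp_nonsymm h η)
    have h2 := congrArg (evalT t) (isJoint_nonsymm h η 0)
    rw [Fin.val_zero, cherednik, pow_zero, one_smul, headInv, mul_one, Module.End.mul_apply,
      evalT_tail h.t_ne h.t_ne_one (Nat.zero_le m), evalT_smul, omg_apply, ih] at h2
    rw [raiseOp, Module.End.mul_apply, mulX_apply, map_mul, evalT_smul, omg_apply] at h1
    have h3 : evalT t (X (Fin.last m) : MvPolynomial (Fin (m + 1)) K) = t ^ m := by simp [evalT]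
    rw [h3] at h1
    rw [Nat.sub_zero, h1, spec] at h2
    have h4 : (1 : K) - q ^ (η 0 + 1) * t ^ (m + 1 - coleg η 0) ≠ 0 :=
      h.one_sub_ne (Or.inl (Nat.succ_ne_zero _))
    have hd := dConst_ne_zero h η
    rw [eConst_raise, dConst_raise, legSum_raise, mul_div_mul_right _ _ h4, pow_add]
    refine mul_left_cancel₀ (pow_ne_zero (η 0) h.q_ne) ?_
    rw [h2, Nat.add_sub_cancel]
    ring
  | adj η i hi ih =>
    have h1 := congrArg (evalT t) (hecke_nonsymm_of_lt h hi)
    rw [map_add, evalT_hecke h.t_ne h.t_ne_one, evalT_smul, evalT_smul, ih] at h1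
    have hi' : (η ∘ adj i) i.succ < (η ∘ adj i) i.castSucc := by
      simpa only [Function.comp_apply, adj_succ, adj_castSucc] using hi
    have h2 := dConst_adj q t hi'
    have h3 := legSum_adj hi'
    have hne : η i.castSucc ≠ η i.succ := hi.ne
    rw [coleg_adj i hne, coleg_adj i hne, comp_adj_adj] at h2
    simp only [Function.comp_apply, adj_succ, adj_castSucc] at h2
    rw [comp_adj_adj] at h3
    have h4 := shiftCoeff_of_lt h hi
    have h5 := dConst_ne_zero h η
    have h6 := dConst_ne_zero h (η ∘ adj i)
    have h7 : (1 : K) - q ^ (η i.succ - η i.castSucc) *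
        t ^ (coleg η i.castSucc - coleg η i.succ) ≠ 0 := h.one_sub_ne (Or.inl (by omega))
    rw [eConst_adj q t hne.symm]
    refine mul_left_cancel₀ h.t_ne ?_
    rw [← h1, h3, pow_succ]
    rw [pow_succ, ← mul_assoc] at h2
    generalize q ^ (η i.succ - η i.castSucc) * t ^ (coleg η i.castSucc - coleg η i.succ) = r at *
    generalize shiftCoeff q t η i = c at *
    have h8 : (t + c) * dConst q t (η ∘ adj i) = dConst q t η := by
      refine mul_right_cancel₀ h7 ?_
      linear_combination dConst q t (η ∘ adj i) * h4 - h2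
    field_simp
    linear_combination (t * t ^ legSum (η ∘ adj i) * eConst q t η) * h8
end Evaluation

end

section

open MvPolynomial

section SymFactor

variable {m n : ℕ} {K : Type*} [Field K] {q t : K}

theorem symFactor_eq_prod (t : K) (y : Fin n → K) :
    symFactor t y = ∏ p : Fin n × Fin n,
      if p.1 < p.2 then (y p.2 - t * y p.1) / (y p.2 - y p.1) else 1 := by
  rw [Fintype.prod_prod_type, symFactor]
  refine Finset.prod_congr rfl fun i _ => ?_
  rw [← Finset.prod_filter]
  refine Finset.prod_congr ?_ fun _ _ => rfl
  ext j
  simp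

theorem symFactor_adj (t : K) (y : Fin (m + 1) → K) (i : Fin m) :
    symFactor t (y ∘ adj i) *
        ((y i.succ - t * y i.castSucc) / (y i.succ - y i.castSucc)) =
      symFactor t y * ((y i.castSucc - t * y i.succ) / (y i.castSucc - y i.succ)) := by
  rw [symFactor_eq_prod, symFactor_eq_prod,
    ← Equiv.prod_comp (Equiv.prodCongr (adj i) (adj i))]
  simp only [Equiv.prodCongr_apply, Prod.map_fst, Prod.map_snd, Function.comp_apply]
  have hs : ∀ k, adj i (adj i k) = k := fun k => by simp [adj]
  simp only [hs]
  have h1 : i.castSucc < i.succ := Fin.castSucc_lt_succ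
  have hne : ((i.succ, i.castSucc) : Fin (m + 1) × Fin (m + 1)) ∈
      Finset.univ.erase (i.castSucc, i.succ) :=
    Finset.mem_erase.2 ⟨fun h => h1.ne' (congrArg Prod.fst h), Finset.mem_univ _⟩
  rw [← Finset.mul_prod_erase _ _ (Finset.mem_univ (i.castSucc, i.succ)),
    ← Finset.mul_prod_erase _ _ hne,
    ← Finset.mul_prod_erase _ _ (Finset.mem_univ (i.castSucc, i.succ)),
    ← Finset.mul_prod_erase _ _ hne]
  have h2 : ∀ p ∈ (Finset.univ.erase (i.castSucc, i.succ)).erase (i.succ, i.castSucc),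
      (if adj i p.1 < adj i p.2 then (y p.2 - t * y p.1) / (y p.2 - y p.1) else 1) =
        if p.1 < p.2 then (y p.2 - t * y p.1) / (y p.2 - y p.1) else 1 := by
    rintro ⟨k, l⟩ hp
    simp only [Finset.mem_erase, ne_eq, Prod.mk.injEq] at hp
    simp only [adj_lt_iff i hp.2.1 hp.1]
  rw [Finset.prod_congr rfl h2]
  simp only [adj_castSucc, adj_succ, h1, not_lt_of_gt h1, if_true, if_false]
  ring

theorem symFactor_ne_zero {t : K} {y : Fin n → K} (hg : symFactor t y ≠ 0) {i j : Fin n}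
    (hij : i < j) : y j ≠ t * y i := by
  intro h
  refine hg (Finset.prod_eq_zero (Finset.mem_univ i) (Finset.prod_eq_zero
    (Finset.mem_Ioi.2 hij) ?_))
  rw [h, sub_self, zero_div]

theorem coleg_of_symFactor_ne_zero {κ : Fin n → ℕ} (hκ : Antitone κ)
    {w : Equiv.Perm (Fin n)} (hg : symFactor t (spec q t κ ∘ w) ≠ 0) (i : Fin n) :
    coleg (κ ∘ w) i = w i := by
  have hp : ∀ a b : Fin n, (b : ℕ) = a + 1 → Prec (κ ∘ w) (w.symm a) (w.symm b) := by
    intro a b hab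
    have hle : κ b ≤ κ a := hκ (by rw [Fin.le_def]; omega)
    have hne : a ≠ b := fun e => by rw [e] at hab; omega
    rcases hle.lt_or_eq with h1 | h1
    · unfold Prec
      simp only [Function.comp_apply, Equiv.apply_symm_apply]
      omega
    · have h2 : w.symm a < w.symm b := by
        by_contra h3
        have h4 : w.symm b < w.symm a :=
          lt_of_le_of_ne (not_lt.1 h3) fun e => hne (w.symm.injective e).symm
        refine symFactor_ne_zero hg h4 ?_
        simp only [Function.comp_apply, Equiv.apply_symm_apply, spec, coleg_antitone hκ]
        rw [h1, show n - 1 - (a : ℕ) = n - 1 - (b : ℕ) + 1 by have := b.2; omega]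
        ring
      unfold Prec
      simp only [Function.comp_apply, Equiv.apply_symm_apply]
      omega
  obtain _ | n := n
  · exact i.elim0
  let f : Fin (n + 1) → Fin (n + 1) := fun a => ⟨coleg (κ ∘ w) (w.symm a), coleg_lt _ _⟩
  have hf : StrictMono f := Fin.strictMono_iff_lt_succ.2 fun a =>
    prec_iff_coleg_lt.1 (hp a.castSucc a.succ (by simp))
  have hfs : Function.Surjective f := Finite.surjective_of_injective hf.injective
  have hid : f = id := by
    have := Subsingleton.elim (hf.orderIsoOfSurjective f hfs) (OrderIso.refl _)
    funext a
    exact congrArg (fun e : Fin (n + 1) ≃o Fin (n + 1) => e a) this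
  have := congrArg Fin.val (congrFun hid (w i))
  simpa [f] using this

theorem spec_comp_of_symFactor_ne_zero {κ : Fin n → ℕ} (hκ : Antitone κ)
    {w : Equiv.Perm (Fin n)} (hg : symFactor t (spec q t κ ∘ w) ≠ 0) :
    spec q t (κ ∘ w) = spec q t κ ∘ w := by
  funext i
  rw [Function.comp_apply, spec, spec, coleg_of_symFactor_ne_zero hκ hg, coleg_antitone hκ]
  rfl

end SymFactor

section Symmetrization

variable {m : ℕ} {K : Type*} [Field K] {q t : K}

theorem evalT_nonsymm_ne_zero (h : Admissible q t) (η : Fin (m + 1) → ℕ) :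
    evalT t (nonsymm q t η) ≠ 0 := by
  rw [evalT_nonsymm h]
  exact mul_ne_zero (pow_ne_zero _ h.t_ne) (div_ne_zero (eConst_ne_zero h η) (dConst_ne_zero h η))

/-- The summand that belongs to `w` of the symmetric combination of the `E_η`. -/
def symTerm (q t : K) (κ : Fin (m + 1) → ℕ) (w : Equiv.Perm (Fin (m + 1))) :
    MvPolynomial (Fin (m + 1)) K :=
  (symFactor t (spec q t κ ∘ w) / evalT t (nonsymm q t (κ ∘ w))) • nonsymm q t (κ ∘ w)

theorem hecke_symTerm_of_lt (h : Admissible q t) {κ : Fin (m + 1) → ℕ} (hκ : Antitone κ)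
    (w : Equiv.Perm (Fin (m + 1))) (i : Fin m)
    (hi : (κ ∘ w) i.castSucc < (κ ∘ w) i.succ) :
    hecke t i (symTerm q t κ w) - t • symTerm q t κ w +
      (hecke t i (symTerm q t κ (w * adj i)) - t • symTerm q t κ (w * adj i)) = 0 := by
  unfold symTerm
  rw [Equiv.Perm.coe_mul, ← Function.comp_assoc, ← Function.comp_assoc]
  have hE := hecke_nonsymm_of_lt h hi
  have hv := congrArg (evalT t) hE
  rw [map_add, evalT_hecke h.t_ne h.t_ne_one, evalT_smul, evalT_smul, ← add_mul] at hv
  have hTE := LinearMap.congr_fun (hecke_sq t i) (nonsymm q t (κ ∘ w))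
  have hv0 := evalT_nonsymm_ne_zero h (κ ∘ w)
  have hv1 := evalT_nonsymm_ne_zero h ((κ ∘ w) ∘ adj i)
  have hc := shiftCoeff_mul h (κ ∘ w) i
  have hsub : spec q t (κ ∘ w) i.castSucc - spec q t (κ ∘ w) i.succ ≠ 0 :=
    sub_ne_zero.2 fun e => castSucc_ne_succ i (spec_injective h _ e)
  have hg : symFactor t ((spec q t κ ∘ w) ∘ adj i) * (1 - shiftCoeff q t (κ ∘ w) i) =
      (t + shiftCoeff q t (κ ∘ w) i) * symFactor t (spec q t κ ∘ w) := by
    by_cases h0 : symFactor t (spec q t κ ∘ w) = 0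
    · by_cases h1 : symFactor t ((spec q t κ ∘ w) ∘ adj i) = 0
      · rw [h0, h1, zero_mul, mul_zero]
      · exfalso
        have h2 := spec_comp_of_symFactor_ne_zero (w := w * adj i) hκ h1
        rw [Equiv.Perm.coe_mul, ← Function.comp_assoc, ← Function.comp_assoc] at h2
        have h3 : spec q t (κ ∘ w) = spec q t κ ∘ w := by
          funext k
          have := congrFun h2 (adj i k)
          rw [spec_adj hi.ne] at this
          simpa [adj] using this
        have h4 := symFactor_adj t (spec q t (κ ∘ w)) i
        rw [h3, h0, zero_mul, ← h3] at h4
        have h5 : (spec q t (κ ∘ w) i.succ - t * spec q t (κ ∘ w) i.castSucc) ≠ 0 := by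
          intro h5
          have hp : Prec (κ ∘ w) i.succ i.castSucc := by
            unfold Prec
            omega
          have h6 := prec_iff_coleg_lt.1 hp
          rw [spec_of_prec hp] at h5
          have h7 := spec_ne_zero h (κ ∘ w) i.castSucc
          have h8 : q ^ ((κ ∘ w) i.succ - (κ ∘ w) i.castSucc) *
              t ^ (coleg (κ ∘ w) i.castSucc - coleg (κ ∘ w) i.succ) = t :=
            mul_right_cancel₀ h7 (sub_eq_zero.1 h5)
          obtain ⟨b, hb⟩ := Nat.exists_eq_add_of_lt h6
          rw [show coleg (κ ∘ w) i.castSucc - coleg (κ ∘ w) i.succ = b + 1 by omega, pow_succ,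
            ← mul_assoc] at h8
          have h9 := mul_right_cancel₀ h.t_ne (h8.trans (one_mul t).symm)
          have := (h.pow_eq_one _ _ h9).1
          omega
        rcases mul_eq_zero.1 h4 with h6 | h6
        · rw [h3] at h6
          exact h1 h6
        · rcases div_eq_zero_iff.1 h6 with h7 | h7
          · exact h5 h7
          · exact hsub (by rw [← neg_sub, h7, neg_zero])
    · have h3 := spec_comp_of_symFactor_ne_zero hκ h0
      have h4 := symFactor_adj t (spec q t (κ ∘ w)) i
      rw [← h3]
      generalize spec q t (κ ∘ w) i.castSucc = a at *
      generalize spec q t (κ ∘ w) i.succ = b at *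
      generalize shiftCoeff q t (κ ∘ w) i = c at *
      have e1 : 1 - c = (b - t * a) / (b - a) := by
        rw [eq_div_iff (by rwa [← neg_sub, neg_ne_zero])]
        linear_combination hc
      have e2 : t + c = (a - t * b) / (a - b) := by
        rw [eq_div_iff hsub]
        linear_combination hc
      rw [e1, e2, h4, mul_comm]
  have hE' : hecke t i (nonsymm q t (κ ∘ w)) = t • nonsymm q t ((κ ∘ w) ∘ adj i) -
      shiftCoeff q t (κ ∘ w) i • nonsymm q t (κ ∘ w) := eq_sub_of_add_eq hE
  rw [Module.End.mul_apply, LinearMap.add_apply, LinearMap.smul_apply, LinearMap.smul_apply,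
    Module.End.one_apply, hE', map_sub, map_smul, map_smul, hE'] at hTE
  rw [map_smul, map_smul, hE']
  generalize hecke t i (nonsymm q t ((κ ∘ w) ∘ adj i)) = F' at *
  generalize evalT t (nonsymm q t (κ ∘ w)) = v at *
  generalize evalT t (nonsymm q t ((κ ∘ w) ∘ adj i)) = v' at *
  generalize nonsymm q t (κ ∘ w) = E at *
  generalize nonsymm q t ((κ ∘ w) ∘ adj i) = E' at *
  generalize shiftCoeff q t (κ ∘ w) i = c at *
  generalize symFactor t (spec q t κ ∘ w) = g at *
  generalize symFactor t ((spec q t κ ∘ w) ∘ adj i) = g' at *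
  have hF : F' = t⁻¹ • ((c + t - 1) • t • E' + ((t + c) * (1 - c)) • E) := by
    rw [eq_inv_smul_iff₀ h.t_ne]
    simp only [smul_eq_C_mul, map_sub, map_add, map_mul, C_1] at hTE ⊢
    linear_combination hTE
  have hr : g / v = t⁻¹ * (1 - c) * (g' / v') := by
    have ht := h.t_ne
    field_simp
    refine mul_left_cancel₀ hv0 ?_
    linear_combination (-v) * g * hv - v * v * hg
  rw [hr, hF]
  have htt : (C t * C t⁻¹ : MvPolynomial (Fin (m + 1)) K) = 1 := by
    rw [← map_mul, mul_inv_cancel₀ h.t_ne, map_one]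
  simp only [smul_eq_C_mul, map_sub, map_add, map_mul, C_1]
  generalize (C (g' / v') : MvPolynomial (Fin (m + 1)) K) = B
  generalize (C t⁻¹ : MvPolynomial (Fin (m + 1)) K) = u at *
  linear_combination (B * E' * C t) * htt

theorem hecke_symTerm (h : Admissible q t) {κ : Fin (m + 1) → ℕ} (hκ : Antitone κ)
    (w : Equiv.Perm (Fin (m + 1))) (i : Fin m) :
    hecke t i (symTerm q t κ w) - t • symTerm q t κ w +
      (hecke t i (symTerm q t κ (w * adj i)) - t • symTerm q t κ (w * adj i)) = 0 := by
  have hww : w * adj i * adj i = w := by rw [mul_assoc, Equiv.swap_mul_self, mul_one]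
  rcases lt_trichotomy ((κ ∘ w) i.castSucc) ((κ ∘ w) i.succ) with hi | hi | hi
  · exact hecke_symTerm_of_lt h hκ w i hi
  · have h1 := hecke_nonsymm_of_eq h hi
    have h2 : κ ∘ ⇑(w * adj i) = κ ∘ w := by
      rw [Equiv.Perm.coe_mul, ← Function.comp_assoc, comp_adj_of_eq hi]
    unfold symTerm
    rw [h2, map_smul, map_smul, h1, smul_comm, sub_self, zero_add, smul_comm, sub_self]
  · have h1 := hecke_symTerm_of_lt h hκ (w * adj i) i (by
      simpa only [Equiv.Perm.coe_mul, Function.comp_apply, adj_castSucc, adj_succ] using hi)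
    rw [hww] at h1
    exact (add_comm _ _).trans h1

/-- The symmetric combination of the `E_η` with `η` a rearrangement of `κ`. -/
def symSum (q t : K) (κ : Fin (m + 1) → ℕ) : MvPolynomial (Fin (m + 1)) K :=
  ∑ w : Equiv.Perm (Fin (m + 1)), symTerm q t κ w

theorem hecke_symSum (h : Admissible q t) {κ : Fin (m + 1) → ℕ} (hκ : Antitone κ) (i : Fin m) :
    hecke t i (symSum q t κ) = t • symSum q t κ := by
  rw [← sub_eq_zero, symSum, map_sum, Finset.smul_sum, ← Finset.sum_sub_distrib]
  refine Finset.sum_involution (fun w _ => w * adj i) (fun w _ => hecke_symTerm h hκ w i)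
    (fun w _ _ e => ?_) (fun _ _ => Finset.mem_univ _) fun w _ => ?_
  · have h1 : adj i = 1 := mul_left_cancel (e.trans (mul_one w).symm)
    have h2 := congrArg (fun σ : Equiv.Perm (Fin (m + 1)) => σ i.castSucc) h1
    simp only [adj_castSucc, Equiv.Perm.coe_one, id_eq] at h2
    exact castSucc_ne_succ i h2.symm
  · rw [mul_assoc, Equiv.swap_mul_self, mul_one]

theorem isSymmetric_of_hecke {f : MvPolynomial (Fin (m + 1)) K}
    (hf : ∀ i : Fin m, hecke t i f = t • f) (σ : Equiv.Perm (Fin (m + 1))) :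
    rename σ f = f := by
  have hσ : σ ∈ Submonoid.closure (Set.range fun i : Fin m => Equiv.swap i.castSucc i.succ) := by
    rw [Equiv.Perm.mclosure_swap_castSucc_succ]
    exact Submonoid.mem_top σ
  induction hσ using Submonoid.closure_induction with
  | mem _ hx =>
    obtain ⟨i, rfl⟩ := hx
    exact symm_of_hecke (hf i)
  | one => exact rename_id_apply f
  | mul x y _ _ hx hy =>
    rw [Equiv.Perm.coe_mul, ← rename_rename, hy, hx]

theorem evalT_symSum (h : Admissible q t) (κ : Fin (m + 1) → ℕ) :
    evalT t (symSum q t κ) = bracketFactorial t (m + 1) := by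
  rw [symSum, map_sum, ← sum_symFactor t h.t_ne_one (spec q t κ) (spec_injective h κ)
    (spec_ne_zero h κ)]
  refine Finset.sum_congr rfl fun w _ => ?_
  rw [symTerm, evalT_smul, div_mul_cancel₀ _ (evalT_nonsymm_ne_zero h _)]

theorem cf_nonsymm_of_antitone (h : Admissible q t) {κ : Fin (m + 1) → ℕ} (hκ : Antitone κ)
    {w : Equiv.Perm (Fin (m + 1))} (hw : κ ∘ w ≠ κ) : cf κ (nonsymm q t (κ ∘ w)) = 0 := by
  have hj := isJoint_nonsymm h (κ ∘ w)
  have hm := hj.mem_notAbove h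
  rw [notAbove_comp] at hm
  by_contra hne
  refine hw (spec_separates h fun k => ?_)
  have h1 := cf_cherednik (q := q) h.t_ne hκ hm k
  rw [hj k, map_smul, smul_eq_mul] at h1
  exact mul_right_cancel₀ hne h1

theorem cf_symSum (h : Admissible q t) {κ : Fin (m + 1) → ℕ} (hκ : Antitone κ) :
    cf κ (symSum q t κ) = symFactor t (spec q t κ) / evalT t (nonsymm q t κ) := by
  rw [symSum, map_sum, Finset.sum_eq_single 1]
  · rw [symTerm, map_smul]
    simp only [Equiv.Perm.coe_one, Function.comp_id]
    rw [cf_nonsymm h, smul_eq_mul, mul_one]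
  · intro w _ hw
    rw [symTerm, map_smul]
    by_cases h1 : κ ∘ w = κ
    · have h0 : symFactor t (spec q t κ ∘ w) = 0 := by
        by_contra h2
        refine hw ?_
        have h3 := spec_comp_of_symFactor_ne_zero hκ h2
        rw [h1] at h3
        refine Equiv.ext fun i => ?_
        exact (spec_injective h κ (congrFun h3 i)).symm
      rw [h0, zero_div, zero_smul]
    · rw [cf_nonsymm_of_antitone h hκ h1, smul_zero]
  · exact fun h1 => absurd (Finset.mem_univ _) h1

/-- The symmetric Macdonald polynomial, constructed from the nonsymmetric ones. -/
def symP (q t : K) (κ : Fin (m + 1) → ℕ) : MvPolynomial (Fin (m + 1)) K :=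
  (evalT t (nonsymm q t κ) / symFactor t (spec q t κ)) • symSum q t κ

theorem hecke_symP (h : Admissible q t) {κ : Fin (m + 1) → ℕ} (hκ : Antitone κ) (i : Fin m) :
    hecke t i (symP q t κ) = t • symP q t κ := by
  rw [symP, map_smul, hecke_symSum h hκ, smul_comm]

theorem rename_symP (h : Admissible q t) {κ : Fin (m + 1) → ℕ} (hκ : Antitone κ)
    (σ : Equiv.Perm (Fin (m + 1))) : rename σ (symP q t κ) = symP q t κ :=
  isSymmetric_of_hecke (hecke_symP h hκ) σ

theorem cf_symP (h : Admissible q t) {κ : Fin (m + 1) → ℕ} (hκ : Antitone κ) :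
    cf κ (symP q t κ) = 1 := by
  rw [symP, map_smul, cf_symSum h hκ, smul_eq_mul]
  have h1 := evalT_nonsymm_ne_zero h κ
  have h2 := symFactor_spec_ne_zero h hκ
  field_simp

theorem evalT_symP (h : Admissible q t) {κ : Fin (m + 1) → ℕ} (hκ : Antitone κ) :
    evalT t (symP q t κ) = t ^ legSum κ * (bConst q t κ / hConst q t κ) := by
  rw [symP, evalT_smul, evalT_symSum h, evalT_nonsymm h, ← bracketFactorial_div_symFactor h hκ]
  ring

theorem domLE_of_cf_symP (h : Admissible q t) {κ μ : Fin (m + 1) → ℕ}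
    (hμ : cf μ (symP q t κ) ≠ 0) : DomLE μ κ := by
  rw [symP, map_smul, smul_eq_mul, symSum, map_sum] at hμ
  obtain ⟨w, -, hw⟩ := Finset.exists_ne_zero_of_sum_ne_zero (right_ne_zero_of_mul hμ)
  rw [symTerm, map_smul, smul_eq_mul] at hw
  have := (isJoint_nonsymm h (κ ∘ w)).domLE h (right_ne_zero_of_mul hw)
  rwa [domLE_comp_right] at this

theorem sum_cherednik_symP (h : Admissible q t) {κ : Fin (m + 1) → ℕ} (hκ : Antitone κ) :
    ∑ k : Fin (m + 1), cherednik m q t k (symP q t κ) =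
      (∑ k, spec q t κ k) • symP q t κ := by
  simp only [symP, map_smul]
  rw [← Finset.smul_sum, smul_comm]
  congr 1
  simp only [symSum, map_sum]
  rw [Finset.sum_comm, Finset.smul_sum]
  refine Finset.sum_congr rfl fun w _ => ?_
  simp only [symTerm, map_smul, isJoint_nonsymm h (κ ∘ w) _]
  rw [← Finset.smul_sum, ← Finset.sum_smul]
  by_cases h0 : symFactor t (spec q t κ ∘ w) = 0
  · rw [h0, zero_div, zero_smul, zero_smul, smul_zero]
  · rw [spec_comp_of_symFactor_ne_zero hκ h0, smul_comm]
    congr 1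
    exact Equiv.sum_comp w (spec q t κ)

end Symmetrization

end

section

open MvPolynomial

section Operator

variable {m : ℕ} {K : Type*} [Field K] {q t : K}

/-- The factor `(t x_i - x_j) / (x_i - x_j)`. -/
def opFactor (t : K) (i j : Fin (m + 1)) : RatFun (m + 1) K :=
  (algebraMap K _ t * ratX K i - ratX K j) / (ratX K i - ratX K j)

theorem permRat_opFactor (σ : Equiv.Perm (Fin (m + 1))) (t : K) (i j : Fin (m + 1)) :
    permRat σ (opFactor t i j) = opFactor t (σ i) (σ j) := by
  simp [opFactor]

theorem rename_qShift (σ : Equiv.Perm (Fin (m + 1))) (q : K) (i : Fin (m + 1))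
    (f : MvPolynomial (Fin (m + 1)) K) :
    rename σ (qShift q i f) = qShift q (σ i) (rename σ f) := by
  suffices h : (rename σ).comp (qShift q i) = (qShift q (σ i)).comp (rename (R := K) σ) from
    AlgHom.congr_fun h f
  ext1 k
  simp only [AlgHom.comp_apply, rename_X, qShift, aeval_X]
  by_cases hk : k = i
  · simp [hk]
  · simp [hk]

/-- The shifted polynomial `τ_i f` as a rational function. -/
def shifted (q : K) (f : MvPolynomial (Fin (m + 1)) K) (i : Fin (m + 1)) : RatFun (m + 1) K :=
  algebraMap _ _ (qShift q i f)

theorem permRat_shifted {f : MvPolynomial (Fin (m + 1)) K}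
    (hf : ∀ σ : Equiv.Perm (Fin (m + 1)), rename σ f = f) (σ : Equiv.Perm (Fin (m + 1)))
    (i : Fin (m + 1)) : permRat σ (shifted q f i) = shifted q f (σ i) := by
  rw [shifted, permRat_algebraMap, rename_qShift, hf, shifted]

theorem rot_of_symm {f : MvPolynomial (Fin (m + 1)) K}
    (hf : ∀ σ : Equiv.Perm (Fin (m + 1)), rename σ f = f) :
    rot q f = qShift q (Fin.last m) f := by
  have h : rot q = (qShift q (Fin.last m)).comp (rename (R := K) (finRotate (m + 1)).symm) := by
    ext1 k
    rw [AlgHom.comp_apply, rename_X, qShift, aeval_X]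
    refine Fin.cases ?_ (fun l => ?_) k
    · have : (finRotate (m + 1)).symm 0 = Fin.last m := by
        rw [Equiv.symm_apply_eq, finRotate_last]
      rw [rot_X_zero, this, if_pos rfl]
    · have : (finRotate (m + 1)).symm l.succ = l.castSucc := by
        rw [Equiv.symm_apply_eq, finRotate_apply, Fin.coeSucc_eq_succ]
      rw [rot_X_succ, this, if_neg (Fin.castSucc_lt_last l).ne]
  rw [h, AlgHom.comp_apply, hf]

theorem opFactor_exchange (t : K) {a b c : Fin (m + 1)} (hab : a ≠ b) (hac : a ≠ c)
    (hbc : b ≠ c) :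
    ((1 - algebraMap K (RatFun (m + 1) K) t) * ratX K b *
        ((algebraMap K _ t - 1) * ratX K c / (ratX K c - ratX K b)) +
      (algebraMap K _ t * ratX K a - ratX K b) *
        ((algebraMap K _ t - 1) * ratX K c / (ratX K c - ratX K a))) /
        (ratX K a - ratX K b) =
      (algebraMap K _ t - 1) * ratX K c / (ratX K c - ratX K a) * opFactor t c b := by
  have h1 := ratX_sub_ne_zero (K := K) hab
  have h2 := ratX_sub_ne_zero (K := K) hac.symm
  have h3 := ratX_sub_ne_zero (K := K) hbc.symm
  unfold opFactor
  field_simp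
  ring

/-- The image of `τ_n f` under `T_k ⋯ T_{n-1}`, for symmetric `f`. -/
def tailShift (q t : K) (f : MvPolynomial (Fin (m + 1)) K) (k : Fin (m + 1)) :
    RatFun (m + 1) K :=
  (∏ j ∈ Finset.Ioi k, opFactor t k j) * shifted q f k +
    ∑ i ∈ Finset.Ioi k, (algebraMap K _ t - 1) * ratX K i / (ratX K i - ratX K k) *
      (∏ j ∈ (Finset.Ioi k).erase i, opFactor t i j) * shifted q f i

theorem Ioi_castSucc (i : Fin m) :
    Finset.Ioi i.castSucc = insert i.succ (Finset.Ioi i.succ) := by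
  ext j
  simp only [Finset.mem_Ioi, Finset.mem_insert, Fin.lt_def, Fin.ext_iff, Fin.val_castSucc,
    Fin.val_succ]
  omega

theorem adj_of_mem_Ioi {i : Fin m} {j : Fin (m + 1)} (hj : j ∈ Finset.Ioi i.succ) :
    adj i j = j := by
  refine adj_of_ne ?_
  simp only [Finset.mem_Ioi, Fin.lt_def, Fin.val_succ] at hj
  omega

theorem algebraMap_tail {f : MvPolynomial (Fin (m + 1)) K}
    (hf : ∀ σ : Equiv.Perm (Fin (m + 1)), rename σ f = f) (k : Fin (m + 1)) :
    algebraMap _ (RatFun (m + 1) K) (tail m t k (qShift q (Fin.last m) f)) =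
      tailShift q t f k := by
  induction k using Fin.reverseInduction with
  | last =>
    have hl : Finset.Ioi (Fin.last m) = ∅ := by
      ext j
      simp [Fin.le_last]
    simp [tailShift, shifted, hl]
  | cast i ih =>
    have hi : ((i.castSucc : Fin (m + 1)) : ℕ) < m := i.2
    rw [tail_of_lt t hi, Module.End.mul_apply, heckeN_of_lt t hi]
    rw [Fin.val_succ] at ih
    have e : (⟨((i.castSucc : Fin (m + 1)) : ℕ), hi⟩ : Fin m) = i := rfl
    rw [e, algebraMap_hecke, Fin.val_castSucc, ih]
    have hS : permRat (adj i) (tailShift q t f i.succ) =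
        (∏ j ∈ Finset.Ioi i.succ, opFactor t i.castSucc j) * shifted q f i.castSucc +
        ∑ l ∈ Finset.Ioi i.succ, (algebraMap K _ t - 1) * ratX K l /
          (ratX K l - ratX K i.castSucc) *
          (∏ j ∈ (Finset.Ioi i.succ).erase l, opFactor t l j) * shifted q f l := by
      rw [tailShift, map_add, map_mul, map_prod, map_sum, permRat_shifted hf, adj_succ]
      congr 1
      · congr 1
        refine Finset.prod_congr rfl fun j hj => ?_
        rw [permRat_opFactor, adj_succ, adj_of_mem_Ioi hj]
      · refine Finset.sum_congr rfl fun l hl => ?_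
        rw [map_mul, map_mul, map_prod, map_div₀, map_mul, map_sub, map_sub, permRat_C, map_one,
          permRat_ratX, permRat_ratX, adj_of_mem_Ioi hl, adj_succ, permRat_shifted hf,
          adj_of_mem_Ioi hl]
        congr 2
        refine Finset.prod_congr rfl fun j hj => ?_
        rw [permRat_opFactor, adj_of_mem_Ioi hl, adj_of_mem_Ioi (Finset.mem_of_mem_erase hj)]
    rw [hS]
    have hnot : i.succ ∉ Finset.Ioi i.succ := by simp
    rw [tailShift, tailShift, Ioi_castSucc, Finset.prod_insert hnot, Finset.sum_insert hnot,
      Finset.erase_insert hnot]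
    have hsum : ∀ l ∈ Finset.Ioi i.succ,
        (algebraMap K (RatFun (m + 1) K) t - 1) * ratX K l / (ratX K l - ratX K i.castSucc) *
          (∏ j ∈ (insert i.succ (Finset.Ioi i.succ)).erase l, opFactor t l j) * shifted q f l =
        ((1 - algebraMap K _ t) * ratX K i.succ *
          ((algebraMap K _ t - 1) * ratX K l / (ratX K l - ratX K i.succ) *
          (∏ j ∈ (Finset.Ioi i.succ).erase l, opFactor t l j) * shifted q f l) +
        (algebraMap K _ t * ratX K i.castSucc - ratX K i.succ) *
          ((algebraMap K _ t - 1) * ratX K l / (ratX K l - ratX K i.castSucc) *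
          (∏ j ∈ (Finset.Ioi i.succ).erase l, opFactor t l j) * shifted q f l)) /
          (ratX K i.castSucc - ratX K i.succ) := by
      intro l hl
      have hl' := Finset.mem_Ioi.1 hl
      rw [Finset.erase_insert_of_ne hl'.ne, Finset.prod_insert
        (fun h => hnot (Finset.mem_of_mem_erase h)), ← mul_assoc, ← opFactor_exchange t
        (castSucc_ne_succ i) (lt_trans Fin.castSucc_lt_succ hl').ne hl'.ne]
      ring
    rw [Finset.sum_congr rfl hsum, ← Finset.sum_div, Finset.sum_add_distrib, ← Finset.mul_sum,
      ← Finset.mul_sum]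
    have h1 := ratX_sub_ne_zero (K := K) (castSucc_ne_succ i)
    have h2 := ratX_sub_ne_zero (K := K) (castSucc_ne_succ i).symm
    have h3 : (algebraMap K (RatFun (m + 1) K) t - 1) * ratX K i.succ /
        (ratX K i.succ - ratX K i.castSucc) =
        (1 - algebraMap K (RatFun (m + 1) K) t) * ratX K i.succ /
        (ratX K i.castSucc - ratX K i.succ) := by
      rw [← neg_sub (ratX K i.castSucc), div_neg]
      ring
    rw [h3]
    unfold opFactor
    ring

theorem prod_erase_eq_sum {n : ℕ} {R : Type*} [CommRing R] (a : Fin n → R) (i : Fin n) :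
    ∏ j ∈ Finset.univ.erase i, a j = ∏ j ∈ Finset.Ioi i, a j +
      ∑ k ∈ Finset.Iio i, (a k - 1) * ∏ j ∈ (Finset.Ioi k).erase i, a j := by
  have h1 := Finset.prod_add_ordered (Finset.Iio i) a fun k => 1 - a k
  simp only [add_sub_cancel, Finset.prod_const_one, mul_one] at h1
  have h2 : Finset.univ.erase i = Finset.Iio i ∪ Finset.Ioi i := by
    ext j
    simp [lt_or_lt_iff_ne]
  have h3 : Disjoint (Finset.Iio i) (Finset.Ioi i) := by
    rw [Finset.disjoint_left]
    intro j hj hj'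
    exact lt_asymm (Finset.mem_Iio.1 hj) (Finset.mem_Ioi.1 hj')
  rw [h2, Finset.prod_union h3]
  have h4 : ∀ k ∈ Finset.Iio i, ∏ j ∈ (Finset.Ioi k).erase i, a j =
      (∏ j ∈ (Finset.Iio i).filter (k < ·), a j) * ∏ j ∈ Finset.Ioi i, a j := by
    intro k hk
    rw [Finset.mem_Iio] at hk
    rw [← Finset.prod_union (h3.mono_left (Finset.filter_subset _ _))]
    refine Finset.prod_congr ?_ fun _ _ => rfl
    ext j
    simp only [Finset.mem_erase, Finset.mem_Ioi, Finset.mem_union, Finset.mem_filter,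
      Finset.mem_Iio, ne_eq]
    constructor
    · rintro ⟨hj, hkj⟩
      rcases lt_or_gt_of_ne hj with h | h
      · exact Or.inl ⟨h, hkj⟩
      · exact Or.inr h
    · rintro (⟨h, hkj⟩ | h)
      · exact ⟨h.ne, hkj⟩
      · exact ⟨h.ne', hk.trans h⟩
  have h5 : ∑ k ∈ Finset.Iio i, (a k - 1) * ∏ j ∈ (Finset.Ioi k).erase i, a j =
      -(∑ k ∈ Finset.Iio i, (1 - a k) * ∏ j ∈ (Finset.Iio i).filter (k < ·), a j) *
        ∏ j ∈ Finset.Ioi i, a j := by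
    rw [← Finset.sum_neg_distrib, Finset.sum_mul]
    refine Finset.sum_congr rfl fun k hk => ?_
    rw [h4 k hk]
    ring
  rw [h5]
  linear_combination (-∏ j ∈ Finset.Ioi i, a j) * h1

theorem opFactor_sub_one (t : K) {i k : Fin (m + 1)} (h : i ≠ k) :
    opFactor t i k - 1 = (algebraMap K (RatFun (m + 1) K) t - 1) * ratX K i /
      (ratX K i - ratX K k) := by
  have := ratX_sub_ne_zero (K := K) h
  unfold opFactor
  field_simp
  ring

theorem sum_tailShift (q t : K) (f : MvPolynomial (Fin (m + 1)) K) :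
    ∑ k, tailShift q t f k = macdonaldOp q t f := by
  unfold tailShift macdonaldOp
  rw [Finset.sum_add_distrib]
  have hswap : ∑ k : Fin (m + 1), ∑ i ∈ Finset.Ioi k,
      (algebraMap K (RatFun (m + 1) K) t - 1) * ratX K i / (ratX K i - ratX K k) *
        (∏ j ∈ (Finset.Ioi k).erase i, opFactor t i j) * shifted q f i =
      ∑ i : Fin (m + 1), ∑ k ∈ Finset.Iio i,
      (algebraMap K (RatFun (m + 1) K) t - 1) * ratX K i / (ratX K i - ratX K k) *
        (∏ j ∈ (Finset.Ioi k).erase i, opFactor t i j) * shifted q f i :=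
    Finset.sum_comm' fun k i => by simp
  rw [hswap, ← Finset.sum_add_distrib]
  refine Finset.sum_congr rfl fun i _ => ?_
  have h := prod_erase_eq_sum (fun j => opFactor t i j) i
  have h' : ∏ j ∈ Finset.univ.erase i,
      (algebraMap K (RatFun (m + 1) K) t * ratX K i - ratX K j) / (ratX K i - ratX K j) =
      ∏ j ∈ Finset.univ.erase i, opFactor t i j := rfl
  rw [h', h, add_mul, Finset.sum_mul]
  congr 1
  refine Finset.sum_congr rfl fun k hk => ?_
  rw [opFactor_sub_one t (Finset.mem_Iio.1 hk).ne']
  rfl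

theorem heckeInv_of_symm {f : MvPolynomial (Fin (m + 1)) K}
    (hf : ∀ σ : Equiv.Perm (Fin (m + 1)), rename σ f = f) {k : ℕ} (hk : k < m) :
    heckeInv m t k f = t⁻¹ • f := by
  rw [heckeInv, LinearMap.smul_apply, LinearMap.sub_apply, LinearMap.smul_apply,
    Module.End.one_apply, heckeN_of_lt t hk, hecke_of_symm t _ (hf _), ← sub_smul, sub_sub_cancel,
    one_smul]

theorem headInv_of_symm {f : MvPolynomial (Fin (m + 1)) K}
    (hf : ∀ σ : Equiv.Perm (Fin (m + 1)), rename σ f = f) {k : ℕ} (hk : k ≤ m) :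
    headInv m t k f = (t ^ k)⁻¹ • f := by
  induction k with
  | zero => simp [headInv]
  | succ k ih =>
    rw [headInv, Module.End.mul_apply, heckeInv_of_symm hf hk, map_smul, ih (by omega),
      smul_smul, pow_succ', mul_inv]

/-- On symmetric polynomials the Macdonald operator is the sum of the Cherednik operators. -/
theorem macdonaldOp_eq_sum_cherednik (ht : t ≠ 0) {f : MvPolynomial (Fin (m + 1)) K}
    (hf : ∀ σ : Equiv.Perm (Fin (m + 1)), rename σ f = f) :
    macdonaldOp q t f = algebraMap _ _ (∑ k : Fin (m + 1), cherednik m q t k f) := by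
  rw [← sum_tailShift, map_sum]
  refine Finset.sum_congr rfl fun k _ => ?_
  rw [cherednik, LinearMap.smul_apply, Module.End.mul_apply, Module.End.mul_apply,
    headInv_of_symm hf (by omega), LinearMap.map_smul, LinearMap.map_smul, smul_smul,
    mul_inv_cancel₀ (pow_ne_zero _ ht), one_smul, omg_apply, rot_of_symm hf, algebraMap_tail hf]

end Operator

section Uniqueness

variable {m n : ℕ} {K : Type*} [Field K] {q t : K}

theorem monomialSymm_eq (κ : Fin n → ℕ) : monomialSymm (K := K) κ =
    ∑ η ∈ Finset.univ.image (fun σ : Equiv.Perm (Fin n) => κ ∘ σ), mon K η := rfl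

theorem mem_orbit_iff {κ ν : Fin n → ℕ} (hκ : Antitone κ) :
    ν ∈ Finset.univ.image (fun σ : Equiv.Perm (Fin n) => κ ∘ σ) ↔ plus ν = κ := by
  simp only [Finset.mem_image, Finset.mem_univ, true_and]
  constructor
  · rintro ⟨σ, rfl⟩
    rw [plus_comp, plus_of_antitone hκ]
  · rintro rfl
    obtain ⟨σ, hσ⟩ := exists_plus_eq ν
    refine ⟨σ⁻¹, ?_⟩
    rw [hσ, Function.comp_assoc, ← Equiv.Perm.coe_mul, mul_inv_cancel, Equiv.Perm.coe_one,
      Function.comp_id]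

theorem cf_monomialSymm {κ : Fin n → ℕ} (hκ : Antitone κ) (ν : Fin n → ℕ) :
    cf ν (monomialSymm (K := K) κ) = if plus ν = κ then 1 else 0 := by
  rw [monomialSymm_eq, map_sum]
  simp only [cf_mon, Finset.sum_ite_eq', mem_orbit_iff hκ]

theorem cf_rename (σ : Equiv.Perm (Fin n)) (ν : Fin n → ℕ) (f : MvPolynomial (Fin n) K) :
    cf ν (rename σ f) = cf (ν ∘ σ) f := by
  suffices h : cf ν ∘ₗ (rename σ).toLinearMap = cf (K := K) (ν ∘ σ) from LinearMap.congr_fun h f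
  refine linearMap_ext_mon fun μ => ?_
  have h1 : rename σ (mon K μ) = mon K (μ ∘ ⇑σ⁻¹) := by
    have := rename_mon (K := K) σ (μ ∘ ⇑σ⁻¹)
    rwa [Function.comp_assoc, ← Equiv.Perm.coe_mul, inv_mul_cancel, Equiv.Perm.coe_one,
      Function.comp_id] at this
  rw [LinearMap.comp_apply, AlgHom.toLinearMap_apply, h1, cf_mon, cf_mon]
  congr 1
  rw [eq_iff_iff]
  constructor
  · rintro rfl
    rw [Function.comp_assoc, ← Equiv.Perm.coe_mul, inv_mul_cancel, Equiv.Perm.coe_one,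
      Function.comp_id]
  · rintro rfl
    rw [Function.comp_assoc, ← Equiv.Perm.coe_mul, mul_inv_cancel, Equiv.Perm.coe_one,
      Function.comp_id]

theorem rename_of_cf {f : MvPolynomial (Fin n) K}
    (hf : ∀ (σ : Equiv.Perm (Fin n)) (ν : Fin n → ℕ), cf (ν ∘ σ) f = cf ν f)
    (σ : Equiv.Perm (Fin n)) : rename σ f = f :=
  ext_cf fun ν => by rw [cf_rename, hf]

theorem cf_plus {f : MvPolynomial (Fin n) K}
    (hf : ∀ σ : Equiv.Perm (Fin n), rename σ f = f) (ν : Fin n → ℕ) :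
    cf (plus ν) f = cf ν f := by
  obtain ⟨σ, hσ⟩ := exists_plus_eq ν
  rw [hσ, ← cf_rename, hf]

theorem DomLE.domLT {μ κ : Fin n → ℕ} (h : DomLE μ κ) (hκ : Antitone κ)
    (hne : μ ≠ κ) : DomLT μ κ := by
  refine ⟨hne, h.1, fun p => ?_⟩
  rcases lt_or_ge p n with hp | hp
  · set k := κ ⟨p, hp⟩ with hk
    set s := Finset.univ.filter fun i : Fin n => (i : ℕ) < p with hs
    have h1 : ∑ i ∈ s, μ i ≤ excess k μ + s.card * k := by
      calc ∑ i ∈ s, μ i ≤ ∑ i ∈ s, ((μ i - k) + k) := Finset.sum_le_sum fun i _ => by omega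
        _ = ∑ i ∈ s, (μ i - k) + s.card * k := by
          rw [Finset.sum_add_distrib, Finset.sum_const, smul_eq_mul]
        _ ≤ excess k μ + s.card * k := Nat.add_le_add_right
          (Finset.sum_le_sum_of_subset (Finset.subset_univ s)) _
    have h2 : excess k κ + s.card * k = ∑ i ∈ s, κ i := by
      have h3 : excess k κ = ∑ i ∈ s, (κ i - k) := by
        refine (Finset.sum_subset (Finset.subset_univ s) fun i _ hi => ?_).symm
        rw [hs, Finset.mem_filter, not_and] at hi
        have : κ i ≤ k := hκ (Fin.le_def.2 (not_lt.1 (hi (Finset.mem_univ i))))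
        omega
      rw [h3, ← smul_eq_mul, ← Finset.sum_const, ← Finset.sum_add_distrib]
      refine Finset.sum_congr rfl fun i hi => ?_
      rw [hs, Finset.mem_filter] at hi
      have : k ≤ κ i := hκ (Fin.le_def.2 hi.2.le)
      omega
    have h3 := h.2 k
    omega
  · have hs : Finset.univ.filter (fun i : Fin n => (i : ℕ) < p) = Finset.univ :=
      Finset.filter_true_of_mem fun i _ => lt_of_lt_of_le i.2 hp
    rw [hs, h.1]

/-- The parameters are admissible and the eigenvalues of the Macdonald operator separate
comparable partitions. -/
structure Generic (q t : K) : Prop extends Admissible q t where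
  separates : ∀ {n : ℕ} {μ κ : Fin n → ℕ}, Antitone μ → Antitone κ → DomLT μ κ →
    macdonaldEigenvalue q t μ ≠ macdonaldEigenvalue q t κ

theorem sum_spec_of_antitone {κ : Fin n → ℕ} (hκ : Antitone κ) :
    ∑ k, spec q t κ k = macdonaldEigenvalue q t κ := by
  unfold spec macdonaldEigenvalue
  exact Finset.sum_congr rfl fun k _ => by rw [coleg_antitone hκ]

theorem isMacdonaldP_symP (h : Admissible q t) {κ : Fin (m + 1) → ℕ} (hκ : Antitone κ) :
    IsMacdonaldP q t κ (symP q t κ) := by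
  classical
  have hsym := rename_symP h hκ
  constructor
  · refine ⟨Finsupp.onFinset (supp (symP q t κ))
      (fun μ => if Antitone μ ∧ μ ≠ κ then cf μ (symP q t κ) else 0) fun μ hμ => ?_,
      fun μ hμ => ?_, ?_⟩
    · exact mem_supp.2 fun h0 => hμ (by rw [h0, ite_self])
    · rw [Finsupp.mem_support_iff, Finsupp.onFinset_apply, ite_ne_right_iff] at hμ
      exact ⟨hμ.1.1, (domLE_of_cf_symP h hμ.2).domLT hκ hμ.1.2⟩
    · refine ext_cf fun ν => ?_
      rw [map_add, Finsupp.sum, map_sum, cf_monomialSymm hκ]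
      have h1 : ∀ μ ∈ (Finsupp.onFinset (supp (symP q t κ))
          (fun μ => if Antitone μ ∧ μ ≠ κ then cf μ (symP q t κ) else 0) fun μ hμ =>
            mem_supp.2 fun h0 => hμ (by rw [h0, ite_self])).support,
          cf ν (C ((Finsupp.onFinset (supp (symP q t κ))
          (fun μ => if Antitone μ ∧ μ ≠ κ then cf μ (symP q t κ) else 0) fun μ hμ =>
            mem_supp.2 fun h0 => hμ (by rw [h0, ite_self])) μ) * monomialSymm μ) =
          if plus ν = μ then cf (plus ν) (symP q t κ) else 0 := by
        intro μ hμ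
        rw [Finsupp.mem_support_iff, Finsupp.onFinset_apply, ite_ne_right_iff] at hμ
        rw [Finsupp.onFinset_apply, if_pos hμ.1, ← smul_eq_C_mul, map_smul,
          cf_monomialSymm hμ.1.1, smul_eq_mul, mul_ite, mul_one, mul_zero]
        by_cases h2 : plus ν = μ
        · rw [if_pos h2, if_pos h2, h2]
        · rw [if_neg h2, if_neg h2]
      rw [Finset.sum_congr rfl h1, Finset.sum_ite_eq, ← cf_plus hsym ν]
      by_cases h2 : plus ν = κ
      · rw [if_pos h2, if_neg, h2, cf_symP h hκ, add_zero]
        rw [Finsupp.mem_support_iff, Finsupp.onFinset_apply, not_not, if_neg]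
        exact fun h3 => h3.2 h2
      · rw [if_neg h2, zero_add]
        by_cases h3 : cf (plus ν) (symP q t κ) = 0
        · rw [h3, ite_self]
        · rw [if_pos]
          rw [Finsupp.mem_support_iff, Finsupp.onFinset_apply, if_pos ⟨plus_antitone ν, h2⟩]
          exact h3
  · rw [macdonaldOp_eq_sum_cherednik h.t_ne hsym, sum_cherednik_symP h hκ,
      sum_spec_of_antitone hκ, smul_eq_C_mul]

theorem IsMacdonaldP.cf_comp {κ : Fin n → ℕ} (hκ : Antitone κ) {P : MvPolynomial (Fin n) K}
    (hP : IsMacdonaldP q t κ P) (σ : Equiv.Perm (Fin n)) (ν : Fin n → ℕ) :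
    cf (ν ∘ σ) P = cf ν P := by
  obtain ⟨u, hu, rfl⟩ := hP.triangular
  rw [map_add, map_add, Finsupp.sum, map_sum, map_sum, cf_monomialSymm hκ, cf_monomialSymm hκ,
    plus_comp]
  congr 1
  refine Finset.sum_congr rfl fun μ hμ => ?_
  rw [← smul_eq_C_mul, map_smul, map_smul, cf_monomialSymm (hu μ hμ).1,
    cf_monomialSymm (hu μ hμ).1, plus_comp]

theorem IsMacdonaldP.cf_self {κ : Fin n → ℕ} (hκ : Antitone κ) {P : MvPolynomial (Fin n) K}
    (hP : IsMacdonaldP q t κ P) : cf κ P = 1 := by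
  obtain ⟨u, hu, rfl⟩ := hP.triangular
  rw [map_add, Finsupp.sum, map_sum, cf_monomialSymm hκ, plus_of_antitone hκ, if_pos rfl,
    Finset.sum_eq_zero, add_zero]
  intro μ hμ
  rw [← smul_eq_C_mul, map_smul, cf_monomialSymm (hu μ hμ).1, plus_of_antitone hκ,
    if_neg (hu μ hμ).2.1.symm, smul_zero]

theorem IsMacdonaldP.domLT {κ : Fin n → ℕ} (hκ : Antitone κ) {P : MvPolynomial (Fin n) K}
    (hP : IsMacdonaldP q t κ P) {μ : Fin n → ℕ} (hμ : Antitone μ) (hμκ : μ ≠ κ)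
    (h : cf μ P ≠ 0) : DomLT μ κ := by
  obtain ⟨u, hu, rfl⟩ := hP.triangular
  by_contra hcon
  refine h ?_
  rw [map_add, Finsupp.sum, map_sum, cf_monomialSymm hκ, plus_of_antitone hμ, if_neg hμκ, zero_add]
  refine Finset.sum_eq_zero fun ν hν => ?_
  rw [← smul_eq_C_mul, map_smul, cf_monomialSymm (hu ν hν).1, plus_of_antitone hμ, if_neg,
    smul_zero]
  rintro rfl
  exact hcon (hu μ hν).2

theorem IsMacdonaldP.unique (h : Generic q t) {κ : Fin (m + 1) → ℕ} (hκ : Antitone κ)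
    {P R : MvPolynomial (Fin (m + 1)) K} (hP : IsMacdonaldP q t κ P)
    (hR : IsMacdonaldP q t κ R) : P = R := by
  have hPs := rename_of_cf (hP.cf_comp hκ)
  have hRs := rename_of_cf (hR.cf_comp hκ)
  have hDP := hP.eigen
  have hDR := hR.eigen
  rw [macdonaldOp_eq_sum_cherednik h.t_ne hPs] at hDP
  rw [macdonaldOp_eq_sum_cherednik h.t_ne hRs] at hDR
  have hDP' := IsFractionRing.injective (MvPolynomial (Fin (m + 1)) K) (RatFun (m + 1) K) hDP
  have hDR' := IsFractionRing.injective (MvPolynomial (Fin (m + 1)) K) (RatFun (m + 1) K) hDR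
  rw [← sub_eq_zero]
  by_contra hne
  obtain ⟨ρ, hρ⟩ := exists_cf_ne_zero hne
  obtain ⟨ν, h1, -, h2⟩ := exists_maximal_supp _ hρ
  have hs : ∀ σ : Equiv.Perm (Fin (m + 1)), rename σ (P - R) = P - R := fun σ => by
    rw [map_sub, hPs, hRs]
  have h3 : cf (plus ν) (P - R) ≠ 0 := by rwa [cf_plus hs]
  have hm : P - R ∈ notAbove K (plus ν) := by
    obtain ⟨σ, hσ⟩ := exists_plus_eq ν
    rw [hσ, notAbove_comp]
    exact mem_span_mon h2
  have h4 : ∑ k : Fin (m + 1), cherednik m q t k (P - R) =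
      macdonaldEigenvalue q t κ • (P - R) := by
    simp only [map_sub]
    rw [Finset.sum_sub_distrib, hDP', hDR', smul_eq_C_mul]
    ring
  have h5 := congrArg (cf (plus ν)) h4
  rw [map_sum, map_smul, smul_eq_mul] at h5
  simp only [cf_cherednik (q := q) h.t_ne (plus_antitone ν) hm] at h5
  rw [← Finset.sum_mul, sum_spec_of_antitone (plus_antitone ν)] at h5
  have h6 := mul_right_cancel₀ h3 h5
  by_cases h7 : plus ν = κ
  · rw [h7, map_sub, hP.cf_self hκ, hR.cf_self hκ, sub_self] at h3
    exact h3 rfl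
  · refine h.separates (plus_antitone ν) hκ ?_ h6
    rw [map_sub] at h3
    by_cases h8 : cf (plus ν) P = 0
    · rw [h8, zero_sub, neg_ne_zero] at h3
      exact hR.domLT hκ (plus_antitone ν) h7 h3
    · exact hP.domLT hκ (plus_antitone ν) h7 h8

theorem macdonaldP_eq {κ : Fin n → ℕ} {P : MvPolynomial (Fin n) K}
    (hP : IsMacdonaldP q t κ P) (hu : ∀ R, IsMacdonaldP q t κ R → R = P) :
    macdonaldP q t κ = P := by
  have h : ∃! P, IsMacdonaldP q t κ P := ⟨P, hP, hu⟩
  rw [macdonaldP, dif_pos h]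
  exact hu _ h.choose_spec.1

theorem macdonaldP_eq_symP (h : Generic q t) {κ : Fin (m + 1) → ℕ} (hκ : Antitone κ) :
    macdonaldP q t κ = symP q t κ :=
  macdonaldP_eq (isMacdonaldP_symP h.toAdmissible hκ) fun _ hR =>
    hR.unique h hκ (isMacdonaldP_symP h.toAdmissible hκ)

theorem macdonaldP_fin_zero (q t : K) (κ : Fin 0 → ℕ) : macdonaldP q t κ = 1 := by
  have hm : monomialSymm (K := K) κ = 1 := by
    have : Finset.univ.image (fun σ : Equiv.Perm (Fin 0) => κ ∘ σ) = {κ} := by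
      ext ν
      simp [Subsingleton.elim ν κ]
    rw [monomialSymm, this]
    simp
  refine macdonaldP_eq ⟨⟨0, by simp, ?_⟩, ?_⟩ fun R hR => ?_
  · rw [hm, Finsupp.sum_zero_index, add_zero]
  · simp [macdonaldOp, macdonaldEigenvalue]
  · obtain ⟨u, hu, rfl⟩ := hR.triangular
    have : u = 0 := by
      rw [← Finsupp.support_eq_empty, Finset.eq_empty_iff_forall_notMem]
      exact fun μ hμ => (hu μ hμ).2.1 (Subsingleton.elim _ _)
    rw [hm, this, Finsupp.sum_zero_index, add_zero]

end Uniqueness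

section Evaluation

variable {K : Type*} [Field K] {q t : K}

theorem eval_macdonaldP (h : Generic q t) {n : ℕ} {κ : Fin n → ℕ} (hκ : Antitone κ) :
    eval (fun i : Fin n => t ^ (i : ℕ)) (macdonaldP q t κ) =
      t ^ legSum κ * (bConst q t κ / hConst q t κ) := by
  obtain _ | m := n
  · rw [macdonaldP_fin_zero]
    simp [legSum, bConst, hConst]
  · rw [macdonaldP_eq_symP h hκ]
    exact evalT_symP h.toAdmissible hκ

theorem evaluation_formulas (h : Generic q t) {n : ℕ} (η : Fin n → ℕ) :
    eval (fun i : Fin n => t ^ (i : ℕ)) (macdonaldP q t (plus η)) =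
      t ^ legSum (incr η) * bracketMultinomial t⁻¹ η *
        (eConst q t (incr η) / dConst q t (incr η)) ∧
    eval (fun i : Fin n => t ^ (i : ℕ)) (macdonaldP q t (plus η)) =
      t ^ legSum (plus η) * (bConst q t (plus η) / hConst q t (plus η)) := by
  have h1 := eval_macdonaldP h (plus_antitone η)
  refine ⟨?_, h1⟩
  rw [h1, legSum_incr, pow_add, mul_assoc (t ^ legSum (plus η)),
    bracketMultinomial_inv_mul h.toAdmissible, mul_assoc,
    bracketMultinomial_mul_div h.toAdmissible η (hConst_ne_zero h.toAdmissible _)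
      (dConst_ne_zero h.toAdmissible _)]

end Evaluation

end

section

open MvPolynomial

section RealParameters

theorem mul_sub_one_mul_sub_le {q : ℝ} (hq : 0 < q) (a b : ℕ) :
    q ^ b * (q - 1) * ((a : ℝ) - b) ≤ q ^ a - q ^ b := by
  have hpos : ∀ k : ℕ, 0 ≤ (q - 1) * (q ^ k - 1) := by
    intro k
    rcases le_total 1 q with h | h
    · exact mul_nonneg (by linarith) (by linarith [one_le_pow₀ h (n := k)])
    · exact mul_nonneg_of_nonpos_of_nonpos (by linarith)
        (by linarith [pow_le_one₀ hq.le h (n := k)])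
  rcases le_total b a with h | h
  · obtain ⟨k, rfl⟩ := Nat.exists_eq_add_of_le h
    have h1 : (q - 1) * k ≤ q ^ k - 1 := by
      induction k with
      | zero => simp
      | succ k ih =>
        have h2 := ih (by omega)
        have h3 := hpos k
        push_cast
        rw [pow_succ]
        nlinarith
    have h2 := mul_le_mul_of_nonneg_left h1 (pow_pos hq b).le
    push_cast
    rw [pow_add]
    linarith
  · obtain ⟨k, rfl⟩ := Nat.exists_eq_add_of_le h
    have h1 : q ^ k * (1 - (q - 1) * k) ≤ 1 := by
      induction k with
      | zero => simp
      | succ k ih =>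
        have h2 := ih (by omega)
        have h3 := hpos (k + 1)
        have h4 := mul_le_mul_of_nonneg_left h2 hq.le
        push_cast
        rw [pow_succ] at h3 ⊢
        nlinarith
    have h2 := mul_le_mul_of_nonneg_left h1 (pow_pos hq a).le
    push_cast
    rw [pow_add]
    linarith

theorem eq_last_add_sum {m : ℕ} (w : Fin (m + 1) → ℝ) (i : Fin (m + 1)) :
    w i = w (Fin.last m) +
      ∑ p : Fin m, if i ≤ p.castSucc then w p.castSucc - w p.succ else 0 := by
  induction i using Fin.reverseInduction with
  | last =>
    have : ∀ p : Fin m, ¬ Fin.last m ≤ p.castSucc := fun p => not_le.2 (Fin.castSucc_lt_last p)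
    simp [this]
  | cast i ih =>
    have h : ∀ p : Fin m, (if i.castSucc ≤ p.castSucc then w p.castSucc - w p.succ else 0) =
        (if i.succ ≤ p.castSucc then w p.castSucc - w p.succ else 0) +
          if p = i then w i.castSucc - w i.succ else 0 := by
      intro p
      simp only [Fin.le_def, Fin.ext_iff, Fin.val_castSucc, Fin.val_succ]
      rcases lt_trichotomy (p : ℕ) i with h | h | h
      · rw [if_neg (by omega), if_neg (by omega), if_neg (by omega), add_zero]
      · have : p = i := Fin.ext h
        subst this
        simp
      · rw [if_pos (by omega), if_pos (by omega), if_neg (by omega), add_zero]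
    simp only [h, Finset.sum_add_distrib, Finset.sum_ite_eq', Finset.mem_univ, if_true]
    linarith

theorem sum_mul_pos {m : ℕ} {w d : Fin (m + 1) → ℝ}
    (hw : ∀ p : Fin m, w p.succ < w p.castSucc) (h0 : ∑ i, d i = 0)
    (hd : ∀ p : ℕ, 0 ≤ ∑ i ∈ Finset.univ.filter (fun i : Fin (m + 1) => (i : ℕ) < p), d i)
    (hne : d ≠ 0) : 0 < ∑ i, w i * d i := by
  have h1 : ∑ i, w i * d i = ∑ p : Fin m, (w p.castSucc - w p.succ) *
      ∑ i ∈ Finset.univ.filter (fun i : Fin (m + 1) => (i : ℕ) < p + 1), d i := by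
    calc ∑ i, w i * d i = ∑ i, (w (Fin.last m) * d i + ∑ p : Fin m,
          (if i ≤ p.castSucc then w p.castSucc - w p.succ else 0) * d i) := by
          refine Finset.sum_congr rfl fun i _ => ?_
          conv_lhs => rw [eq_last_add_sum w i]
          rw [add_mul, Finset.sum_mul]
      _ = _ := by
          rw [Finset.sum_add_distrib, ← Finset.mul_sum, h0, mul_zero, zero_add, Finset.sum_comm]
          refine Finset.sum_congr rfl fun p _ => ?_
          rw [Finset.mul_sum, Finset.sum_filter]
          refine Finset.sum_congr rfl fun i _ => ?_
          have : (i ≤ p.castSucc) ↔ (i : ℕ) < p + 1 := by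
            rw [Fin.le_def, Fin.val_castSucc]
            omega
          simp only [this]
          split_ifs <;> simp
  rw [h1]
  have hnn : ∀ p ∈ (Finset.univ : Finset (Fin m)), 0 ≤ (w p.castSucc - w p.succ) *
      ∑ i ∈ Finset.univ.filter (fun i : Fin (m + 1) => (i : ℕ) < p + 1), d i := fun p _ =>
    mul_nonneg (sub_nonneg.2 (hw p).le) (hd _)
  refine lt_of_le_of_ne (Finset.sum_nonneg hnn) fun he => hne ?_
  have hz := (Finset.sum_eq_zero_iff_of_nonneg hnn).1 he.symm
  have hP : ∀ p : ℕ, p ≤ m + 1 →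
      ∑ i ∈ Finset.univ.filter (fun i : Fin (m + 1) => (i : ℕ) < p), d i = 0 := by
    intro p hp
    obtain _ | p := p
    · simp
    · rcases (Nat.lt_or_ge p m) with hpm | hpm
      · have := hz ⟨p, hpm⟩ (Finset.mem_univ _)
        exact (mul_eq_zero.1 this).resolve_left (sub_pos.2 (hw _)).ne'
      · rw [Finset.filter_true_of_mem fun i _ => by omega, h0]
  funext k
  have h2 := hP (k + 1) (by omega)
  have h3 : Finset.univ.filter (fun i : Fin (m + 1) => (i : ℕ) < k + 1) =
      insert k (Finset.univ.filter fun i : Fin (m + 1) => (i : ℕ) < k) := by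
    ext i
    simp only [Finset.mem_filter, Finset.mem_univ, true_and, Finset.mem_insert, Fin.ext_iff]
    omega
  rw [h3, Finset.sum_insert (by simp), hP k (by omega), add_zero] at h2
  exact h2

theorem macdonaldEigenvalue_lt {q t : ℝ} (hq : 0 < q) (ht : 0 < t)
    (hqt : q < 1 ∧ t < 1 ∨ 1 < q ∧ 1 < t) {n : ℕ} {μ κ : Fin n → ℕ} (hμ : Antitone μ)
    (h : DomLT μ κ) : macdonaldEigenvalue q t μ < macdonaldEigenvalue q t κ := by
  obtain _ | m := n
  · exact absurd (Subsingleton.elim _ _) h.1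
  have hsum : (∑ i, ((κ i : ℝ) - μ i)) = 0 := by
    rw [Finset.sum_sub_distrib, sub_eq_zero]
    exact_mod_cast h.2.1.symm
  have hpart : ∀ p : ℕ, 0 ≤ ∑ i ∈ Finset.univ.filter (fun i : Fin (m + 1) => (i : ℕ) < p),
      ((κ i : ℝ) - μ i) := by
    intro p
    rw [Finset.sum_sub_distrib, sub_nonneg]
    exact_mod_cast h.2.2 p
  have hne : (fun i => (κ i : ℝ) - μ i) ≠ 0 := by
    intro h0
    refine h.1 (funext fun i => ?_)
    have := congrFun h0 i
    simp only [Pi.zero_apply, sub_eq_zero] at this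
    exact_mod_cast this.symm
  have hpos : 0 < ∑ i : Fin (m + 1), ((q - 1) * (q ^ μ i * t ^ (m - (i : ℕ)))) *
      ((κ i : ℝ) - μ i) := by
    refine sum_mul_pos (fun p => ?_) hsum hpart hne
    have hle : μ p.succ ≤ μ p.castSucc := hμ Fin.castSucc_lt_succ.le
    have e : m - ((p.castSucc : Fin (m + 1)) : ℕ) = m - ((p.succ : Fin (m + 1)) : ℕ) + 1 := by
      rw [Fin.val_castSucc, Fin.val_succ]
      omega
    have hT := pow_pos ht (m - ((p.succ : Fin (m + 1)) : ℕ))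
    have hQ := pow_pos hq (μ p.succ)
    have hQ' := pow_pos hq (μ p.castSucc)
    rw [e, pow_succ]
    rcases hqt with ⟨h1, h2⟩ | ⟨h1, h2⟩
    · have h3 := pow_le_pow_of_le_one hq.le h1.le hle
      refine mul_lt_mul_of_neg_left ?_ (by linarith)
      rw [← mul_assoc]
      calc q ^ μ p.castSucc * t ^ (m - ((p.succ : Fin (m + 1)) : ℕ)) * t
          < q ^ μ p.castSucc * t ^ (m - ((p.succ : Fin (m + 1)) : ℕ)) :=
            mul_lt_of_lt_one_right (mul_pos hQ' hT) h2
        _ ≤ _ := mul_le_mul_of_nonneg_right h3 hT.le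
    · have h3 := pow_le_pow_right₀ h1.le hle
      refine mul_lt_mul_of_pos_left ?_ (by linarith)
      rw [← mul_assoc]
      calc q ^ μ p.succ * t ^ (m - ((p.succ : Fin (m + 1)) : ℕ))
          ≤ q ^ μ p.castSucc * t ^ (m - ((p.succ : Fin (m + 1)) : ℕ)) :=
            mul_le_mul_of_nonneg_right h3 hT.le
        _ < _ := lt_mul_of_one_lt_right (mul_pos hQ' hT) h2
  have hle : ∑ i : Fin (m + 1), ((q - 1) * (q ^ μ i * t ^ (m - (i : ℕ)))) *
      ((κ i : ℝ) - μ i) ≤ macdonaldEigenvalue q t κ - macdonaldEigenvalue q t μ := by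
    unfold macdonaldEigenvalue
    rw [← Finset.sum_sub_distrib]
    refine Finset.sum_le_sum fun i _ => ?_
    have h1 := mul_le_mul_of_nonneg_right (mul_sub_one_mul_sub_le hq (κ i) (μ i))
      (pow_pos ht (m - (i : ℕ))).le
    simp only [Nat.add_sub_cancel]
    linarith
  linarith

theorem admissible_real {q t : ℝ} (hq : 0 < q) (hq1 : q < 1) (ht : 0 < t) (ht1 : t < 1) :
    Admissible q t where
  q_ne := hq.ne'
  t_ne := ht.ne'
  pow_eq_one a b hab := by
    have h1 := pow_le_one₀ hq.le hq1.le (n := a)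
    have h2 := pow_le_one₀ ht.le ht1.le (n := b)
    have h3 := pow_pos hq a
    have h4 := pow_pos ht b
    constructor
    · by_contra ha
      nlinarith [pow_lt_one₀ hq.le hq1 ha]
    · by_contra hb
      nlinarith [pow_lt_one₀ ht.le ht1 hb]

theorem generic_real {q t : ℝ} (hq : 0 < q) (hq1 : q < 1) (ht : 0 < t) (ht1 : t < 1) :
    Generic q t where
  toAdmissible := admissible_real hq hq1 ht ht1
  separates hμ _ h := (macdonaldEigenvalue_lt hq ht (Or.inl ⟨hq1, ht1⟩) hμ h).ne

theorem generic_real_inv {q t : ℝ} (hq : 0 < q) (hq1 : q < 1) (ht : 0 < t) (ht1 : t < 1) :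
    Generic q⁻¹ t⁻¹ where
  toAdmissible := (admissible_real hq hq1 ht ht1).inv
  separates hμ _ h := (macdonaldEigenvalue_lt (inv_pos.2 hq) (inv_pos.2 ht)
    (Or.inr ⟨(one_lt_inv₀ hq).2 hq1, (one_lt_inv₀ ht).2 ht1⟩) hμ h).ne

end RealParameters

section Indeterminates

variable {K : Type*} [Field K] [CharZero K] {q t : K}

theorem aeval_eq_of_algebraicIndependent (h : AlgebraicIndependent ℚ ![q, t])
    {p p' : MvPolynomial (Fin 2) ℚ} (e : aeval ![q, t] p = aeval ![q, t] p') (x : Fin 2 → ℝ) :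
    aeval x p = aeval x p' := by
  rw [h e]

theorem generic_of_algebraicIndependent (h : AlgebraicIndependent ℚ ![q, t]) : Generic q t where
  q_ne h0 := by
    have := aeval_eq_of_algebraicIndependent h (p := X 0) (p' := 0) (by simpa using h0) 1
    simp at this
  t_ne h0 := by
    have := aeval_eq_of_algebraicIndependent h (p := X 1) (p' := 0) (by simpa using h0) 1
    simp at this
  pow_eq_one a b hab := by
    have := aeval_eq_of_algebraicIndependent h (p := X 0 ^ a * X 1 ^ b) (p' := 1)
      (by simpa using hab) ![1 / 2, 1 / 2]
    refine (admissible_real (q := 1 / 2) (t := 1 / 2) (by norm_num) (by norm_num) (by norm_num)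
      (by norm_num)).pow_eq_one a b ?_
    simpa using this
  separates := by
    intro n μ κ hμ hκ hμκ e
    have := aeval_eq_of_algebraicIndependent h
      (p := ∑ i : Fin n, X 0 ^ μ i * X 1 ^ (n - 1 - (i : ℕ)))
      (p' := ∑ i : Fin n, X 0 ^ κ i * X 1 ^ (n - 1 - (i : ℕ)))
      (by simpa [macdonaldEigenvalue] using e) ![1 / 2, 1 / 2]
    refine (generic_real (q := 1 / 2) (t := 1 / 2) (by norm_num) (by norm_num) (by norm_num)
      (by norm_num)).separates hμ hκ hμκ ?_
    simpa [macdonaldEigenvalue] using this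

end Indeterminates

end

section

theorem norm_ofReal_of_pos {q : ℝ} (hq : 0 < q) : ‖(q : ℂ)‖ = q := by
  rw [Complex.norm_real, Real.norm_of_nonneg hq.le]

section

variable {q t : ℝ}

theorem summable_qPochInf (hq : 0 < q) (hq1 : q < 1) (b : ℂ) :
    Summable fun i : ℕ => ‖-(b * (q : ℂ) ^ i)‖ := by
  simp only [norm_neg, norm_mul, norm_pow, norm_ofReal_of_pos hq]
  exact (summable_geometric_of_lt_one hq.le hq1).mul_left _

theorem multipliable_qPochInf (hq : 0 < q) (hq1 : q < 1) (b : ℂ) :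
    Multipliable fun i : ℕ => 1 - b * (q : ℂ) ^ i := by
  simpa only [sub_eq_add_neg] using multipliable_one_add_of_summable (summable_qPochInf hq hq1 b)

theorem qPochInf_eq_mul (hq : 0 < q) (hq1 : q < 1) (b : ℂ) :
    qPochInf b q = (1 - b) * qPochInf (b * q) q := by
  unfold qPochInf
  have e : ∀ i : ℕ, 1 - b * (q : ℂ) ^ (i + 1) = 1 - b * q * (q : ℂ) ^ i := fun i => by ring
  rw [tprod_eq_zero_mul' (by simpa only [e] using multipliable_qPochInf hq hq1 (b * q))]
  simp only [e, pow_zero, mul_one]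

theorem qPochInf_ne_zero (hq : 0 < q) (hq1 : q < 1) {b : ℂ} (hb : ‖b‖ < 1) : qPochInf b q ≠ 0 := by
  unfold qPochInf
  simp only [sub_eq_add_neg]
  refine tprod_one_add_ne_zero_of_summable (fun i h => ?_) (summable_qPochInf hq hq1 b)
  have h1 : b * (q : ℂ) ^ i = 1 := by linear_combination -h
  have h2 : ‖b * (q : ℂ) ^ i‖ < 1 := by
    rw [norm_mul, norm_pow, norm_ofReal_of_pos hq]
    exact mul_lt_one_of_nonneg_of_lt_one_left (norm_nonneg _) hb (pow_le_one₀ hq.le hq1.le)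
  rw [h1, norm_one] at h2
  exact lt_irrefl _ h2

theorem differentiable_qPochInf (hq : 0 < q) (hq1 : q < 1) :
    Differentiable ℂ fun b => qPochInf b q := by
  have h : MultipliableLocallyUniformlyOn (fun (i : ℕ) (b : ℂ) => 1 + -(b * (q : ℂ) ^ i))
      Set.univ := by
    refine ⟨fun b => ∏' i, (1 + -(b * (q : ℂ) ^ i)),
      hasProdLocallyUniformlyOn_of_forall_compact isOpen_univ fun K _ hK => ?_⟩
    obtain ⟨R, hR⟩ := hK.isBounded.exists_norm_le
    refine ((summable_geometric_of_lt_one hq.le hq1).mul_left R).hasProdUniformlyOn_nat_one_add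
      hK (.of_forall fun i x hx => ?_) fun _ => by fun_prop
    rw [norm_neg, norm_mul, norm_pow, norm_ofReal_of_pos hq]
    exact mul_le_mul_of_nonneg_right (hR x hx) (by positivity)
  have h2 := h.hasProdLocallyUniformlyOn.differentiableOn
    (.of_forall fun s => by
      simpa [Finset.prod_fn] using DifferentiableOn.finsetProd (fun _ _ => by fun_prop)) isOpen_univ
  rw [differentiableOn_univ] at h2
  simpa only [qPochInf, sub_eq_add_neg] using h2

theorem conj_qPochInf (hq : 0 < q) (hq1 : q < 1) (b : ℂ) :
    (starRingEnd ℂ) (qPochInf b q) = qPochInf ((starRingEnd ℂ) b) q := by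
  unfold qPochInf
  rw [(multipliable_qPochInf hq hq1 b).map_tprod (starRingEnd ℂ) Complex.continuous_conj]
  simp

theorem qPoch_mul (hq : 0 < q) (hq1 : q < 1) (b : ℂ) (hb : ‖b * t‖ < 1) :
    (1 - b * t) * qPoch b q t = (1 - b) * qPoch (q * b) q t := by
  unfold qPoch
  have h0 : (1 : ℂ) - b * t ≠ 0 := by
    intro h
    rw [← sub_eq_zero.1 h, norm_one] at hb
    exact lt_irrefl _ hb
  rw [qPochInf_eq_mul hq hq1 b, qPochInf_eq_mul hq hq1 (b * t),
    show b * (t : ℂ) * q = q * b * t by ring, mul_comm b (q : ℂ)]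
  have h1 : qPochInf (q * b * t) q ≠ 0 := by
    refine qPochInf_ne_zero hq hq1 ?_
    rw [mul_assoc, norm_mul, norm_ofReal_of_pos hq]
    exact mul_lt_one_of_nonneg_of_lt_one_left hq.le hq1 hb.le
  field_simp

theorem qPoch_one (hq : 0 < q) (hq1 : q < 1) : qPoch 1 q t = 0 := by
  unfold qPoch
  rw [qPochInf_eq_mul hq hq1 1, sub_self, zero_mul, zero_div]

theorem qPoch_ne_zero (hq : 0 < q) (hq1 : q < 1) (ht : 0 < t) (ht1 : t < 1) {b : ℂ}
    (hb : ‖b‖ = 1) (hb1 : b ≠ 1) : qPoch b q t ≠ 0 := by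
  unfold qPoch
  rw [qPochInf_eq_mul hq hq1 b]
  refine div_ne_zero (mul_ne_zero (sub_ne_zero.2 hb1.symm) (qPochInf_ne_zero hq hq1 ?_))
    (qPochInf_ne_zero hq hq1 ?_)
  · rw [norm_mul, hb, one_mul, norm_ofReal_of_pos hq]
    exact hq1
  · rw [norm_mul, hb, one_mul, norm_ofReal_of_pos ht]
    exact ht1

theorem differentiableAt_qPoch (hq : 0 < q) (hq1 : q < 1) {b : ℂ} (hb : ‖b * t‖ < 1) :
    DifferentiableAt ℂ (fun b => qPoch b q t) b := by
  unfold qPoch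
  have h := differentiable_qPochInf hq hq1
  refine (h b).div ?_ (qPochInf_ne_zero hq hq1 hb)
  exact (h (b * t)).comp b (by fun_prop : DifferentiableAt ℂ (fun b : ℂ => b * (t : ℂ)) b)

theorem conj_qPoch (hq : 0 < q) (hq1 : q < 1) (b : ℂ) :
    (starRingEnd ℂ) (qPoch b q t) = qPoch ((starRingEnd ℂ) b) q t := by
  unfold qPoch
  rw [map_div₀, conj_qPochInf hq hq1, conj_qPochInf hq hq1, map_mul, Complex.conj_ofReal]

end

/-- The factor of the weight function that belongs to one pair of variables, as a function of
their quotient. -/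
def pairWeight (q t : ℝ) (z : ℂ) : ℂ := qPoch z q t * qPoch (q * z⁻¹) q t

theorem weight_eq {n : ℕ} (q t : ℝ) (x : Fin n → ℂ) :
    weight q t x = ∏ i, ∏ j ∈ Finset.Ioi i, pairWeight q t (x i / x j) := by
  simp only [weight, pairWeight, inv_div]

theorem pairWeight_mul_inv {q : ℝ} (hq : 0 < q) (t : ℝ) (z : ℂ) :
    pairWeight q t (q * z⁻¹) = pairWeight q t z := by
  have hq' : (q : ℂ) ≠ 0 := by exact_mod_cast hq.ne'
  unfold pairWeight
  rw [mul_inv, inv_inv, mul_inv_cancel_left₀ hq', mul_comm]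

section

variable {q t : ℝ}

theorem differentiableAt_pairWeight (hq : 0 < q) (hq1 : q < 1) (ht : 0 < t) (ht1 : t < 1) {z : ℂ}
    (h1 : q ≤ ‖z‖) (h2 : ‖z‖ ≤ 1) :
    DifferentiableAt ℂ (pairWeight q t) z := by
  have hz : z ≠ 0 := norm_pos_iff.1 (hq.trans_le h1)
  unfold pairWeight
  refine (differentiableAt_qPoch hq hq1 ?_).mul ?_
  · rw [norm_mul, norm_ofReal_of_pos ht]
    nlinarith [norm_nonneg z]
  · refine DifferentiableAt.comp (g := fun b => qPoch b q t) z
      (differentiableAt_qPoch hq hq1 ?_) ?_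
    · rw [norm_mul, norm_mul, norm_inv, norm_ofReal_of_pos ht, norm_ofReal_of_pos hq]
      have h3 : q * ‖z‖⁻¹ ≤ 1 := by
        rw [← div_eq_mul_inv]
        exact div_le_one_of_le₀ h1 (norm_nonneg _)
      have h4 : 0 ≤ q * ‖z‖⁻¹ := by positivity
      nlinarith
    · exact (differentiableAt_inv hz).const_mul _

theorem pairWeight_eq (hq : 0 < q) (hq1 : q < 1) (ht : 0 < t) (ht1 : t < 1) {z : ℂ}
    (hz : ‖z‖ = 1) (hz1 : z ≠ 1) :
    pairWeight q t z = qPoch z q t * qPoch z⁻¹ q t * ((z - t) / (z - 1)) := by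
  have hz0 : z ≠ 0 := norm_pos_iff.1 (by rw [hz]; exact one_pos)
  have h := qPoch_mul hq hq1 z⁻¹
    (by rw [norm_mul, norm_inv, hz, inv_one, one_mul, norm_ofReal_of_pos ht]; exact ht1)
  unfold pairWeight
  have h1 : z - 1 ≠ 0 := sub_ne_zero.2 hz1
  have h2 : (1 : ℂ) - z⁻¹ ≠ 0 := by
    rw [sub_ne_zero]
    intro h
    exact hz1 (by rw [← inv_inv z, ← h, inv_one])
  have h3 : qPoch (q * z⁻¹) q t = qPoch z⁻¹ q t * ((z - t) / (z - 1)) := by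
    rw [mul_div_assoc', eq_div_iff h1]
    have : (z - 1) = z * (1 - z⁻¹) := by field_simp
    have h4 : z * z⁻¹ = 1 := mul_inv_cancel₀ hz0
    linear_combination -z * h + (qPoch (q * z⁻¹) q t - t * qPoch z⁻¹ q t) * h4
  rw [h3]
  ring

theorem pairWeight_one (hq : 0 < q) (hq1 : q < 1) : pairWeight q t 1 = 0 := by
  unfold pairWeight
  rw [qPoch_one hq hq1, zero_mul]

end

end

section

open MvPolynomial MeasureTheory

section Torus

variable {n : ℕ}

/-- The point of the torus with the given angles. -/
def torusPt (θ : Fin n → UnitAddCircle) : Fin n → ℂ := fun i => (AddCircle.toCircle (θ i) : ℂ)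

theorem norm_torusPt (θ : Fin n → UnitAddCircle) (i : Fin n) : ‖torusPt θ i‖ = 1 :=
  Circle.norm_coe _

theorem torusPt_ne_zero (θ : Fin n → UnitAddCircle) (i : Fin n) : torusPt θ i ≠ 0 :=
  Circle.coe_ne_zero _

theorem continuous_torusPt : Continuous (torusPt : (Fin n → UnitAddCircle) → Fin n → ℂ) := by
  refine continuous_pi fun i => ?_
  exact continuous_subtype_val.comp (AddCircle.continuous_toCircle.comp (continuous_apply i))

/-- The measure on the angles whose integrals are constant terms. -/
abbrev torusMeasure (n : ℕ) : Measure (Fin n → UnitAddCircle) :=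
  Measure.pi fun _ => AddCircle.haarAddCircle

theorem constantTerm_eq (F : (Fin n → ℂ) → ℂ) :
    constantTerm F = ∫ θ, F (torusPt θ) ∂torusMeasure n := rfl

theorem constantTerm_congr {F G : (Fin n → ℂ) → ℂ} (h : ∀ θ, F (torusPt θ) = G (torusPt θ)) :
    constantTerm F = constantTerm G := by
  rw [constantTerm_eq, constantTerm_eq]
  simp only [h]

theorem constantTerm_comp (w : Equiv.Perm (Fin n)) (F : (Fin n → ℂ) → ℂ) :
    constantTerm (fun x => F (x ∘ w)) = constantTerm F := by
  have h := measurePreserving_piCongrLeft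
    (fun _ : Fin n => (AddCircle.haarAddCircle : Measure UnitAddCircle)) w
  have h2 := h.symm.integral_comp' (g := fun θ => F (torusPt θ))
  rw [constantTerm_eq, constantTerm_eq]
  exact h2

theorem constantTerm_add {F G : (Fin n → ℂ) → ℂ} (hF : Continuous fun θ => F (torusPt θ))
    (hG : Continuous fun θ => G (torusPt θ)) :
    constantTerm (fun x => F x + G x) = constantTerm F + constantTerm G :=
  integral_add (hF.integrable_of_hasCompactSupport (HasCompactSupport.of_compactSpace _))
    (hG.integrable_of_hasCompactSupport (HasCompactSupport.of_compactSpace _))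

theorem constantTerm_sub {F G : (Fin n → ℂ) → ℂ} (hF : Continuous fun θ => F (torusPt θ))
    (hG : Continuous fun θ => G (torusPt θ)) :
    constantTerm (fun x => F x - G x) = constantTerm F - constantTerm G :=
  integral_sub (hF.integrable_of_hasCompactSupport (HasCompactSupport.of_compactSpace _))
    (hG.integrable_of_hasCompactSupport (HasCompactSupport.of_compactSpace _))

theorem constantTerm_const_mul (c : ℂ) (F : (Fin n → ℂ) → ℂ) :
    constantTerm (fun x => c * F x) = c * constantTerm F :=
  integral_const_mul _ _

theorem norm_div_torusPt (θ : Fin n → UnitAddCircle) (i j : Fin n) :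
    ‖torusPt θ i / torusPt θ j‖ = 1 := by
  rw [norm_div, norm_torusPt, norm_torusPt, div_one]

theorem continuous_div_torusPt (i j : Fin n) :
    Continuous fun θ : Fin n → UnitAddCircle => torusPt θ i / torusPt θ j :=
  ((continuous_apply i).comp continuous_torusPt).div
    ((continuous_apply j).comp continuous_torusPt) fun θ => torusPt_ne_zero θ j

theorem continuous_aeval_torusPt (f : MvPolynomial (Fin n) ℝ) :
    Continuous fun θ : Fin n → UnitAddCircle => aeval (torusPt θ) f := by
  induction f using MvPolynomial.induction_on with
  | C a => simpa using continuous_const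
  | add f g hf hg => simp only [map_add]; exact hf.add hg
  | mul_X f i hf =>
    simp only [map_mul, aeval_X]
    exact hf.mul ((continuous_apply i).comp continuous_torusPt)

theorem continuous_aeval_inv_torusPt (f : MvPolynomial (Fin n) ℝ) :
    Continuous fun θ : Fin n → UnitAddCircle => aeval (fun i => (torusPt θ i)⁻¹) f := by
  induction f using MvPolynomial.induction_on with
  | C a => simpa using continuous_const
  | add f g hf hg => simp only [map_add]; exact hf.add hg
  | mul_X f i hf =>
    simp only [map_mul, aeval_X]; exact hf.mul (((continuous_apply i).comp continuous_torusPt).inv₀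
      fun θ => torusPt_ne_zero θ i)

end Torus

section Weight

variable {n : ℕ} {q t : ℝ}

theorem continuous_weight (hq : 0 < q) (hq1 : q < 1) (ht : 0 < t) (ht1 : t < 1) :
    Continuous fun θ : Fin n → UnitAddCircle => weight q t (torusPt θ) := by
  simp only [weight_eq]
  refine continuous_finsetProd _ fun i _ => continuous_finsetProd _ fun j _ => ?_
  rw [continuous_iff_continuousAt]
  intro θ
  refine ContinuousAt.comp (g := pairWeight q t) ?_ (continuous_div_torusPt i j).continuousAt
  exact (differentiableAt_pairWeight hq hq1 ht ht1 (by rw [norm_div_torusPt]; exact hq1.le)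
    (norm_div_torusPt θ i j).le).continuousAt

theorem weight_of_not_injective (hq : 0 < q) (hq1 : q < 1) {x : Fin n → ℂ} (hx : ∀ i, x i ≠ 0)
    (h : ¬ Function.Injective x) : weight q t x = 0 := by
  rw [weight_eq]
  obtain ⟨i, j, hij, hne⟩ : ∃ i j, x i = x j ∧ i < j := by
    simp only [Function.Injective, not_forall] at h
    obtain ⟨i, j, h1, h2⟩ := h
    rcases lt_or_gt_of_ne h2 with h3 | h3
    · exact ⟨i, j, h1, h3⟩
    · exact ⟨j, i, h1.symm, h3⟩
  refine Finset.prod_eq_zero (Finset.mem_univ i) (Finset.prod_eq_zero (Finset.mem_Ioi.2 hne) ?_)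
  rw [hij, div_self (hx j), pairWeight_one hq hq1]

/-- The symmetric variant `∏_{i ≠ j} (x_i / x_j; q)_λ` of the weight function. -/
def symWeight (q t : ℝ) (x : Fin n → ℂ) : ℂ := ∏ i, ∏ j ∈ {i}ᶜ, qPoch (x i / x j) q t

theorem symWeight_eq (x : Fin n → ℂ) : symWeight q t x =
    ∏ i, ∏ j ∈ Finset.Ioi i, (qPoch (x i / x j) q t * qPoch (x j / x i) q t) := by
  unfold symWeight
  rw [← Finset.prod_prod_Ioi_mul_eq_prod_prod_off_diag (fun j i => qPoch (x i / x j) q t)]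

theorem symWeight_comp (x : Fin n → ℂ) (w : Equiv.Perm (Fin n)) :
    symWeight q t (x ∘ w) = symWeight q t x := by
  unfold symWeight
  rw [← Equiv.prod_comp w fun i => ∏ j ∈ {i}ᶜ, qPoch (x i / x j) q t]
  refine Finset.prod_congr rfl fun i _ => ?_
  refine Finset.prod_bij (fun j _ => w j) ?_ ?_ ?_ ?_
  · intro j hj
    simpa using hj
  · intro a _ b _ h
    exact w.injective h
  · intro b hb
    refine ⟨w⁻¹ b, ?_, by simp⟩
    simp only [Finset.mem_compl, Finset.mem_singleton] at hb ⊢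
    intro h
    exact hb (by rw [← h]; simp)
  · intro j _
    rfl

theorem symWeight_of_not_injective (hq : 0 < q) (hq1 : q < 1) {x : Fin n → ℂ}
    (hx : ∀ i, x i ≠ 0) (h : ¬ Function.Injective x) : symWeight q t x = 0 := by
  simp only [Function.Injective, not_forall] at h
  obtain ⟨i, j, h1, h2⟩ := h
  refine Finset.prod_eq_zero (Finset.mem_univ i) (Finset.prod_eq_zero (i := j) ?_ ?_)
  · simpa using fun h => h2 h.symm
  · rw [h1, div_self (hx j), qPoch_one hq hq1]

theorem weight_eq_symWeight_mul (hq : 0 < q) (hq1 : q < 1) (ht : 0 < t) (ht1 : t < 1)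
    {x : Fin n → ℂ} (hx : ∀ i, ‖x i‖ = 1) (hi : Function.Injective x) :
    weight q t x = symWeight q t x * symFactor (t : ℂ) fun i => (x i)⁻¹ := by
  have hx0 : ∀ i, x i ≠ 0 := fun i => norm_pos_iff.1 (by rw [hx]; exact one_pos)
  rw [weight_eq, symWeight_eq, symFactor, ← Finset.prod_mul_distrib]
  refine Finset.prod_congr rfl fun i _ => ?_
  rw [← Finset.prod_mul_distrib]
  refine Finset.prod_congr rfl fun j hj => ?_
  have hij : x i ≠ x j := fun h => (Finset.mem_Ioi.1 hj).ne (hi h)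
  have h0 := hx0 i
  have h1 := hx0 j
  rw [pairWeight_eq hq hq1 ht ht1 (by rw [norm_div, hx, hx, div_one])
    (by rwa [Ne, div_eq_one_iff_eq h1]), inv_div]
  congr 1
  have h2 : x i - x j ≠ 0 := sub_ne_zero.2 hij
  have h3 : x i / x j - 1 ≠ 0 := by
    rw [div_sub_one h1]
    exact div_ne_zero h2 h1
  have h4 : (x j)⁻¹ - (x i)⁻¹ ≠ 0 := by
    rw [inv_sub_inv h1 h0]
    exact div_ne_zero h2 (mul_ne_zero h1 h0)
  rw [div_eq_div_iff h3 h4]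
  field_simp

theorem continuous_symWeight (hq : 0 < q) (hq1 : q < 1) (ht : 0 < t) (ht1 : t < 1) :
    Continuous fun θ : Fin n → UnitAddCircle => symWeight q t (torusPt θ) := by
  unfold symWeight
  refine continuous_finsetProd _ fun i _ => continuous_finsetProd _ fun j _ => ?_
  rw [continuous_iff_continuousAt]
  intro θ
  refine ContinuousAt.comp (g := fun b => qPoch b q t) ?_ (continuous_div_torusPt i j).continuousAt
  refine (differentiableAt_qPoch hq hq1 ?_).continuousAt
  rw [norm_mul, norm_div_torusPt, one_mul, norm_ofReal_of_pos ht]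
  exact ht1

theorem symWeight_eq_normSq (hq : 0 < q) (hq1 : q < 1) {x : Fin n → ℂ} (hx : ∀ i, ‖x i‖ = 1) :
    symWeight q t x =
      ((∏ i, ∏ j ∈ Finset.Ioi i, Complex.normSq (qPoch (x i / x j) q t) : ℝ) : ℂ) := by
  rw [symWeight_eq]
  push_cast
  refine Finset.prod_congr rfl fun i _ => Finset.prod_congr rfl fun j _ => ?_
  rw [← Complex.mul_conj, conj_qPoch hq hq1]
  congr 2
  rw [map_div₀, ← Complex.inv_eq_conj (hx i), ← Complex.inv_eq_conj (hx j)]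
  simp [div_eq_mul_inv, mul_comm]

instance : Infinite UnitAddCircle := by
  have : Infinite (Set.Ico (0 : ℝ) (0 + 1)) :=
    Set.infinite_coe_iff.2 (Set.Ico_infinite (by norm_num))
  exact Infinite.of_injective _ (AddCircle.equivIco (1 : ℝ) 0).symm.injective

theorem torusPt_injective {θ : Fin n → UnitAddCircle} (h : Function.Injective θ) :
    Function.Injective (torusPt θ) := fun _ _ hij =>
  h (AddCircle.injective_toCircle one_ne_zero (Circle.coe_injective hij))

theorem constantTerm_symWeight_ne_zero (n : ℕ) (hq : 0 < q) (hq1 : q < 1) (ht : 0 < t)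
    (ht1 : t < 1) : constantTerm (symWeight (n := n) q t) ≠ 0 := by
  set r : (Fin n → UnitAddCircle) → ℝ := fun θ =>
    ∏ i, ∏ j ∈ Finset.Ioi i, Complex.normSq (qPoch (torusPt θ i / torusPt θ j) q t)
  have hr : ∀ θ, symWeight q t (torusPt θ) = (r θ : ℂ) := fun θ =>
    symWeight_eq_normSq hq hq1 (norm_torusPt θ)
  have hc : Continuous r := by
    have h := Complex.continuous_re.comp (continuous_symWeight (n := n) hq hq1 ht ht1)
    refine h.congr fun θ => ?_
    simp [hr]
  rw [constantTerm_eq]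
  simp only [hr]
  rw [integral_complex_ofReal]
  refine Complex.ofReal_ne_zero.2 (ne_of_gt ?_)
  set θ : Fin n → UnitAddCircle := fun i => Infinite.natEmbedding UnitAddCircle i
  have hθ : Function.Injective (torusPt θ) :=
    torusPt_injective ((Infinite.natEmbedding UnitAddCircle).injective.comp Fin.val_injective)
  refine hc.integral_pos_of_hasCompactSupport_nonneg_nonzero
    (HasCompactSupport.of_compactSpace _) (fun θ => ?_) (x := θ) ?_
  · exact Finset.prod_nonneg fun _ _ => Finset.prod_nonneg fun _ _ => Complex.normSq_nonneg _
  · refine Finset.prod_ne_zero_iff.2 fun i _ => Finset.prod_ne_zero_iff.2 fun j hj => ?_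
    rw [Ne, Complex.normSq_eq_zero]
    refine qPoch_ne_zero hq hq1 ht ht1 (norm_div_torusPt θ i j) ?_
    rw [Ne, div_eq_one_iff_eq (torusPt_ne_zero θ j)]
    exact fun h => (Finset.mem_Ioi.1 hj).ne (hθ h)

theorem bracketFactorial_ne_zero {K : Type*} [Field K] {t : K} (h : ∀ k : ℕ, k ≠ 0 → t ^ k ≠ 1)
    (k : ℕ) : bracketFactorial t k ≠ 0 := by
  refine Finset.prod_ne_zero_iff.2 fun i hi => div_ne_zero ?_ ?_
  · exact sub_ne_zero.2 (h i (by have := Finset.mem_Icc.1 hi; omega)).symm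
  · simpa [sub_ne_zero] using (h 1 one_ne_zero).symm

theorem constantTerm_weight_ne_zero (n : ℕ) (hq : 0 < q) (hq1 : q < 1) (ht : 0 < t)
    (ht1 : t < 1) : constantTerm (weight (n := n) q t) ≠ 0 := by
  have ht2 : ∀ k : ℕ, k ≠ 0 → (t : ℂ) ^ k ≠ 1 := fun k hk h =>
    (pow_lt_one₀ ht.le ht1 hk).ne (by exact_mod_cast h)
  have h1 : ∀ θ : Fin n → UnitAddCircle,
      ∑ w : Equiv.Perm (Fin n), weight q t (torusPt θ ∘ w) =
        bracketFactorial (t : ℂ) n * symWeight q t (torusPt θ) := by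
    intro θ
    by_cases hi : Function.Injective (torusPt θ)
    · have h2 : ∀ w : Equiv.Perm (Fin n), weight q t (torusPt θ ∘ w) = symWeight q t (torusPt θ) *
          symFactor (t : ℂ) ((fun i => (torusPt θ i)⁻¹) ∘ w) := by
        intro w
        rw [weight_eq_symWeight_mul hq hq1 ht ht1 (x := torusPt θ ∘ w)
          (fun i => norm_torusPt θ (w i))
          (hi.comp w.injective), symWeight_comp]
        rfl
      simp only [h2]
      rw [← Finset.mul_sum, sum_symFactor (t : ℂ) (by simpa using ht2 1 one_ne_zero)
        (fun i => (torusPt θ i)⁻¹) (inv_injective.comp hi)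
        (fun i => inv_ne_zero (torusPt_ne_zero θ i)), mul_comm]
    · rw [symWeight_of_not_injective hq hq1 (torusPt_ne_zero θ) hi, mul_zero]
      refine Finset.sum_eq_zero fun w _ => ?_
      refine weight_of_not_injective hq hq1 (fun i => torusPt_ne_zero θ (w i)) fun h => hi ?_
      have h2 := h.comp (w⁻¹).injective
      convert h2 using 1
      funext i
      simp
  have hc := continuous_weight (n := n) hq hq1 ht ht1
  have h2 : ∑ w : Equiv.Perm (Fin n), constantTerm (fun x => weight q t (x ∘ w)) =
      bracketFactorial (t : ℂ) n * constantTerm (symWeight (n := n) q t) := by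
    rw [← constantTerm_const_mul, constantTerm_eq]
    simp only [constantTerm_eq, ← h1]
    rw [integral_finsetSum]
    intro w _
    have hw : Continuous fun θ : Fin n → UnitAddCircle => θ ∘ w :=
      continuous_pi fun i => continuous_apply (w i)
    exact (hc.comp hw).integrable_of_hasCompactSupport (HasCompactSupport.of_compactSpace _)
  intro h0
  simp only [constantTerm_comp, h0, Finset.sum_const_zero] at h2
  exact mul_ne_zero (bracketFactorial_ne_zero ht2 n)
    (constantTerm_symWeight_ne_zero n hq hq1 ht ht1)
    h2.symm

end Weight

end

section

open MvPolynomial MeasureTheory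

/-- The pairing `CT (f(x) g(1/x) W(x))` of polynomials. -/
def pairing {n : ℕ} (q t : ℝ) (f g : MvPolynomial (Fin n) ℝ) : ℂ :=
  constantTerm fun x => aeval x f * aeval (fun i => (x i)⁻¹) g * weight q t x

section Pairing

variable {n : ℕ} {q t : ℝ}

theorem continuous_pairing_integrand (hq : 0 < q) (hq1 : q < 1) (ht : 0 < t) (ht1 : t < 1)
    (f g : MvPolynomial (Fin n) ℝ) : Continuous fun θ : Fin n → UnitAddCircle =>
      aeval (torusPt θ) f * aeval (fun i => (torusPt θ i)⁻¹) g * weight q t (torusPt θ) :=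
  ((continuous_aeval_torusPt f).mul (continuous_aeval_inv_torusPt g)).mul
    (continuous_weight hq hq1 ht ht1)

theorem pairing_add_left (hq : 0 < q) (hq1 : q < 1) (ht : 0 < t) (ht1 : t < 1)
    (f f' g : MvPolynomial (Fin n) ℝ) :
    pairing q t (f + f') g = pairing q t f g + pairing q t f' g := by
  unfold pairing
  rw [← constantTerm_add (continuous_pairing_integrand hq hq1 ht ht1 f g)
    (continuous_pairing_integrand hq hq1 ht ht1 f' g)]
  simp only [map_add, add_mul]

theorem pairing_add_right (hq : 0 < q) (hq1 : q < 1) (ht : 0 < t) (ht1 : t < 1)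
    (f g g' : MvPolynomial (Fin n) ℝ) :
    pairing q t f (g + g') = pairing q t f g + pairing q t f g' := by
  unfold pairing
  rw [← constantTerm_add (continuous_pairing_integrand hq hq1 ht ht1 f g)
    (continuous_pairing_integrand hq hq1 ht ht1 f g')]
  simp only [map_add, add_mul, mul_add]

theorem pairing_smul_left (c : ℝ) (f g : MvPolynomial (Fin n) ℝ) :
    pairing q t (c • f) g = c * pairing q t f g := by
  unfold pairing
  rw [← constantTerm_const_mul]
  simp only [map_smul, Complex.real_smul, mul_assoc]

theorem pairing_smul_right (c : ℝ) (f g : MvPolynomial (Fin n) ℝ) :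
    pairing q t f (c • g) = c * pairing q t f g := by
  unfold pairing
  rw [← constantTerm_const_mul]
  refine constantTerm_congr fun θ => ?_
  simp only [map_smul, Complex.real_smul]
  ring

/-- The pairing as a bilinear form. -/
def pairingForm (hq : 0 < q) (hq1 : q < 1) (ht : 0 < t) (ht1 : t < 1) :
    MvPolynomial (Fin n) ℝ →ₗ[ℝ] MvPolynomial (Fin n) ℝ →ₗ[ℝ] ℂ :=
  LinearMap.mk₂ ℝ (pairing q t) (pairing_add_left hq hq1 ht ht1)
    (fun c f g => by rw [pairing_smul_left, Complex.real_smul])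
    (pairing_add_right hq hq1 ht ht1)
    (fun c f g => by rw [pairing_smul_right, Complex.real_smul])

end Pairing

section Hecke

variable {m : ℕ} {q t : ℝ}

theorem aeval_hecke (i : Fin m) (s : ℝ) (f : MvPolynomial (Fin (m + 1)) ℝ)
    (x : Fin (m + 1) → ℂ) :
    (x i.castSucc - x i.succ) * aeval x (hecke s i f) =
      (1 - s) * x i.succ * aeval x f +
        (s * x i.castSucc - x i.succ) * aeval (x ∘ adj i) f := by
  have h := congrArg (aeval x) (hecke_spec s i f)
  simpa [aeval_rename] using h

theorem comp_adj_castSucc {α : Type*} (i : Fin m) (x : Fin (m + 1) → α) :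
    (x ∘ adj i) i.castSucc = x i.succ := by simp [adj]

theorem comp_adj_succ {α : Type*} (i : Fin m) (x : Fin (m + 1) → α) :
    (x ∘ adj i) i.succ = x i.castSucc := by simp [adj]

theorem pairing_integrand_hecke (hq : 0 < q) (hq1 : q < 1) (ht : 0 < t) (ht1 : t < 1)
    (i : Fin m) (f g : MvPolynomial (Fin (m + 1)) ℝ) {x : Fin (m + 1) → ℂ}
    (hx : ∀ k, ‖x k‖ = 1) :
    (aeval x (hecke t i f) * aeval (fun k => (x k)⁻¹) (hecke t⁻¹ i g) -
        aeval x f * aeval (fun k => (x k)⁻¹) g) * weight q t x +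
      (aeval (x ∘ adj i) (hecke t i f) * aeval (fun k => ((x ∘ adj i) k)⁻¹) (hecke t⁻¹ i g) -
        aeval (x ∘ adj i) f * aeval (fun k => ((x ∘ adj i) k)⁻¹) g) *
          weight q t (x ∘ adj i) = 0 := by
  have hx0 : ∀ k, x k ≠ 0 := fun k => norm_pos_iff.1 (by rw [hx]; exact one_pos)
  by_cases hi : Function.Injective x
  swap
  · rw [weight_of_not_injective hq hq1 hx0 hi, weight_of_not_injective hq hq1
      (x := x ∘ adj i) (fun k => hx0 _), mul_zero, mul_zero, add_zero]
    intro h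
    refine hi ?_
    have h2 := h.comp (adj i).injective
    convert h2 using 1
    funext k
    simp [adj]
  have hss : (x ∘ adj i) ∘ adj i = x := by
    funext k
    simp [adj]
  set y : Fin (m + 1) → ℂ := fun k => (x k)⁻¹ with hy
  have hyc : (fun k => ((x ∘ adj i) k)⁻¹) = y ∘ adj i := rfl
  have hyy : (y ∘ adj i) ∘ adj i = y := by
    funext k
    simp [adj]
  rw [hyc]
  have a1 := aeval_hecke i t f x
  have a2 := aeval_hecke i t f (x ∘ adj i)
  have b1 := aeval_hecke i t⁻¹ g y
  have b2 := aeval_hecke i t⁻¹ g (y ∘ adj i)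
  rw [hss, comp_adj_castSucc, comp_adj_succ] at a2
  rw [hyy, comp_adj_castSucc, comp_adj_succ] at b2
  have w1 := weight_eq_symWeight_mul hq hq1 ht ht1 hx hi
  have w2 := weight_eq_symWeight_mul hq hq1 ht ht1 (x := x ∘ adj i) (fun k => hx _)
    (hi.comp (adj i).injective)
  rw [symWeight_comp, hyc] at w2
  have w3 := symFactor_adj (t : ℂ) y i
  rw [w1, w2]
  have hu := hx0 i.castSucc
  have hv := hx0 i.succ
  have huv : x i.castSucc - x i.succ ≠ 0 := sub_ne_zero.2 fun h => castSucc_ne_succ i (hi h)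
  have ht0 : (t : ℂ) ≠ 0 := by exact_mod_cast ht.ne'
  have hutv : x i.castSucc - t * x i.succ ≠ 0 := by
    intro h
    have h2 := congrArg norm (sub_eq_zero.1 h)
    rw [norm_mul, hx, hx, norm_ofReal_of_pos ht, mul_one] at h2
    exact ht1.ne' h2
  simp only [hy] at b1 b2 w3
  rw [← hy] at b1 b2 w3
  push_cast at b1 b2
  generalize aeval x (hecke t i f) = A at *
  generalize aeval (x ∘ adj i) (hecke t i f) = A' at *
  generalize aeval y (hecke t⁻¹ i g) = B at *
  generalize aeval (y ∘ adj i) (hecke t⁻¹ i g) = B' at *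
  generalize aeval x f = F at *
  generalize aeval (x ∘ adj i) f = F' at *
  generalize aeval y g = G at *
  generalize aeval (y ∘ adj i) g = G' at *
  generalize symFactor (t : ℂ) y = S at *
  generalize symFactor (t : ℂ) (y ∘ adj i) = S' at *
  generalize symWeight q t x = D at *
  generalize x i.castSucc = u at *
  generalize x i.succ = v at *
  have hvu : v - u ≠ 0 := by rwa [← neg_sub, neg_ne_zero]
  have hiuv : u⁻¹ - v⁻¹ ≠ 0 := by
    rw [inv_sub_inv hu hv]
    exact div_ne_zero hvu (mul_ne_zero hu hv)
  have hivu : v⁻¹ - u⁻¹ ≠ 0 := by rwa [← neg_sub, neg_ne_zero]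
  have eA : A = ((1 - t) * v * F + (t * u - v) * F') / (u - v) := by
    rw [eq_div_iff huv]; linear_combination a1
  have eA' : A' = -((1 - t) * u * F' + (t * v - u) * F) / (u - v) := by
    rw [eq_div_iff huv]; linear_combination -a2
  have eB : B = -((t - 1) * u * G + (v - t * u) * G') / (t * (u - v)) := by
    rw [eq_div_iff (mul_ne_zero ht0 huv)]
    field_simp at b1
    linear_combination -b1
  have eB' : B' = ((t - 1) * v * G' + (u - t * v) * G) / (t * (u - v)) := by
    rw [eq_div_iff (mul_ne_zero ht0 huv)]
    field_simp at b2
    linear_combination b2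
  have eS : S' = -(S * (v - t * u)) / (u - t * v) := by
    rw [eq_div_iff hutv]
    have e1 : (v⁻¹ - t * u⁻¹) / (v⁻¹ - u⁻¹) = (u - t * v) / (u - v) := by
      rw [div_eq_div_iff hivu huv]; field_simp
    have e2 : (u⁻¹ - t * v⁻¹) / (u⁻¹ - v⁻¹) = -(v - t * u) / (u - v) := by
      rw [div_eq_div_iff hiuv huv]; field_simp; ring
    rw [e1, e2] at w3
    field_simp at w3
    linear_combination w3
  rw [eA, eA', eB, eB', eS]
  field_simp
  ring

theorem pairing_hecke (hq : 0 < q) (hq1 : q < 1) (ht : 0 < t) (ht1 : t < 1)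
    (i : Fin m) (f g : MvPolynomial (Fin (m + 1)) ℝ) :
    pairing q t (hecke t i f) (hecke t⁻¹ i g) = pairing q t f g := by
  set F : (Fin (m + 1) → ℂ) → ℂ := fun x =>
    aeval x (hecke t i f) * aeval (fun k => (x k)⁻¹) (hecke t⁻¹ i g) * weight q t x -
      aeval x f * aeval (fun k => (x k)⁻¹) g * weight q t x with hF
  have hc : Continuous fun θ => F (torusPt θ) :=
    (continuous_pairing_integrand hq hq1 ht ht1 (hecke t i f) (hecke t⁻¹ i g)).sub
      (continuous_pairing_integrand hq hq1 ht ht1 f g)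
  have hs : Continuous fun θ : Fin (m + 1) → UnitAddCircle => θ ∘ adj i :=
    continuous_pi fun k => continuous_apply (adj i k)
  have h1 : constantTerm F + constantTerm (fun x => F (x ∘ adj i)) = 0 := by
    rw [← constantTerm_add (G := fun x => F (x ∘ adj i)) hc (hc.comp hs), constantTerm_eq]
    refine integral_eq_zero_of_ae (.of_forall fun θ => ?_)
    have h := pairing_integrand_hecke hq hq1 ht ht1 i f g (norm_torusPt θ)
    simp only [hF, Pi.zero_apply]
    linear_combination h
  rw [constantTerm_comp] at h1
  have h2 : constantTerm F = 0 := by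
    linear_combination h1 / 2
  rw [hF, constantTerm_sub
    (continuous_pairing_integrand hq hq1 ht ht1 (hecke t i f) (hecke t⁻¹ i g))
    (continuous_pairing_integrand hq hq1 ht ht1 f g)] at h2
  exact sub_eq_zero.1 h2

end Hecke

end

section

open MvPolynomial MeasureTheory

theorem integral_toCircle_eq_circleAverage (G : ℂ → ℂ) (R : ℝ) :
    ∫ φ : UnitAddCircle, G (R * (AddCircle.toCircle φ : ℂ)) ∂AddCircle.haarAddCircle =
      Real.circleAverage G 0 R := by
  rw [AddCircle.integral_haarAddCircle, inv_one, one_smul,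
    ← UnitAddCircle.intervalIntegral_preimage 0, Real.circleAverage_def]
  have h := intervalIntegral.integral_comp_mul_left (a := 0) (b := 1)
    (fun θ => G (circleMap 0 R θ)) (c := 2 * Real.pi) (by positivity)
  rw [mul_zero, mul_one] at h
  rw [← h, zero_add]
  refine intervalIntegral.integral_congr fun x _ => ?_
  simp only [AddCircle.toCircle_apply_mk, Circle.coe_exp, circleMap, div_one, zero_add]

theorem integral_toCircle_dilate {q : ℝ} (hq : 0 < q) (hq1 : q < 1) {G : ℂ → ℂ}
    (hG : ∀ z, q ≤ ‖z‖ → ‖z‖ ≤ 1 → DifferentiableAt ℂ G z) :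
    ∫ φ : UnitAddCircle, G (q * (AddCircle.toCircle φ : ℂ)) ∂AddCircle.haarAddCircle =
      ∫ φ : UnitAddCircle, G (AddCircle.toCircle φ : ℂ) ∂AddCircle.haarAddCircle := by
  have h1 := integral_toCircle_eq_circleAverage G 1
  simp only [Complex.ofReal_one, one_mul] at h1
  rw [h1, integral_toCircle_eq_circleAverage, Real.circleAverage_eq_circleIntegral hq.ne',
    Real.circleAverage_eq_circleIntegral one_ne_zero]
  congr 1
  refine (Complex.circleIntegral_sub_center_inv_smul_eq_of_differentiable_on_annulus_off_countable
    hq hq1.le Set.countable_empty (fun z hz => ?_) fun z hz => ?_).symm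
  · simp only [Set.mem_sdiff, Metric.mem_closedBall, dist_zero_right, Metric.mem_ball, not_lt] at hz
    exact (hG z hz.2 hz.1).continuousAt.continuousWithinAt
  · simp only [Set.mem_sdiff, Metric.mem_closedBall, dist_zero_right, Metric.mem_ball, not_le] at hz
    exact hG z hz.1.2.le hz.1.1.le

theorem differentiableAt_aeval {n : ℕ} {z : ℂ} (f : MvPolynomial (Fin n) ℝ)
    {φ : ℂ → Fin n → ℂ} (h : ∀ i, DifferentiableAt ℂ (fun z => φ z i) z) :
    DifferentiableAt ℂ (fun z => aeval (φ z) f) z := by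
  induction f using MvPolynomial.induction_on with
  | C a => simp
  | add f g hf hg => simp only [map_add]; exact hf.add hg
  | mul_X f i hf => simp only [map_mul, aeval_X]; exact hf.mul (h i)

variable {m : ℕ} {q t : ℝ}

theorem constantTerm_eq_integral_insertNth (p : Fin (m + 1)) {F : (Fin (m + 1) → ℂ) → ℂ}
    (hF : Continuous fun θ => F (torusPt θ)) :
    constantTerm F = ∫ θ : Fin m → UnitAddCircle, ∫ φ : UnitAddCircle,
      F (torusPt (p.insertNth (α := fun _ => UnitAddCircle) φ θ)) ∂AddCircle.haarAddCircle
        ∂torusMeasure m := by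
  have h := measurePreserving_piFinSuccAbove
    (fun _ : Fin (m + 1) => (AddCircle.haarAddCircle : Measure UnitAddCircle)) p
  have h2 := h.symm.integral_comp' (g := fun θ => F (torusPt θ))
  rw [constantTerm_eq, ← h2]
  refine integral_prod_symm (fun z => F (torusPt
    (p.insertNth (α := fun _ => UnitAddCircle) z.1 z.2))) ?_
  refine Continuous.integrable_of_hasCompactSupport ?_ (HasCompactSupport.of_compactSpace _)
  exact hF.comp (Continuous.finInsertNth p continuous_fst continuous_snd)

/-- The map `x ↦ (q x_n, x_1, …, x_{n-1})` that underlies `rot q`. -/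
def rotPt (q : ℂ) (x : Fin (m + 1) → ℂ) : Fin (m + 1) → ℂ :=
  Fin.cons (q * x (Fin.last m)) fun k => x k.castSucc

theorem aeval_rot (f : MvPolynomial (Fin (m + 1)) ℝ) (x : Fin (m + 1) → ℂ) :
    aeval x (rot q f) = aeval (rotPt q x) f := by
  have h : (aeval x : MvPolynomial (Fin (m + 1)) ℝ →ₐ[ℝ] ℂ).comp (rot q) = aeval (rotPt q x) := by
    refine MvPolynomial.algHom_ext fun i => ?_
    refine Fin.cases ?_ (fun k => ?_) i
    · simp [rotPt]
    · simp [rotPt]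
  exact DFunLike.congr_fun h f

theorem rotPt_inv (x : Fin (m + 1) → ℂ) :
    rotPt ((q⁻¹ : ℝ) : ℂ) (fun i => (x i)⁻¹) = fun i => (rotPt q x i)⁻¹ := by
  funext i
  refine Fin.cases ?_ (fun k => ?_) i
  · simp [rotPt, mul_comm]
  · simp [rotPt]

theorem weight_cons (q t : ℝ) (a : ℂ) (y : Fin m → ℂ) :
    weight q t (Fin.cons a y : Fin (m + 1) → ℂ) =
      (∏ j, pairWeight q t (a / y j)) * weight q t y := by
  rw [weight_eq, weight_eq, Fin.prod_univ_succ, Fin.prod_Ioi_zero]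
  congr 1
  refine Finset.prod_congr rfl fun i _ => ?_
  rw [Fin.prod_Ioi_succ]
  rfl

theorem prod_Ioi_castSucc {M : Type*} [CommMonoid M] (i : Fin m) (f : Fin (m + 1) → M) :
    ∏ j ∈ Finset.Ioi i.castSucc, f j = f (Fin.last m) * ∏ j ∈ Finset.Ioi i, f j.castSucc := by
  have h : ∀ {k : ℕ} (a : Fin k) (g : Fin k → M),
      ∏ j ∈ Finset.Ioi a, g j = ∏ j, if a < j then g j else 1 := by
    intro k a g
    rw [← Finset.prod_filter]
    refine Finset.prod_congr ?_ fun _ _ => rfl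
    ext j
    simp
  rw [h, h, Fin.prod_univ_castSucc, mul_comm]
  simp [Fin.castSucc_lt_last]

theorem weight_rotPt (hq : 0 < q) (t : ℝ) (x : Fin (m + 1) → ℂ) :
    weight q t (rotPt q x) = weight q t x := by
  unfold rotPt
  rw [weight_cons]
  have h : ∀ j : Fin m, pairWeight q t (q * x (Fin.last m) / x j.castSucc) =
      pairWeight q t (x j.castSucc / x (Fin.last m)) := by
    intro j
    rw [← pairWeight_mul_inv hq t (x j.castSucc / x (Fin.last m)), inv_div, mul_div_assoc]
  simp only [h]
  rw [weight_eq, weight_eq, ← Finset.prod_mul_distrib, Fin.prod_univ_castSucc]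
  simp only [prod_Ioi_castSucc]
  rw [show Finset.Ioi (Fin.last m) = ∅ from Finset.Ioi_eq_empty.2 fun k _ => Fin.le_last k]
  simp

theorem pairing_rot (hq : 0 < q) (hq1 : q < 1) (ht : 0 < t) (ht1 : t < 1)
    (f g : MvPolynomial (Fin (m + 1)) ℝ) :
    pairing q t (rot q f) (rot q⁻¹ g) = pairing q t f g := by
  set h : (Fin (m + 1) → ℂ) → ℂ := fun x =>
    aeval x f * aeval (fun i => (x i)⁻¹) g * weight q t x with hh
  have h1 : pairing q t (rot q f) (rot q⁻¹ g) = constantTerm fun x => h (rotPt q x) := by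
    refine constantTerm_congr fun θ => ?_
    simp only [hh]
    rw [aeval_rot, aeval_rot, rotPt_inv, weight_rotPt hq]
  have hc := continuous_pairing_integrand hq hq1 ht ht1 f g
  have hc' : Continuous fun θ => h (rotPt q (torusPt θ)) := by
    have := continuous_pairing_integrand hq hq1 ht ht1 (rot q f) (rot q⁻¹ g)
    refine this.congr fun θ => ?_
    simp only [hh]
    rw [aeval_rot, aeval_rot, rotPt_inv, weight_rotPt hq]
  rw [h1, constantTerm_eq_integral_insertNth (F := fun x => h (rotPt q x)) (Fin.last m) hc']
  unfold pairing
  rw [constantTerm_eq_integral_insertNth 0 hc]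
  refine integral_congr_ae (.of_forall fun θ => ?_)
  have e1 : ∀ φ : UnitAddCircle, rotPt q (torusPt ((Fin.last m).insertNth
      (α := fun _ => UnitAddCircle) φ θ)) =
        Fin.cons ((q : ℂ) * (AddCircle.toCircle φ : ℂ)) (torusPt θ) := by
    intro φ
    unfold rotPt
    congr 1
    · simp [torusPt]
    · funext k
      simp [torusPt]
  have e2 : ∀ φ : UnitAddCircle, torusPt ((0 : Fin (m + 1)).insertNth
      (α := fun _ => UnitAddCircle) φ θ) =
        Fin.cons ((AddCircle.toCircle φ : ℂ)) (torusPt θ) := by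
    intro φ
    funext k
    refine Fin.cases ?_ (fun k => ?_) k <;> simp [torusPt]
  simp only [e1, e2]
  refine integral_toCircle_dilate hq hq1
    (G := fun z => h (Fin.cons z (torusPt θ) : Fin (m + 1) → ℂ)) fun z hz1 hz2 => ?_
  have hz : z ≠ 0 := norm_pos_iff.1 (hq.trans_le hz1)
  simp only [hh, weight_cons]
  refine ((differentiableAt_aeval f fun i => ?_).mul (differentiableAt_aeval g fun i => ?_)).mul
    (DifferentiableAt.mul ?_ (differentiableAt_const _))
  · refine Fin.cases ?_ (fun k => ?_) i
    · simp
    · simp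
  · refine Fin.cases ?_ (fun k => ?_) i
    · simpa using differentiableAt_inv hz
    · simp
  · refine DifferentiableAt.fun_finsetProd fun j _ => ?_
    refine DifferentiableAt.comp (g := pairWeight q t) z ?_ (by fun_prop)
    have hn : ‖z / torusPt θ j‖ = ‖z‖ := by rw [norm_div, norm_torusPt, div_one]
    exact differentiableAt_pairWeight hq hq1 ht ht1 (by rwa [hn]) (by rwa [hn])

end

section

open MvPolynomial

variable {m : ℕ} {K : Type*} [Field K] {V : Type*} [AddCommGroup V] [Module K V]

/-- A bilinear form for which the operators with parameters `q⁻¹`, `t⁻¹` are the inverse adjoints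
of the operators with parameters `q`, `t`. -/
structure IsInvariantForm (q t : K)
    (B : MvPolynomial (Fin (m + 1)) K →ₗ[K] MvPolynomial (Fin (m + 1)) K →ₗ[K] V) : Prop where
  hecke : ∀ (i : Fin m) f g, B (hecke t i f) (hecke t⁻¹ i g) = B f g
  rot : ∀ f g, B (rot q f) (rot q⁻¹ g) = B f g
  mulX : ∀ (k : Fin (m + 1)) f g, B (X k * f) (X k * g) = B f g

namespace IsInvariantForm

variable {q t : K}
  {B : MvPolynomial (Fin (m + 1)) K →ₗ[K] MvPolynomial (Fin (m + 1)) K →ₗ[K] V}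

theorem heckeN (hB : IsInvariantForm q t B) {k : ℕ} (hk : k < m)
    (f g : MvPolynomial (Fin (m + 1)) K) :
    B (heckeN m t k f) (Macdonald.heckeN m t⁻¹ k g) = B f g := by
  rw [heckeN_of_lt t hk, heckeN_of_lt t⁻¹ hk]
  exact hB.hecke _ f g

theorem heckeInv (hB : IsInvariantForm q t B) (ht : t ≠ 0) {k : ℕ} (hk : k < m)
    (f g : MvPolynomial (Fin (m + 1)) K) :
    B (heckeInv m t k f) (Macdonald.heckeInv m t⁻¹ k g) = B f g := by
  rw [← hB.heckeN hk, ← Module.End.mul_apply, ← Module.End.mul_apply, heckeN_mul_inv ht hk,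
    heckeN_mul_inv (inv_ne_zero ht) hk]
  rfl

theorem headInv (hB : IsInvariantForm q t B) (ht : t ≠ 0) {k : ℕ} (hk : k ≤ m) :
    ∀ f g : MvPolynomial (Fin (m + 1)) K,
      B (headInv m t k f) (Macdonald.headInv m t⁻¹ k g) = B f g := by
  induction k with
  | zero => exact fun _ _ => rfl
  | succ k ih => exact fun f g => (ih (by omega) _ _).trans (hB.heckeInv ht (by omega) f g)

theorem tail (hB : IsInvariantForm q t B) {k : ℕ} (hk : k ≤ m)
    (f g : MvPolynomial (Fin (m + 1)) K) :
    B (tail m t k f) (Macdonald.tail m t⁻¹ k g) = B f g := by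
  obtain ⟨d, hd⟩ : ∃ d, m = k + d := ⟨m - k, by omega⟩
  induction d generalizing k with
  | zero =>
    have : k = m := by omega
    rw [this, tail_self, tail_self]
    rfl
  | succ d ih =>
    rw [tail_of_lt t (by omega), tail_of_lt t⁻¹ (by omega), Module.End.mul_apply,
      Module.End.mul_apply, hB.heckeN (by omega)]
    exact ih (by omega) (by omega)

theorem cherednik (hB : IsInvariantForm q t B) (ht : t ≠ 0) {k : ℕ} (hk : k ≤ m)
    (f g : MvPolynomial (Fin (m + 1)) K) :
    B (cherednik m q t k f) (Macdonald.cherednik m q⁻¹ t⁻¹ k g) = B f g := by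
  unfold Macdonald.cherednik
  rw [LinearMap.smul_apply, LinearMap.smul_apply, map_smul, map_smul, LinearMap.smul_apply,
    smul_smul, inv_pow, inv_mul_cancel₀ (pow_ne_zero k ht), one_smul]
  simp only [Module.End.mul_apply, omg_apply]
  rw [hB.tail hk, hB.rot, hB.headInv ht hk]

theorem raiseOp (hB : IsInvariantForm q t B) (f g : MvPolynomial (Fin (m + 1)) K) :
    B (raiseOp m q f) (Macdonald.raiseOp m q⁻¹ g) = B f g := by
  unfold Macdonald.raiseOp
  simp only [Module.End.mul_apply, omg_apply, mulX_apply]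
  rw [hB.mulX, hB.rot]

theorem eq_zero_of_ne (hB : IsInvariantForm q t B) (h : Admissible q t)
    {η ν : Fin (m + 1) → ℕ} (hne : η ≠ ν) :
    B (nonsymm q t η) (nonsymm q⁻¹ t⁻¹ ν) = 0 := by
  by_contra h0
  refine hne (spec_separates h fun k => ?_)
  have h1 := hB.cherednik h.t_ne (Nat.lt_succ_iff.1 k.2) (nonsymm q t η) (nonsymm q⁻¹ t⁻¹ ν)
  rw [isJoint_nonsymm h η k, isJoint_nonsymm h.inv ν k, map_smul, map_smul,
    LinearMap.smul_apply, smul_smul, spec_inv] at h1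
  have h2 : ((spec q t ν k)⁻¹ * spec q t η k - 1) • B (nonsymm q t η) (nonsymm q⁻¹ t⁻¹ ν) = 0 := by
    rw [sub_smul, h1, one_smul, sub_self]
  have h3 := (smul_eq_zero.1 h2).resolve_right h0
  have h4 := spec_ne_zero h ν k
  rwa [sub_eq_zero, inv_mul_eq_one₀ h4, eq_comm] at h3

theorem nonsymm_raise (hB : IsInvariantForm q t B) (h : Admissible q t)
    (η : Fin (m + 1) → ℕ) :
    B (nonsymm q t (raise η)) (nonsymm q⁻¹ t⁻¹ (raise η)) =
      B (nonsymm q t η) (nonsymm q⁻¹ t⁻¹ η) := by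
  have h1 := hB.raiseOp (nonsymm q t η) (nonsymm q⁻¹ t⁻¹ η)
  rw [raiseOp_nonsymm h, raiseOp_nonsymm h.inv, map_smul, map_smul, LinearMap.smul_apply,
    smul_smul, inv_pow, inv_mul_cancel₀ (pow_ne_zero _ h.q_ne), one_smul] at h1
  exact h1

theorem nonsymm_adj (hB : IsInvariantForm q t B) (h : Admissible q t) {η : Fin (m + 1) → ℕ}
    {i : Fin m} (hi : η i.castSucc < η i.succ) :
    B (nonsymm q t (η ∘ adj i)) (nonsymm q⁻¹ t⁻¹ (η ∘ adj i)) =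
      (1 - shiftCoeff q t η i * shiftCoeff q⁻¹ t⁻¹ η i) •
        B (nonsymm q t η) (nonsymm q⁻¹ t⁻¹ η) := by
  have hne : η ∘ adj i ≠ η := by
    intro e
    have := congrFun e i.castSucc
    rw [comp_adj_castSucc] at this
    omega
  have e1 := hecke_nonsymm_of_lt h hi
  have e2 := hecke_nonsymm_of_lt h.inv hi
  have o1 := hB.eq_zero_of_ne h hne
  have o2 := hB.eq_zero_of_ne h hne.symm
  have hT := hB.hecke i (nonsymm q t η) (nonsymm q⁻¹ t⁻¹ η)
  rw [eq_sub_of_add_eq e1, eq_sub_of_add_eq e2] at hT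
  simp only [map_sub, map_smul, LinearMap.sub_apply, LinearMap.smul_apply, o1, o2, smul_zero,
    sub_zero, zero_sub, smul_neg, sub_neg_eq_add, smul_smul,
    inv_mul_cancel₀ h.t_ne, one_smul] at hT
  rw [sub_smul, one_smul, mul_comm (shiftCoeff q t η i)]
  exact eq_sub_of_add_eq hT

theorem shiftCoeff_mul_shiftCoeff_inv (h : Admissible q t) {η : Fin (m + 1) → ℕ}
    {i : Fin m} (hi : η i.castSucc < η i.succ) :
    1 - shiftCoeff q t η i * shiftCoeff q⁻¹ t⁻¹ η i =
      (1 - q ^ (η i.succ - η i.castSucc) * t ^ (coleg η i.castSucc - coleg η i.succ - 1)) *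
        (1 - q ^ (η i.succ - η i.castSucc) * t ^ (coleg η i.castSucc - coleg η i.succ + 1)) /
        (1 - q ^ (η i.succ - η i.castSucc) * t ^ (coleg η i.castSucc - coleg η i.succ)) ^ 2 := by
  have c1 := shiftCoeff_of_lt h hi
  have c2 := shiftCoeff_of_lt h.inv hi
  have hlt : coleg η i.succ < coleg η i.castSucc := coleg_lt_of_prec (by unfold Prec; omega)
  obtain ⟨b, hb⟩ : ∃ b, coleg η i.castSucc - coleg η i.succ = b + 1 :=
    ⟨coleg η i.castSucc - coleg η i.succ - 1, by omega⟩
  rw [hb] at c1 c2 ⊢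
  rw [Nat.add_sub_cancel]
  have hr : 1 - q ^ (η i.succ - η i.castSucc) * t ^ (b + 1) ≠ 0 :=
    h.one_sub_ne (Or.inr b.succ_ne_zero)
  generalize shiftCoeff q t η i = c at *
  generalize shiftCoeff q⁻¹ t⁻¹ η i = c' at *
  have hq := pow_ne_zero (η i.succ - η i.castSucc) h.q_ne
  have ht := h.t_ne
  have htb := pow_ne_zero b ht
  rw [inv_pow, inv_pow] at c2
  generalize q ^ (η i.succ - η i.castSucc) = Q at *
  simp only [pow_succ] at c1 c2 hr ⊢
  generalize t ^ b = T at *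
  have h1 : c = (1 - t) / (1 - Q * (T * t)) := by rw [eq_div_iff hr, c1]
  have h2 : c' = -((1 - t) * (Q * T)) / -(1 - Q * (T * t)) := by
    rw [eq_div_iff (neg_ne_zero.2 hr)]
    field_simp at c2
    linear_combination c2
  rw [h1, h2, neg_div_neg_eq, div_mul_div_comm, ← pow_two, one_sub_div (pow_ne_zero 2 hr)]
  congr 1 <;> ring

theorem norm_nonsymm (hB : IsInvariantForm q t B) (h : Admissible q t)
    (η : Fin (m + 1) → ℕ) :
    B (nonsymm q t η) (nonsymm q⁻¹ t⁻¹ η) =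
      (dConst' q t η * eConst q t η / (dConst q t η * eConst' q t η)) • B 1 1 := by
  induction η using composition_induction with
  | zero =>
    rw [nonsymm_zero h, nonsymm_zero h.inv]
    simp [dConst, dConst', eConst, eConst']
  | raise η ih =>
    rw [hB.nonsymm_raise h, ih, dConst_raise, dConst'_raise, eConst_raise, eConst'_raise]
    congr 1
    have h1 := h.one_sub_ne (a := η 0 + 1) (b := m + 1 - coleg η 0) (Or.inl (Nat.succ_ne_zero _))
    have h2 := h.one_sub_ne (a := η 0 + 1) (b := m - coleg η 0) (Or.inl (Nat.succ_ne_zero _))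
    have h3 := dConst_ne_zero h η
    have h4 := eConst'_ne_zero h η
    field_simp
  | adj η i hi ih =>
    rw [hB.nonsymm_adj h hi, ih, smul_smul, shiftCoeff_mul_shiftCoeff_inv h hi]
    congr 1
    have hi' : (η ∘ adj i) i.succ < (η ∘ adj i) i.castSucc := by
      rwa [comp_adj_succ, comp_adj_castSucc]
    have hss : (η ∘ adj i) ∘ adj i = η := comp_adj_adj i η
    have hne := castSucc_ne_succ i
    have d1 := dConst_adj q t hi'
    have d2 := dConst'_adj q t hi'
    have e1 := eConst_adj q t hi'.ne
    have e2 := eConst'_adj q t hi'.ne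
    rw [hss] at d1 d2 e1 e2
    rw [coleg_adj i hi.ne, coleg_adj i hi.ne, comp_adj_succ, comp_adj_castSucc,
      Equiv.swap_apply_left, Equiv.swap_apply_right] at d1 d2
    rw [← e1, ← e2]
    have hlt : coleg η i.succ < coleg η i.castSucc := coleg_lt_of_prec (by unfold Prec; omega)
    have h0 := h.one_sub_ne (a := η i.succ - η i.castSucc)
      (b := coleg η i.castSucc - coleg η i.succ) (Or.inl (by omega))
    have h1 := dConst_ne_zero h η
    have h2 := dConst_ne_zero h (η ∘ adj i)
    have h3 := eConst'_ne_zero h η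
    rw [pow_two, div_mul_div_comm, div_eq_div_iff (mul_ne_zero (mul_ne_zero h0 h0)
      (mul_ne_zero h1 h3)) (mul_ne_zero h2 h3)]
    generalize 1 - q ^ (η i.succ - η i.castSucc) * t ^ (coleg η i.castSucc - coleg η i.succ - 1) =
      a at *
    generalize 1 - q ^ (η i.succ - η i.castSucc) * t ^ (coleg η i.castSucc - coleg η i.succ + 1) =
      b at *
    generalize 1 - q ^ (η i.succ - η i.castSucc) * t ^ (coleg η i.castSucc - coleg η i.succ) =
      r at *
    linear_combination (b * eConst q t η * dConst q t (η ∘ adj i) * eConst' q t η) * d2 -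
      (dConst' q t (η ∘ adj i) * r * eConst q t η * eConst' q t η) * d1

theorem evalT_mul_form_adj (h : Admissible q t)
    {L : MvPolynomial (Fin (m + 1)) K →ₗ[K] V}
    (hL : ∀ (i : Fin m) f, L (Macdonald.hecke t i f) = t • L f) (η : Fin (m + 1) → ℕ) (i : Fin m) :
    evalT t (nonsymm q t η) • L (nonsymm q t (η ∘ adj i)) =
      evalT t (nonsymm q t (η ∘ adj i)) • L (nonsymm q t η) := by
  have key : ∀ ν : Fin (m + 1) → ℕ, ν i.castSucc < ν i.succ →
      evalT t (nonsymm q t ν) • L (nonsymm q t (ν ∘ adj i)) =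
        evalT t (nonsymm q t (ν ∘ adj i)) • L (nonsymm q t ν) := by
    intro ν hν
    have e := hecke_nonsymm_of_lt h hν
    have e1 := congrArg (evalT t) e
    have e2 := congrArg L e
    rw [map_add, evalT_hecke h.t_ne h.t_ne_one, evalT_smul, evalT_smul, ← add_mul] at e1
    rw [map_add, hL, map_smul, map_smul, ← add_smul] at e2
    refine (smul_right_inj h.t_ne).1 ?_
    rw [smul_comm, ← e2, smul_smul, smul_smul, ← e1, mul_comm]
  rcases lt_trichotomy (η i.castSucc) (η i.succ) with hi | hi | hi
  · exact key η hi
  · rw [comp_adj_of_eq hi]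
  · have h1 := key (η ∘ adj i) (by rwa [comp_adj_succ, comp_adj_castSucc])
    rw [comp_adj_adj] at h1
    exact h1.symm

theorem evalT_mul_form_comp (h : Admissible q t)
    {L : MvPolynomial (Fin (m + 1)) K →ₗ[K] V}
    (hL : ∀ (i : Fin m) f, L (Macdonald.hecke t i f) = t • L f) (η : Fin (m + 1) → ℕ)
    (σ : Equiv.Perm (Fin (m + 1))) :
    evalT t (nonsymm q t η) • L (nonsymm q t (η ∘ σ)) =
      evalT t (nonsymm q t (η ∘ σ)) • L (nonsymm q t η) := by
  have hσ : σ ∈ Submonoid.closure (Set.range fun i : Fin m => Equiv.swap i.castSucc i.succ) := by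
    rw [Equiv.Perm.mclosure_swap_castSucc_succ]
    exact Submonoid.mem_top σ
  induction hσ using Submonoid.closure_induction generalizing η with
  | mem _ hx =>
    obtain ⟨i, rfl⟩ := hx
    exact evalT_mul_form_adj h hL η i
  | one => rfl
  | mul x y _ _ hx hy =>
    have h1 := hx η
    have h2 := hy (η ∘ x)
    rw [Equiv.Perm.coe_mul, ← Function.comp_assoc]
    refine (smul_right_inj (evalT_nonsymm_ne_zero h (η ∘ x))).1 ?_
    rw [smul_comm, h2, smul_comm, h1, smul_comm]

theorem symP_left (hB : IsInvariantForm q t B) (h : Admissible q t) {κ : Fin (m + 1) → ℕ}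
    (hκ : Antitone κ) :
    B (symP q t κ) (symP q⁻¹ t⁻¹ κ) =
      (bracketFactorial t (m + 1) / symFactor t (spec q t κ)) •
        B (nonsymm q t κ) (symP q⁻¹ t⁻¹ κ) := by
  set L : MvPolynomial (Fin (m + 1)) K →ₗ[K] V := B.flip (symP q⁻¹ t⁻¹ κ) with hLd
  have hL : ∀ (i : Fin m) f, L (Macdonald.hecke t i f) = t • L f := by
    intro i f
    have h1 := hB.hecke i f (symP q⁻¹ t⁻¹ κ)
    rw [hecke_symP h.inv hκ, map_smul] at h1
    change B (Macdonald.hecke t i f) _ = t • B f _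
    rw [← h1, smul_smul, mul_inv_cancel₀ h.t_ne, one_smul]
  have hv := evalT_nonsymm_ne_zero h κ
  have h1 : ∀ w : Equiv.Perm (Fin (m + 1)), L (symTerm q t κ w) =
      symFactor t (spec q t κ ∘ w) • (evalT t (nonsymm q t κ))⁻¹ • L (nonsymm q t κ) := by
    intro w
    have hw := evalT_nonsymm_ne_zero h (κ ∘ w)
    have h2 := evalT_mul_form_comp h hL κ w
    rw [symTerm, map_smul, div_eq_mul_inv, ← smul_smul]
    congr 1
    rw [inv_smul_eq_iff₀ hw, smul_comm, ← h2, inv_smul_smul₀ hv]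
  change L (symP q t κ) = _ • L (nonsymm q t κ)
  rw [symP, map_smul, symSum, map_sum]
  simp only [h1]
  rw [← Finset.sum_smul, sum_symFactor t h.t_ne_one (spec q t κ) (spec_injective h κ)
    (spec_ne_zero h κ), smul_smul, smul_smul]
  congr 1
  field_simp

theorem nonsymm_symP (hB : IsInvariantForm q t B) (h : Admissible q t) {κ : Fin (m + 1) → ℕ}
    (hκ : Antitone κ) :
    B (nonsymm q t κ) (symP q⁻¹ t⁻¹ κ) = B (nonsymm q t κ) (nonsymm q⁻¹ t⁻¹ κ) := by
  have hg := symFactor_spec_ne_zero h.inv hκ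
  have hv := evalT_nonsymm_ne_zero h.inv κ
  rw [symP, map_smul, symSum, map_sum, Finset.sum_eq_single 1]
  · rw [symTerm, map_smul, smul_smul, Equiv.Perm.coe_one, Function.comp_id, Function.comp_id,
      div_mul_div_cancel₀ hg, div_self hv, one_smul]
  · intro w _ hw
    rw [symTerm, map_smul]
    by_cases h0 : symFactor t⁻¹ (spec q⁻¹ t⁻¹ κ ∘ w) = 0
    · rw [h0, zero_div, zero_smul]
    · rw [hB.eq_zero_of_ne h, smul_zero]
      intro e
      have h1 := spec_comp_of_symFactor_ne_zero hκ h0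
      rw [← e] at h1
      refine hw (Equiv.ext fun k => ?_)
      exact (spec_injective h.inv κ (congrFun h1 k)).symm
  · exact fun h0 => absurd (Finset.mem_univ _) h0

theorem norm_symP (hB : IsInvariantForm q t B) (h : Admissible q t) {κ : Fin (m + 1) → ℕ}
    (hκ : Antitone κ) :
    B (symP q t κ) (symP q⁻¹ t⁻¹ κ) =
      (bConst q t κ * dConst' q t κ / (hConst q t κ * eConst' q t κ)) • B 1 1 := by
  rw [hB.symP_left h hκ, hB.nonsymm_symP h hκ, hB.norm_nonsymm h, smul_smul]
  congr 1
  rw [mul_div_mul_comm (bConst q t κ), ← bracketFactorial_div_symFactor h hκ]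
  have h1 := dConst_ne_zero h κ
  have h2 := eConst'_ne_zero h κ
  have h3 := symFactor_spec_ne_zero h hκ
  field_simp

end IsInvariantForm

end

section

open MvPolynomial MeasureTheory

section Norms

variable {q t : ℝ}

theorem isInvariantForm_pairingForm {m : ℕ} (hq : 0 < q) (hq1 : q < 1) (ht : 0 < t)
    (ht1 : t < 1) :
    IsInvariantForm q t (pairingForm (n := m + 1) hq hq1 ht ht1) where
  hecke := pairing_hecke hq hq1 ht ht1
  rot := pairing_rot hq hq1 ht ht1
  mulX k f g := by
    change pairing q t (X k * f) (X k * g) = pairing q t f g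
    refine constantTerm_congr fun θ => ?_
    have h := torusPt_ne_zero θ k
    simp only [map_mul, aeval_X]
    field_simp

theorem normP_eq {n : ℕ} (hq : 0 < q) (hq1 : q < 1) (ht : 0 < t) (ht1 : t < 1)
    {κ : Fin n → ℕ} (hκ : Antitone κ) :
    normP κ q t = ((bConst q t κ * dConst' q t κ / (hConst q t κ * eConst' q t κ) : ℝ) : ℂ) *
      constantTerm (weight (n := n) q t) := by
  cases n with
  | zero =>
    unfold normP scalarProduct
    simp [macdonaldP_fin_zero, bConst, dConst', hConst, eConst']
  | succ m =>
    have h := generic_real hq hq1 ht ht1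
    have hB := (isInvariantForm_pairingForm (m := m) hq hq1 ht ht1).norm_symP h.toAdmissible hκ
    unfold normP scalarProduct
    beta_reduce
    rw [macdonaldP_eq_symP h hκ, macdonaldP_eq_symP (generic_real_inv hq hq1 ht ht1) hκ]
    refine hB.trans ?_
    rw [Complex.real_smul]
    congr 1
    change pairing q t 1 1 = _
    refine constantTerm_congr fun θ => ?_
    simp

theorem normP_div {n : ℕ} (hq : 0 < q) (hq1 : q < 1) (ht : 0 < t) (ht1 : t < 1)
    {κ : Fin n → ℕ} (hκ : Antitone κ) :
    normP κ q t / normP (0 : Fin n → ℕ) q t =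
      ((bConst q t κ * dConst' q t κ / (hConst q t κ * eConst' q t κ) : ℝ) : ℂ) := by
  have h0 : normP (0 : Fin n → ℕ) q t = constantTerm (weight (n := n) q t) := by
    rw [normP_eq hq hq1 ht ht1 fun _ _ _ => le_rfl]
    simp [bConst, dConst', hConst, eConst']
  rw [h0, normP_eq hq hq1 ht ht1 hκ, mul_div_cancel_right₀ _
    (constantTerm_weight_ne_zero n hq hq1 ht ht1)]

theorem norm_constants_eq {K : Type*} [Field K] {q t : K} (h : Admissible q t) {n : ℕ}
    (η : Fin n → ℕ) :
    bracketMultinomial t η * (dConst' q t (plus η) * eConst q t (incr η) /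
        (dConst q t (incr η) * eConst' q t (incr η))) =
      bConst q t (plus η) * dConst' q t (plus η) /
        (hConst q t (plus η) * eConst' q t (plus η)) := by
  have h1 := bracketMultinomial_mul_div h η (hConst_ne_zero h _) (dConst_ne_zero h _)
  rw [eConst'_incr, mul_div_mul_comm (bConst q t (plus η)), ← h1]
  ring

end Norms

end

end Macdonald

end

theorem propositionP (n : ℕ) (η : Fin n → ℕ) :
    -- the evaluation formula, `q` and `t` being indeterminates
    (∀ (K : Type*) [Field K] [CharZero K] (q t : K), AlgebraicIndependent ℚ ![q, t] →
      MvPolynomial.eval (fun i : Fin n => t ^ (i : ℕ))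
          (Macdonald.macdonaldP q t (Macdonald.plus η)) =
        t ^ Macdonald.legSum (Macdonald.incr η) * Macdonald.bracketMultinomial t⁻¹ η *
          (Macdonald.eConst q t (Macdonald.incr η) / Macdonald.dConst q t (Macdonald.incr η)) ∧
      MvPolynomial.eval (fun i : Fin n => t ^ (i : ℕ))
          (Macdonald.macdonaldP q t (Macdonald.plus η)) =
        t ^ Macdonald.legSum (Macdonald.plus η) *
          (Macdonald.bConst q t (Macdonald.plus η) / Macdonald.hConst q t (Macdonald.plus η))) ∧
    -- both formulas, `q` and `t` being real parameters
    (∀ q t : ℝ, 0 < q → q < 1 → 0 < t → t < 1 →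
      (MvPolynomial.eval (fun i : Fin n => t ^ (i : ℕ))
          (Macdonald.macdonaldP q t (Macdonald.plus η)) =
        t ^ Macdonald.legSum (Macdonald.incr η) * Macdonald.bracketMultinomial t⁻¹ η *
          (Macdonald.eConst q t (Macdonald.incr η) / Macdonald.dConst q t (Macdonald.incr η)) ∧
      MvPolynomial.eval (fun i : Fin n => t ^ (i : ℕ))
          (Macdonald.macdonaldP q t (Macdonald.plus η)) =
        t ^ Macdonald.legSum (Macdonald.plus η) *
          (Macdonald.bConst q t (Macdonald.plus η) / Macdonald.hConst q t (Macdonald.plus η))) ∧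
      (Macdonald.normP (Macdonald.plus η) q t / Macdonald.normP (0 : Fin n → ℕ) q t =
        ((Macdonald.bracketMultinomial t η *
          (Macdonald.dConst' q t (Macdonald.plus η) * Macdonald.eConst q t (Macdonald.incr η) /
            (Macdonald.dConst q t (Macdonald.incr η) *
              Macdonald.eConst' q t (Macdonald.incr η))) : ℝ) : ℂ) ∧
      Macdonald.normP (Macdonald.plus η) q t / Macdonald.normP (0 : Fin n → ℕ) q t =
        ((Macdonald.bConst q t (Macdonald.plus η) * Macdonald.dConst' q t (Macdonald.plus η) /
          (Macdonald.hConst q t (Macdonald.plus η) *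
            Macdonald.eConst' q t (Macdonald.plus η)) : ℝ) : ℂ))) := by
  refine ⟨fun K _ _ q t h => Macdonald.evaluation_formulas
    (Macdonald.generic_of_algebraicIndependent h) η, fun q t hq hq1 ht ht1 => ?_⟩
  have h := Macdonald.generic_real hq hq1 ht ht1
  have h2 := Macdonald.normP_div hq hq1 ht ht1 (Macdonald.plus_antitone η)
  exact ⟨Macdonald.evaluation_formulas h η, by
    rw [Macdonald.norm_constants_eq h.toAdmissible, h2], h2⟩
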